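/- Let $H^2=\{z\in\mathbb C:\operatorname{Im}z>0\}$ be the hyperbolic plane, let $G\subset \mathrm{PSL}_2(\mathbb Z)$ be generated by $[A]=\begin{bmatrix}1&-1\\-1&2\end{bmatrix}$ and $[B]=\begin{bmatrix}1&1\\1&2\end{bmatrix}$, let $M=H^2/G$ be the modular torus (a once-punctured hyperbolic torus), and let $\pi:H^2\to M$ be the projection. For $y\in\mathbb R$ let $g_y$ be the vertical geodesic of $H^2$ joining $y$ and $\infty$. Two geodesics of $M$ intersect if they have a point in common. A rational Markov triple is a triple $(x_1,x_2,x_3)$ of rational numbers $x_i=p_i/q_i$, where $q_1,q_2,q_3$ are positive integers with $q_1^2+q_2^2+q_3^2=3q_1q_2q_3$ and $p_1,p_2,p_3$ are integers with $p_2q_1-p_1q_2=q_3$ and $p_3q_2-p_2q_3=q_1$. A Markov fraction is an element of a rational Markov triple. For a Markov fraction $x=p/q$ in lowest terms ($q>0$) put $$\gamma_k^{\pm}(x)=\frac pq\pm\frac{u_{k-1}}{q\,u_k},\qquad u_0=0,\quad u_1=1,\quad u_{k+1}=3q\,u_k-u_{k-1}.$$ The right companions of $x$ are the numbers $\gamma_k^+(x)$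 with $k\ge 2$, and the left companions of $x$ are the numbers $\gamma_k^-(x)$ with $k\ge2$. **Lemma 4.3.** Let $x$ be a Markov fraction. Then $\pi(g_x)$ is a simple geodesic in $M$ with both ends in the cusp, and there is a unique simple closed geodesic $\eta$ in $M$ that does not intersect $\pi(g_x)$. For every $y\in\mathbb R$: * $y$ is a right companion of $x$ if and only if $y\in[x,x+\frac32]$ and $\pi(g_y)$ is a geodesic with both ends in the cusp that intersects neither $\pi(g_x)$ nor $\eta$; * $y$ is a left companion of $x$ if and only if $y\in[x-\frac32,x]$ and $\pi(g_y)$ is a geodesic with both ends in the cusp that intersects neither $\pi(g_x)$ nor $\eta$. Moreover, for every $k\ge2$ each of the geodesics $\pi(g_{\gamma_k^+(x)})$ and $\pi(g_{\gamma_k^-(x)})$ has exactly $k-1$ self-intersections: there are exactly $k-1$ points of $M$ through which it passes more than once, and it passes exactly twice through each of them. -/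

import Mathlib

open scoped MatrixGroups

noncomputable section

/-! ### Markov fractions and their companions -/

/-- A Markov triple: a positive integer solution of `x² + y² + z² = 3xyz`. -/
def IsMarkovTriple (q₁ q₂ q₃ : ℤ) : Prop :=
  0 < q₁ ∧ 0 < q₂ ∧ 0 < q₃ ∧ q₁ ^ 2 + q₂ ^ 2 + q₃ ^ 2 = 3 * q₁ * q₂ * q₃

/-- A rational Markov triple. -/
def IsRationalMarkovTriple (x₁ x₂ x₃ : ℚ) : Prop :=
  ∃ p₁ p₂ p₃ q₁ q₂ q₃ : ℤ, IsMarkovTriple q₁ q₂ q₃ ∧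
    x₁ = p₁ / q₁ ∧ x₂ = p₂ / q₂ ∧ x₃ = p₃ / q₃ ∧
    p₂ * q₁ - p₁ * q₂ = q₃ ∧ p₃ * q₂ - p₂ * q₃ = q₁

/-- A Markov fraction: an element of some rational Markov triple. -/
def IsMarkovFraction (x : ℚ) : Prop :=
  ∃ x₁ x₂ x₃ : ℚ, IsRationalMarkovTriple x₁ x₂ x₃ ∧ (x = x₁ ∨ x = x₂ ∨ x = x₃)

/-- The sequence `u₀ = 0`, `u₁ = 1`, `u_{k+1} = 3 q u_k - u_{k-1}`. -/
def companionSeq (q : ℤ) : ℕ → ℤ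
  | 0 => 0
  | 1 => 1
  | k + 2 => 3 * q * companionSeq q (k + 1) - companionSeq q k

/-- `γ⁺ₖ(x) = x + u_{k-1} / (q u_k)`, where `q` is the denominator of `x` in lowest terms.
It is a right companion of `x` for `k ≥ 2`. -/
def rightGamma (x : ℚ) (k : ℕ) : ℚ :=
  x + companionSeq x.den (k - 1) / (x.den * companionSeq x.den k)

/-- `γ⁻ₖ(x) = x - u_{k-1} / (q u_k)`, where `q` is the denominator of `x` in lowest terms.
It is a left companion of `x` for `k ≥ 2`. -/
def leftGamma (x : ℚ) (k : ℕ) : ℚ :=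
  x - companionSeq x.den (k - 1) / (x.den * companionSeq x.den k)

/-! ### The modular torus -/

/-- The matrix `A`. -/
def torusMatA : SL(2, ℤ) := ⟨!![1, -1; -1, 2], by norm_num [Matrix.det_fin_two_of]⟩

/-- The matrix `B`. -/
def torusMatB : SL(2, ℤ) := ⟨!![1, 1; 1, 2], by norm_num [Matrix.det_fin_two_of]⟩

/-- The group generated by `A` and `B`. It acts on the upper half-plane by Möbius transformations,
i.e. through its image `⟨[A], [B]⟩` in `PSL(2, ℤ)`. -/
def torusGroup : Subgroup SL(2, ℤ) := Subgroup.closure {torusMatA, torusMatB}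

/-- The modular torus `M`: the quotient of the hyperbolic plane by `⟨[A], [B]⟩`. -/
abbrev ModularTorus : Type := MulAction.orbitRel.Quotient torusGroup UpperHalfPlane

/-- The canonical projection `π` from the hyperbolic plane to the modular torus. -/
def torusProj (z : UpperHalfPlane) : ModularTorus := Quotient.mk'' z

/-- The filter of neighbourhoods of the (unique) cusp of the modular torus; a basis is given by
the images of the half-planes `{Im z ≥ c}`. -/
def torusCusp : Filter ModularTorus := Filter.map torusProj UpperHalfPlane.atImInfty

/-! ### Geodesics

Geodesics in the modular torus are the curves `π ∘ γ`, with `γ` a geodesic line in the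
hyperbolic plane; all geodesics here are parametrized by arc length. -/

/-- The point `y + i eᵗ`. -/
def verticalPoint (y t : ℝ) : UpperHalfPlane := ⟨⟨y, Real.exp t⟩, Real.exp_pos t⟩

/-- The geodesic `t ↦ σ • (i eᵗ)` of the hyperbolic plane. Every unit speed geodesic line of the
hyperbolic plane is of this form for some `σ`, since `SL(2, ℝ)` acts transitively on unit tangent
vectors. -/
def geodesicLine (σ : SL(2, ℝ)) (t : ℝ) : UpperHalfPlane := σ • verticalPoint 0 t

/-- The projection `π(g_y)` of the vertical geodesic `g_y`, joining `y` and `∞`, to the modular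
torus, as a parametrized curve. -/
def projVertical (y t : ℝ) : ModularTorus := torusProj (verticalPoint y t)

/-- A curve in the modular torus has both ends in the cusp. -/
def BothEndsInCusp (c : ℝ → ModularTorus) : Prop :=
  Filter.Tendsto c Filter.atTop torusCusp ∧ Filter.Tendsto c Filter.atBot torusCusp

/-- `η` is (the image of) a simple closed geodesic in the modular torus: it is traced by the
projection `c` of a geodesic line, such that `c` is periodic with some period `ℓ > 0` and has no
coincidences `c s = c t` other than those that are forced by periodicity. -/
def IsSimpleClosedGeodesic (η : Set ModularTorus) : Prop :=
  ∃ σ : SL(2, ℝ), ∃ ℓ : ℝ, 0 < ℓ ∧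
    (∀ s t : ℝ, torusProj (geodesicLine σ s) = torusProj (geodesicLine σ t) ↔
      ∃ n : ℤ, s - t = n * ℓ) ∧
    η = Set.range fun t => torusProj (geodesicLine σ t)

/-- The points through which a curve passes more than once. -/
def selfIntersections (c : ℝ → ModularTorus) : Set ModularTorus :=
  {P | ∃ s t : ℝ, s ≠ t ∧ c s = P ∧ c t = P}

/-- A curve has exactly `n` self-intersections: there are exactly `n` points through which it
passes more than once, and it passes exactly twice through each of them. -/
def HasSelfIntersections (c : ℝ → ModularTorus) (n : ℕ) : Prop :=
  (selfIntersections c).encard = n ∧ ∀ P ∈ selfIntersections c, (c ⁻¹' {P}).encard = 2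

end

/-! Cutting `M` along the arc `π(g_x)` leaves an annulus with core `η`. The half of the annulus
between one boundary curve and the core lifts to a region bounded by the axis of a hyperbolic matrix
`N` and by the edges joining consecutive cusps of the chain `N ^ k • ∞`; these edges are translates
of the arc. A vertical geodesic entering this region from `∞` and meeting neither arc nor core must
end at a cusp of the chain or at an end of the axis, and the latter does not lead to the cusp of `M`
(`not_bothEndsInCusp_axisLeft`). Since `N` has trace `3q` and sends `∞` to `x`, the cusps are `x +
u_{k-1} / (q u_k)`. For `k ≥ 1` they increase from `x` to the near end of the axis, while for `k ≤
-1` they lie beyond its far end; so the interval of length `3/2` selects `k ≥ 1`, and `k = 1` is `x`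
itself.

The self-intersections come from `chord_chord`: a translate of a chord of the chain crosses a chord
only if the translation is a power of `N`, up to sign. The chord from cusp `0` to cusp `k`
interleaves with its translate by `N ^ m` exactly for `0 < |m| < k`, and `m`, `-m` give the same
point with its two times exchanged. This leaves `k - 1` points.

Embeddedness of the arc and uniqueness of `η` rest on arithmetic. A rational Markov triple yields
integral half-turns `E₁, E₂, E₃`, with `Eᵢ` exchanging `∞` and `xᵢ`. Descent in the Markov tree
(`exists_system`) shows that they generate a group `Γ` containing the torus group, with products of
two half-turns in the torus group up to sign. Half-turns about the sides of the ideal triangle `∞,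
x₁, x₂` play ping-pong (`isPingPong_letters`): translates of a side do not cross it, and a
hyperbolic element whose axis avoids the side `∞, x₁` is conjugate to a word without that letter,
hence to a power of `N` up to sign. `IsMarkovArc` collects what the geometry needs. Left companions
follow by the reflection `z ↦ -z̄`. -/

/-! ### Endpoint vectors -/

/-- The symplectic bracket of two vectors of the plane. -/
def br (v w : ℝ × ℝ) : ℝ := v.1 * w.2 - v.2 * w.1

/-- The linear action of an integral matrix on the plane. -/
def act (g : SL(2, ℤ)) (v : ℝ × ℝ) : ℝ × ℝ :=
  ((g 0 0 : ℝ) * v.1 + (g 0 1 : ℝ) * v.2, (g 1 0 : ℝ) * v.1 + (g 1 1 : ℝ) * v.2)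

/-- The geodesics with endpoints `r, s` and `r', s'` cross if and only if this is negative. -/
def crossSign (r s r' s' : ℝ × ℝ) : ℝ := br r r' * br r s' * (br s r' * br s s')

/-- The point at infinity. -/
def vecInf : ℝ × ℝ := (1, 0)

theorem det_entries {R : Type*} [CommRing R] (g : SL(2, R)) :
    g 0 0 * g 1 1 - g 0 1 * g 1 0 = 1 := by
  have := g.det_coe
  rwa [Matrix.det_fin_two] at this

theorem det_entries_real (g : SL(2, ℤ)) :
    (g 0 0 : ℝ) * g 1 1 - g 0 1 * g 1 0 = 1 := by
  exact_mod_cast det_entries g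

theorem sl_ext {R : Type*} [CommRing R] {g h : SL(2, R)} (h00 : g 0 0 = h 0 0)
    (h01 : g 0 1 = h 0 1) (h10 : g 1 0 = h 1 0) (h11 : g 1 1 = h 1 1) : g = h := by
  ext i j
  fin_cases i <;> fin_cases j <;> assumption

section entries
variable {R : Type*} [CommRing R] (g h : SL(2, R))
theorem mul00 : (g * h) 0 0 = g 0 0 * h 0 0 + g 0 1 * h 1 0 := by
  simp [Matrix.mul_apply, Fin.sum_univ_two]
theorem mul01 : (g * h) 0 1 = g 0 0 * h 0 1 + g 0 1 * h 1 1 := by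
  simp [Matrix.mul_apply, Fin.sum_univ_two]
theorem mul10 : (g * h) 1 0 = g 1 0 * h 0 0 + g 1 1 * h 1 0 := by
  simp [Matrix.mul_apply, Fin.sum_univ_two]
theorem mul11 : (g * h) 1 1 = g 1 0 * h 0 1 + g 1 1 * h 1 1 := by
  simp [Matrix.mul_apply, Fin.sum_univ_two]
theorem inv00 : g⁻¹ 0 0 = g 1 1 := by
  simp [Matrix.SpecialLinearGroup.coe_inv, Matrix.adjugate_fin_two]
theorem inv01 : g⁻¹ 0 1 = -g 0 1 := by
  simp [Matrix.SpecialLinearGroup.coe_inv, Matrix.adjugate_fin_two]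
theorem inv10 : g⁻¹ 1 0 = -g 1 0 := by
  simp [Matrix.SpecialLinearGroup.coe_inv, Matrix.adjugate_fin_two]
theorem inv11 : g⁻¹ 1 1 = g 0 0 := by
  simp [Matrix.SpecialLinearGroup.coe_inv, Matrix.adjugate_fin_two]
theorem neg_entry (i j : Fin 2) : (-g) i j = -g i j := by simp
end entries

theorem act_mul (g h : SL(2, ℤ)) (v : ℝ × ℝ) : act (g * h) v = act g (act h v) := by
  simp only [act, mul00, mul01, mul10, mul11]
  push_cast
  ext <;> simp only <;> ring

theorem act_one (v : ℝ × ℝ) : act 1 v = v := by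
  ext <;> simp [act]

theorem act_neg (g : SL(2, ℤ)) (v : ℝ × ℝ) : act (-g) v = -act g v := by
  ext <;> simp [act] <;> ring

theorem act_smul (g : SL(2, ℤ)) (c : ℝ) (v : ℝ × ℝ) : act g (c • v) = c • act g v := by
  ext <;> simp [act] <;> ring

theorem act_add (g : SL(2, ℤ)) (v w : ℝ × ℝ) : act g (v + w) = act g v + act g w := by
  ext <;> simp [act] <;> ring

theorem act_sub (g : SL(2, ℤ)) (v w : ℝ × ℝ) : act g (v - w) = act g v - act g w := by
  ext <;> simp [act] <;> ring

theorem act_inv_act (g : SL(2, ℤ)) (v : ℝ × ℝ) : act g⁻¹ (act g v) = v := by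
  rw [← act_mul, inv_mul_cancel, act_one]

theorem act_act_inv (g : SL(2, ℤ)) (v : ℝ × ℝ) : act g (act g⁻¹ v) = v := by
  rw [← act_mul, mul_inv_cancel, act_one]

theorem act_vecInf (g : SL(2, ℤ)) : act g vecInf = ((g 0 0 : ℝ), (g 1 0 : ℝ)) := by
  ext <;> simp [act, vecInf]

theorem br_act (g : SL(2, ℤ)) (v w : ℝ × ℝ) : br (act g v) (act g w) = br v w := by
  have := det_entries_real g
  simp only [br, act]
  linear_combination (v.1 * w.2 - v.2 * w.1) * this

theorem br_act_left (g : SL(2, ℤ)) (v w : ℝ × ℝ) : br (act g v) w = br v (act g⁻¹ w) := by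
  rw [← br_act g v, act_act_inv]

theorem br_act_right (g : SL(2, ℤ)) (v w : ℝ × ℝ) : br v (act g w) = br (act g⁻¹ v) w := by
  rw [← br_act g _ w, act_act_inv]

theorem br_swap (v w : ℝ × ℝ) : br v w = -br w v := by simp only [br]; ring

theorem br_self (v : ℝ × ℝ) : br v v = 0 := by simp only [br]; ring

theorem br_smul_left (c : ℝ) (v w : ℝ × ℝ) : br (c • v) w = c * br v w := by
  simp [br]; ring

theorem br_smul_right (c : ℝ) (v w : ℝ × ℝ) : br v (c • w) = c * br v w := by
  simp [br]; ring

theorem br_neg_left (v w : ℝ × ℝ) : br (-v) w = -br v w := by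
  simp [br]; ring

theorem br_neg_right (v w : ℝ × ℝ) : br v (-w) = -br v w := by
  simp [br]; ring

theorem br_vecInf_left (v : ℝ × ℝ) : br vecInf v = v.2 := by simp [br, vecInf]

theorem br_vecInf_right (v : ℝ × ℝ) : br v vecInf = -v.2 := by simp [br, vecInf]

theorem crossSign_act (g : SL(2, ℤ)) (r s r' s' : ℝ × ℝ) :
    crossSign (act g r) (act g s) (act g r') (act g s') = crossSign r s r' s' := by
  simp only [crossSign, br_act]

theorem crossSign_act_left (g : SL(2, ℤ)) (r s r' s' : ℝ × ℝ) :
    crossSign (act g r) (act g s) r' s' = crossSign r s (act g⁻¹ r') (act g⁻¹ s') := by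
  simp only [crossSign, br_act_left]

theorem crossSign_comm (r s r' s' : ℝ × ℝ) : crossSign r s r' s' = crossSign r' s' r s := by
  simp only [crossSign, br]; ring

theorem crossSign_swap_left (r s r' s' : ℝ × ℝ) : crossSign r s r' s' = crossSign s r r' s' := by
  simp only [crossSign, br]; ring

theorem crossSign_swap_right (r s r' s' : ℝ × ℝ) : crossSign r s r' s' = crossSign r s s' r' := by
  simp only [crossSign, br]; ring

theorem crossSign_neg_left (r s r' s' : ℝ × ℝ) :
    crossSign (-r) (-s) r' s' = crossSign r s r' s' := by
  simp only [crossSign, br_neg_left]; ring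

theorem crossSign_smul_left (a b : ℝ) (r s r' s' : ℝ × ℝ) :
    crossSign (a • r) (b • s) r' s' = (a * b) ^ 2 * crossSign r s r' s' := by
  simp only [crossSign, br_smul_left]; ring

theorem crossSign_smul_right (a b : ℝ) (r s r' s' : ℝ × ℝ) :
    crossSign r s (a • r') (b • s') = (a * b) ^ 2 * crossSign r s r' s' := by
  simp only [crossSign, br_smul_right]; ring

theorem crossSign_neg_second (r s r' s' : ℝ × ℝ) :
    crossSign r s r' (-s') = crossSign r s r' s' := by
  simp only [crossSign, br_neg_right]; ring

theorem crossSign_act_neg_left (g : SL(2, ℤ)) (r s r' s' : ℝ × ℝ) :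
    crossSign (act (-g) r) (act (-g) s) r' s' = crossSign (act g r) (act g s) r' s' := by
  rw [act_neg, act_neg, crossSign_neg_left]

/-- An eigenvector of an integral matrix with eigenvalue `a`, `a² ≠ 1`, is not `∞`. -/
theorem br_vecInf_ne_zero_of_eigen {w : SL(2, ℤ)} {r : ℝ × ℝ} {a : ℝ} (hr : r ≠ 0)
    (hw : act w r = a • r) (ha : a ^ 2 ≠ 1) : br vecInf r ≠ 0 := by
  intro h
  rw [br_vecInf_left] at h
  have hr1 : r.1 ≠ 0 := fun h1 => hr (Prod.ext h1 h)
  have e1 := congrArg Prod.fst hw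
  have e2 := congrArg Prod.snd hw
  simp only [act, h, Prod.smul_fst, Prod.smul_snd, smul_eq_mul, mul_zero, add_zero] at e1 e2
  have c0 : (w 1 0 : ℝ) = 0 := by simpa [hr1] using e2
  have a0 : (w 0 0 : ℝ) = a := mul_right_cancel₀ hr1 e1
  have c0' : w 1 0 = 0 := by exact_mod_cast c0
  have hd := det_entries w
  rw [c0', mul_zero, sub_zero] at hd
  have hsq : (w 0 0) ^ 2 = 1 := by
    rcases Int.isUnit_iff.mp (IsUnit.of_mul_eq_one _ hd) with h' | h' <;> rw [h'] <;> norm_num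
  apply ha
  rw [← a0]
  exact_mod_cast hsq

/-! ### Geodesics -/

/-- The endpoint at time `+∞` of a geodesic line. -/
def headVec (σ : SL(2, ℝ)) : ℝ × ℝ := (σ 0 0, σ 1 0)

/-- The endpoint at time `-∞` of a geodesic line. -/
def tailVec (σ : SL(2, ℝ)) : ℝ × ℝ := (σ 0 1, σ 1 1)

theorem br_head_tail (σ : SL(2, ℝ)) : br (headVec σ) (tailVec σ) = 1 := by
  have := det_entries σ
  simp only [br, headVec, tailVec]
  linarith

/-- The real matrix of an integral matrix. -/
def toReal (g : SL(2, ℤ)) : SL(2, ℝ) := Matrix.SpecialLinearGroup.map (Int.castRingHom ℝ) g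

theorem toReal_apply (g : SL(2, ℤ)) (i j : Fin 2) : toReal g i j = (g i j : ℝ) := by
  simp [toReal]

theorem headVec_toReal_mul (g : SL(2, ℤ)) (σ : SL(2, ℝ)) :
    headVec (toReal g * σ) = act g (headVec σ) := by
  simp [headVec, act, mul00, mul10, toReal_apply]

theorem tailVec_toReal_mul (g : SL(2, ℤ)) (σ : SL(2, ℝ)) :
    tailVec (toReal g * σ) = act g (tailVec σ) := by
  simp [tailVec, act, mul01, mul11, toReal_apply]

theorem toReal_smul (g : SL(2, ℤ)) (z : UpperHalfPlane) : toReal g • z = g • z := by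
  ext1
  rw [UpperHalfPlane.coe_specialLinearGroup_apply, UpperHalfPlane.coe_specialLinearGroup_apply]
  simp [toReal_apply]

theorem smul_geodesicLine (g : SL(2, ℤ)) (σ : SL(2, ℝ)) (t : ℝ) :
    g • geodesicLine σ t = geodesicLine (toReal g * σ) t := by
  rw [geodesicLine, geodesicLine, mul_smul, toReal_smul]

/-- The two equations are the real and imaginary parts of the Möbius equation after clearing the
denominator. -/
theorem sl_smul_vertical_iff (M : SL(2, ℝ)) (t s : ℝ) :
    M • verticalPoint 0 t = verticalPoint 0 s ↔
      M 0 1 = -M 1 0 * (Real.exp s * Real.exp t) ∧ M 0 0 * Real.exp t = M 1 1 * Real.exp s := by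
  rw [UpperHalfPlane.ext_iff, UpperHalfPlane.coe_specialLinearGroup_apply]
  have hz : ((verticalPoint 0 t : UpperHalfPlane) : ℂ) = Complex.I * (Real.exp t : ℝ) := by
    apply Complex.ext <;> simp [verticalPoint, -Complex.ofReal_exp]
  have hz' : ((verticalPoint 0 s : UpperHalfPlane) : ℂ) = Complex.I * (Real.exp s : ℝ) := by
    apply Complex.ext <;> simp [verticalPoint, -Complex.ofReal_exp]
  rw [hz, hz']
  have hne : ((algebraMap ℝ ℝ (M 1 0) : ℝ) : ℂ) * (Complex.I * (Real.exp t : ℝ)) +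
      ((algebraMap ℝ ℝ (M 1 1) : ℝ) : ℂ) ≠ 0 := by
    intro h
    have h1 := congrArg Complex.re h
    have h2 := congrArg Complex.im h
    simp only [Complex.add_re, Complex.add_im, Complex.mul_re, Complex.mul_im, Complex.ofReal_re,
      Complex.ofReal_im, Complex.I_re, Complex.I_im, Algebra.algebraMap_self, RingHom.id_apply,
      Complex.zero_re, Complex.zero_im] at h1 h2
    have h3 : M 1 0 = 0 := by
      have := Real.exp_pos t
      have h4 : M 1 0 * Real.exp t = 0 := by linarith
      rcases mul_eq_zero.mp h4 with h | h
      · exact h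
      · linarith
    have h4 : M 1 1 = 0 := by linarith
    have := det_entries M
    rw [h3, h4] at this
    norm_num at this
  rw [div_eq_iff hne, Complex.ext_iff]
  simp only [Complex.add_re, Complex.add_im, Complex.mul_re, Complex.mul_im, Complex.ofReal_re,
      Complex.ofReal_im, Complex.I_re, Complex.I_im, Algebra.algebraMap_self, RingHom.id_apply]
  constructor
  · rintro ⟨h1, h2⟩
    exact ⟨by linarith, by linarith⟩
  · rintro ⟨h1, h2⟩
    exact ⟨by linarith, by linarith⟩

/-- The condition for two geodesic lines to meet at given times. -/
theorem geodesicLine_eq_iff (σ τ : SL(2, ℝ)) (t s : ℝ) :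
    geodesicLine σ t = geodesicLine τ s ↔
      br (tailVec σ) (tailVec τ) =
          -br (headVec τ) (headVec σ) * (Real.exp s * Real.exp t) ∧
        br (headVec σ) (tailVec τ) * Real.exp t = br (headVec τ) (tailVec σ) * Real.exp s := by
  have : geodesicLine σ t = geodesicLine τ s ↔
      (τ⁻¹ * σ) • verticalPoint 0 t = verticalPoint 0 s := by
    rw [mul_smul, inv_smul_eq_iff]; rfl
  rw [this, sl_smul_vertical_iff]
  simp only [mul00, mul01, mul10, mul11, inv00, inv01, inv10, inv11, br, headVec, tailVec]
  constructor
  · rintro ⟨h1, h2⟩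
    exact ⟨by linarith, by linarith⟩
  · rintro ⟨h1, h2⟩
    exact ⟨by linarith, by linarith⟩

/-- Two geodesic lines that meet cross each other or have the same endpoints. -/
theorem cross_or_same {σ τ : SL(2, ℝ)} {t s : ℝ} (h : geodesicLine σ t = geodesicLine τ s) :
    crossSign (headVec σ) (tailVec σ) (headVec τ) (tailVec τ) < 0 ∨
      (br (headVec σ) (tailVec τ) = 0 ∧ br (headVec τ) (tailVec σ) = 0) ∨
      (br (headVec τ) (headVec σ) = 0 ∧ br (tailVec σ) (tailVec τ) = 0) := by
  obtain ⟨h1, h2⟩ := (geodesicLine_eq_iff σ τ t s).mp h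
  have hT := Real.exp_pos t
  have hS := Real.exp_pos s
  set a := br (headVec σ) (tailVec τ)
  set c := br (headVec τ) (headVec σ)
  set d := br (headVec τ) (tailVec σ)
  by_cases ha : a = 0
  · right; left
    refine ⟨ha, ?_⟩
    rw [ha, zero_mul] at h2
    rcases mul_eq_zero.mp h2.symm with h | h
    · exact h
    · linarith
  by_cases hc : c = 0
  · right; right
    exact ⟨hc, by rw [h1, hc]; ring⟩
  left
  -- The two meeting equations turn the cross sign into minus a square, up to positive factors.
  have : crossSign (headVec σ) (tailVec σ) (headVec τ) (tailVec τ) * Real.exp s =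
      - (a ^ 2 * c ^ 2 * Real.exp t ^ 2 * Real.exp s) := by
    simp only [crossSign]
    rw [br_swap (headVec σ) (headVec τ), br_swap (tailVec σ) (headVec τ), h1]
    change -c * a * (-d * (-c * (Real.exp s * Real.exp t))) * Real.exp s = _
    calc _ = -(c * a * (d * Real.exp s) * c * Real.exp s * Real.exp t) := by ring
      _ = _ := by rw [← h2]; ring
  have h3 : 0 < a ^ 2 * c ^ 2 * Real.exp t ^ 2 * Real.exp s := by positivity
  nlinarith

/-- The Plücker relation of four vectors in the plane; with both brackets on the right equal to `1`
it is the determinant of `τ⁻¹ * σ`. -/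
theorem br_plucker (σ τ : SL(2, ℝ)) :
    br (headVec σ) (tailVec τ) * br (headVec τ) (tailVec σ) -
      br (tailVec σ) (tailVec τ) * br (headVec τ) (headVec σ) =
      br (headVec σ) (tailVec σ) * br (headVec τ) (tailVec τ) := by
  simp only [br]; ring

/-- Crossing geodesic lines meet. -/
theorem meet_of_crossSign {σ τ : SL(2, ℝ)}
    (h : crossSign (headVec σ) (tailVec σ) (headVec τ) (tailVec τ) < 0) :
    ∃ t s, geodesicLine σ t = geodesicLine τ s := by
  have hσ := br_head_tail σ
  have hτ := br_head_tail τ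
  have hdet : br (headVec σ) (tailVec τ) * br (headVec τ) (tailVec σ) -
      br (tailVec σ) (tailVec τ) * br (headVec τ) (headVec σ) = 1 := by
    exact (br_plucker σ τ).trans (by rw [hσ, hτ, one_mul])
  simp only [geodesicLine_eq_iff]
  simp only [crossSign] at h
  rw [br_swap (headVec σ) (headVec τ), br_swap (tailVec σ) (headVec τ)] at h
  set a := br (headVec σ) (tailVec τ)
  set b := br (tailVec σ) (tailVec τ)
  set c := br (headVec τ) (headVec σ)
  set d := br (headVec τ) (tailVec σ)
  have h' : (a * d) * (b * c) < 0 := by linarith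
  -- As `ad - bc = 1`, a negative product `(ad)(bc)` forces `ad > 0 > bc`.
  have had : 0 < a * d := by
    by_contra hn
    have : 0 < b * c := by
      rcases lt_or_ge 0 (b * c) with h | h
      · exact h
      · nlinarith
    linarith
  have hbc : b * c < 0 := by nlinarith
  have ha : a ≠ 0 := fun h => by simp [h] at had
  have hd : d ≠ 0 := fun h => by simp [h] at had
  have hc : c ≠ 0 := fun h => by simp [h] at hbc
  -- Eliminating `e^s` from the meeting equations leaves `e^{2t} = -bd/(ac)` and `e^s = (a/d) e^t`.
  have q1 : 0 < -b * d / (a * c) := by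
    have : -b * d / (a * c) = (-(b * c)) * (a * d) / (a * c) ^ 2 := by field_simp
    rw [this]
    have : 0 < -(b * c) := by linarith
    positivity
  have q2 : 0 < a / d := by
    have : a / d = a * d / d ^ 2 := by field_simp
    rw [this]; positivity
  refine ⟨Real.log (Real.sqrt (-b * d / (a * c))),
    Real.log (a * Real.sqrt (-b * d / (a * c)) / d), ?_⟩
  have hs := Real.sqrt_pos.mpr q1
  rw [Real.exp_log hs, Real.exp_log (by rw [mul_div_right_comm]; positivity)]
  have hsq := Real.mul_self_sqrt q1.le
  constructor
  · calc b = -c * (a / d * (-b * d / (a * c))) := by field_simp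
      _ = -c * (a / d * (Real.sqrt (-b * d / (a * c)) * Real.sqrt (-b * d / (a * c)))) := by
        rw [hsq]
      _ = _ := by ring
  · field_simp

/-- The matrix of the vertical geodesic ending at `y`. -/
def vertMat (y : ℝ) : SL(2, ℝ) := ⟨!![1, y; 0, 1], by simp [Matrix.det_fin_two_of]⟩

/-- The vector of the real point `y`. -/
def vecOf (y : ℝ) : ℝ × ℝ := (y, 1)

theorem headVec_vertMat (y : ℝ) : headVec (vertMat y) = vecInf := by
  simp [headVec, vertMat, vecInf]

theorem tailVec_vertMat (y : ℝ) : tailVec (vertMat y) = vecOf y := by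
  simp [tailVec, vertMat, vecOf]

theorem verticalPoint_eq (y t : ℝ) : verticalPoint y t = geodesicLine (vertMat y) t := by
  ext1
  rw [geodesicLine, UpperHalfPlane.coe_specialLinearGroup_apply]
  apply Complex.ext <;> simp [verticalPoint, vertMat]

/-- Geodesic lines with the same endpoints have the same points. -/
theorem range_geodesicLine_eq {σ τ : SL(2, ℝ)}
    (h : (br (headVec σ) (tailVec τ) = 0 ∧ br (headVec τ) (tailVec σ) = 0) ∨
      (br (headVec τ) (headVec σ) = 0 ∧ br (tailVec σ) (tailVec τ) = 0)) :
    Set.range (geodesicLine σ) = Set.range (geodesicLine τ) := by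
  have key : ∀ σ τ : SL(2, ℝ),
      ((br (headVec σ) (tailVec τ) = 0 ∧ br (headVec τ) (tailVec σ) = 0) ∨
      (br (headVec τ) (headVec σ) = 0 ∧ br (tailVec σ) (tailVec τ) = 0)) →
      Set.range (geodesicLine σ) ⊆ Set.range (geodesicLine τ) := by
    intro σ τ h
    rintro _ ⟨t, rfl⟩
    have hσ := br_head_tail σ
    have hτ := br_head_tail τ
    have hdet : br (headVec σ) (tailVec τ) * br (headVec τ) (tailVec σ) -
        br (tailVec σ) (tailVec τ) * br (headVec τ) (headVec σ) = 1 := by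
      exact (br_plucker σ τ).trans (by rw [hσ, hτ, one_mul])
    simp only [Set.mem_range]
    simp only [eq_comm (b := geodesicLine σ t), geodesicLine_eq_iff]
    set a := br (headVec σ) (tailVec τ)
    set b := br (tailVec σ) (tailVec τ)
    set c := br (headVec τ) (headVec σ)
    set d := br (headVec τ) (tailVec σ)
    rcases h with ⟨ha, hd⟩ | ⟨hc, hb⟩
    · rw [ha, hd] at hdet ⊢
      have hc : c ≠ 0 := fun h => by simp [h] at hdet
      have h0 : 0 < b ^ 2 := by
        have : b ≠ 0 := fun h => by simp [h] at hdet
        positivity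
      refine ⟨Real.log (b ^ 2 / Real.exp t), ?_, by ring⟩
      rw [Real.exp_log (div_pos h0 (Real.exp_pos t))]
      have := (Real.exp_pos t).ne'
      field_simp
      linear_combination (-b) * hdet
    · rw [hc, hb] at hdet ⊢
      have ha : a ≠ 0 := fun h => by simp [h] at hdet
      have h0 : 0 < a ^ 2 := by positivity
      refine ⟨Real.log (a ^ 2 * Real.exp t), by ring, ?_⟩
      rw [Real.exp_log (mul_pos h0 (Real.exp_pos t))]
      linear_combination (-(a * Real.exp t)) * hdet
  refine subset_antisymm (key σ τ h) (key τ σ ?_)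
  rcases h with ⟨ha, hd⟩ | ⟨hc, hb⟩
  · exact Or.inl ⟨hd, ha⟩
  · exact Or.inr ⟨by rw [br_swap, hc, neg_zero], by rw [br_swap, hb, neg_zero]⟩

/-! ### The torus group up to sign -/

/-- The elements of `SL(2, ℤ)` that belong to the torus group up to sign. -/
def torusGroupPM : Subgroup SL(2, ℤ) where
  carrier := {g | g ∈ torusGroup ∨ -g ∈ torusGroup}
  mul_mem' := by
    rintro a b (ha | ha) (hb | hb)
    · exact Or.inl (mul_mem ha hb)
    · exact Or.inr (by rw [← mul_neg]; exact mul_mem ha hb)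
    · exact Or.inr (by rw [← neg_mul]; exact mul_mem ha hb)
    · exact Or.inl (by rw [← neg_mul_neg]; exact mul_mem ha hb)
  one_mem' := Or.inl (one_mem _)
  inv_mem' := by
    rintro a (ha | ha)
    · exact Or.inl (inv_mem ha)
    · exact Or.inr (by rw [← inv_neg]; exact inv_mem ha)

theorem neg_mem_torusGroupPM {g : SL(2, ℤ)} (h : g ∈ torusGroupPM) : -g ∈ torusGroupPM := by
  rcases h with h | h
  · exact Or.inr (by rwa [neg_neg])
  · exact Or.inl h

theorem torusProj_eq_iff (z z' : UpperHalfPlane) :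
    torusProj z = torusProj z' ↔ ∃ w ∈ torusGroup, w • z' = z := by
  rw [torusProj, torusProj, Quotient.eq'', MulAction.orbitRel_apply, MulAction.mem_orbit_iff]
  constructor
  · rintro ⟨g, hg⟩
    exact ⟨g, g.2, hg⟩
  · rintro ⟨w, hw, h⟩
    exact ⟨⟨w, hw⟩, h⟩

theorem torusProj_smul {w : SL(2, ℤ)} (hw : w ∈ torusGroupPM) (z : UpperHalfPlane) :
    torusProj (w • z) = torusProj z := by
  rw [torusProj_eq_iff]
  rcases hw with hw | hw
  · exact ⟨w, hw, rfl⟩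
  · exact ⟨-w, hw, by rw [ModularGroup.SL_neg_smul]⟩

/-! ### Integral involutions -/

/-- The translation `z ↦ z + n`. -/
abbrev transl (n : ℤ) : SL(2, ℤ) := ModularGroup.T ^ n

theorem transl00 (n : ℤ) : transl n 0 0 = 1 := by
  have := ModularGroup.coe_T_zpow n
  simp [this]
theorem transl01 (n : ℤ) : transl n 0 1 = n := by
  have := ModularGroup.coe_T_zpow n
  simp [this]
theorem transl10 (n : ℤ) : transl n 1 0 = 0 := by
  have := ModularGroup.coe_T_zpow n
  simp [this]
theorem transl11 (n : ℤ) : transl n 1 1 = 1 := by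
  have := ModularGroup.coe_T_zpow n
  simp [this]

/-- Cayley–Hamilton with trace `0` and determinant `1`. -/
theorem mul_self_of_trace_zero {E : SL(2, ℤ)} (h : E 1 1 = -E 0 0) : E * E = -1 := by
  have hd := det_entries E
  rw [h] at hd
  apply sl_ext
  · rw [mul00, neg_entry, Matrix.SpecialLinearGroup.coe_one]; simp; linarith
  · rw [mul01, neg_entry, Matrix.SpecialLinearGroup.coe_one, h]; simp; ring
  · rw [mul10, neg_entry, Matrix.SpecialLinearGroup.coe_one, h]; simp; ring
  · rw [mul11, neg_entry, Matrix.SpecialLinearGroup.coe_one, h]; simp; linarith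

theorem inv_of_trace_zero {E : SL(2, ℤ)} (h : E 1 1 = -E 0 0) : E⁻¹ = -E := by
  rw [inv_eq_iff_mul_eq_one, mul_neg, mul_self_of_trace_zero h, neg_neg]

/-- Integral data of a rational Markov triple. -/
def IsTriple (p₁ q₁ p₂ q₂ p₃ q₃ : ℤ) : Prop :=
  IsMarkovTriple q₁ q₂ q₃ ∧ p₂ * q₁ - p₁ * q₂ = q₃ ∧ p₃ * q₂ - p₂ * q₃ = q₁

/-- `E` is the integral elliptic involution that exchanges `∞` and `p / q`. -/
def IsInvolution (p q : ℤ) (E : SL(2, ℤ)) : Prop := E 0 0 = p ∧ E 1 0 = q ∧ E 1 1 = -p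

theorem IsInvolution.trace {p q : ℤ} {E : SL(2, ℤ)} (h : IsInvolution p q E) :
    E 1 1 = -E 0 0 := by rw [h.1, h.2.2]

theorem IsInvolution.det {p q : ℤ} {E : SL(2, ℤ)} (h : IsInvolution p q E) :
    q * E 0 1 = -(p ^ 2 + 1) := by
  have := det_entries E
  rw [h.1, h.2.1, h.2.2] at this
  linarith

/-- Conjugation by a translation moves an elliptic involution. -/
theorem IsInvolution.conj_transl {p q : ℤ} {E : SL(2, ℤ)} (h : IsInvolution p q E) (n : ℤ) :
    IsInvolution (p + n * q) q (transl n * E * transl (-n)) := by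
  obtain ⟨h1, h2, h3⟩ := h
  refine ⟨?_, ?_, ?_⟩
  · simp only [mul00, mul01, transl00, transl01, transl10, h1, h2]; ring
  · simp only [mul10, mul11, transl00, transl10, transl11, h2]; ring
  · simp only [mul10, mul11, transl01, transl10, transl11, h2, h3]; ring

/-! ### Systems of half-turns attached to Markov triples, and their mutations -/

/-- A system of three elliptic involutions that is adapted to a rational Markov triple and to the
torus group. -/
structure IsSystem (p₁ q₁ p₂ q₂ p₃ q₃ : ℤ) (E₁ E₂ E₃ : SL(2, ℤ)) : Prop where
  inv₁ : IsInvolution p₁ q₁ E₁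
  inv₂ : IsInvolution p₂ q₂ E₂
  inv₃ : IsInvolution p₃ q₃ E₃
  even₁₂ : E₁ * E₂ ∈ torusGroupPM
  even₂₃ : E₂ * E₃ ∈ torusGroupPM
  gen : torusGroup ≤ Subgroup.closure {E₁, E₂, E₃}

section prod
variable {p₁ q₁ p₂ q₂ p₃ q₃ : ℤ} {E₁ E₂ E₃ : SL(2, ℤ)}

/-- Multiply by `q₂` and insert the Markov equation. Thus `x₃` falls short of `x₁ + 3` by `q₂ / (q₁
q₃)`, which lets the triple be continued with period `3`. -/
theorem IsTriple.det₁₃ (h : IsTriple p₁ q₁ p₂ q₂ p₃ q₃) :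
    p₃ * q₁ - p₁ * q₃ = 3 * q₁ * q₃ - q₂ := by
  obtain ⟨⟨h1, h2, h3, hm⟩, h12, h23⟩ := h
  apply mul_left_cancel₀ h2.ne'
  linear_combination q₁ * h23 + q₃ * h12 + hm

/-- Rotation serves to put any of the three fractions first, and the largest denominator in the
middle. -/
theorem IsTriple.rot (h : IsTriple p₁ q₁ p₂ q₂ p₃ q₃) :
    IsTriple p₂ q₂ p₃ q₃ (p₁ + 3 * q₁) q₁ := by
  have h13 := h.det₁₃
  obtain ⟨⟨h1, h2, h3, hm⟩, h12, h23⟩ := h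
  exact ⟨⟨h2, h3, h1, by linarith⟩, h23, by linarith⟩

/-- Up to sign this product is the hyperbolic element `N` of the arc at `x₁`: it sends `∞` to `x₁`
and has trace `-3q₁`. -/
theorem prod23_entries (h : IsTriple p₁ q₁ p₂ q₂ p₃ q₃) (i2 : IsInvolution p₂ q₂ E₂)
    (i3 : IsInvolution p₃ q₃ E₃) :
    (E₂ * E₃) 0 0 = p₁ ∧ (E₂ * E₃) 1 0 = q₁ ∧ (E₂ * E₃) 1 1 = -(p₁ + 3 * q₁) := by
  have h13 := h.det₁₃
  obtain ⟨⟨h1, h2, h3, hm⟩, h12, h23⟩ := h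
  have d2 := i2.det
  have d3 := i3.det
  obtain ⟨a2, b2, c2⟩ := i2
  obtain ⟨a3, b3, c3⟩ := i3
  refine ⟨?_, ?_, ?_⟩
  · rw [mul00, a2, a3, b3]
    apply mul_left_cancel₀ h2.ne'
    linear_combination p₂ * h23 + h12 + q₃ * d2
  · rw [mul10, b2, a3, c2, b3]; linarith
  · rw [mul11, b2, c2, c3]
    apply mul_left_cancel₀ h3.ne'
    linear_combination (-p₃) * h23 + q₂ * d3 - h13

/-- The relation at the cusp: the three half-turns compose to a parabolic element fixing `∞`. -/
theorem prod123 (h : IsTriple p₁ q₁ p₂ q₂ p₃ q₃) (i1 : IsInvolution p₁ q₁ E₁)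
    (i2 : IsInvolution p₂ q₂ E₂) (i3 : IsInvolution p₃ q₃ E₃) :
    E₁ * (E₂ * E₃) = -transl (-3) := by
  obtain ⟨n0, n1, n2⟩ := prod23_entries h i2 i3
  have hd := det_entries (E₂ * E₃)
  have hq := h.1.1
  have d1 := i1.det
  obtain ⟨a1, b1, c1⟩ := i1
  rw [n0, n1, n2] at hd
  apply sl_ext
  · rw [mul00, neg_entry, n0, n1, a1, transl00]; linarith
  · rw [mul01, neg_entry, n2, a1, transl01]
    apply mul_left_cancel₀ hq.ne'
    linear_combination (-p₁) * hd - (p₁ + 3 * q₁) * d1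
  · rw [mul10, neg_entry, n0, n1, b1, c1, transl10]; ring
  · rw [mul11, neg_entry, n2, b1, c1, transl11]; linarith

theorem neg_one_mem_of_trace_zero {H : Subgroup SL(2, ℤ)} (hE : E₁ ∈ H) (h : E₁ 1 1 = -E₁ 0 0) :
    (-1 : SL(2, ℤ)) ∈ H := by
  rw [← mul_self_of_trace_zero h]; exact mul_mem hE hE

/-- By `prod123`, conjugating `E₁` by `transl (-3)` is the same as conjugating it by `E₂ * E₃`, so
both the evenness conditions and generation survive. -/
theorem IsSystem.rot_back (h : IsTriple p₁ q₁ p₂ q₂ p₃ q₃)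
    (s : IsSystem p₂ q₂ p₃ q₃ (p₁ + 3 * q₁) q₁ E₂ E₃ E₁) :
    IsSystem p₁ q₁ p₂ q₂ p₃ q₃ (transl (-3) * E₁ * transl 3) E₂ E₃ := by
  have hp := prod123 h.rot s.inv₁ s.inv₂ s.inv₃
  have hN : transl (-3) * E₁ * transl 3 = (E₂ * E₃) * E₁ * (E₂ * E₃)⁻¹ := by
    have h1 : E₂ * E₃ = -transl (-3) * E₁⁻¹ := by rw [← hp]; group
    rw [h1]
    simp only [mul_inv_rev, inv_inv, mul_neg, neg_mul, inv_neg, neg_neg]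
    simp only [transl]
    group
  have e1 := inv_of_trace_zero s.inv₃.trace
  have e3 := inv_of_trace_zero s.inv₂.trace
  have e2 := inv_of_trace_zero s.inv₁.trace
  have sq2 := mul_self_of_trace_zero s.inv₁.trace
  refine ⟨?_, s.inv₁, s.inv₂, ?_, s.even₁₂, ?_⟩
  · have := s.inv₃.conj_transl (-3)
    rw [neg_neg] at this
    convert this using 1
    ring
  · have : transl (-3) * E₁ * transl 3 * E₂ = -((E₂ * E₃) * (E₃ * E₁)⁻¹) := by
      rw [hN]
      simp only [mul_inv_rev, e1, e2, e3, mul_neg, neg_mul, neg_neg]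
      rw [show E₂ * E₃ * E₁ * (E₃ * E₂) * E₂ = (E₂ * E₃) * (E₁ * E₃) * (E₂ * E₂) by group, sq2]
      simp
    rw [this]
    exact neg_mem_torusGroupPM (mul_mem s.even₁₂ (inv_mem s.even₂₃))
  · refine s.gen.trans ((Subgroup.closure_le _).mpr ?_)
    have m2 : E₂ ∈ Subgroup.closure {transl (-3) * E₁ * transl 3, E₂, E₃} :=
      Subgroup.subset_closure (by simp)
    have m3 : E₃ ∈ Subgroup.closure {transl (-3) * E₁ * transl 3, E₂, E₃} :=
      Subgroup.subset_closure (by simp)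
    have m1 : transl (-3) * E₁ * transl 3 ∈
        Subgroup.closure {transl (-3) * E₁ * transl 3, E₂, E₃} :=
      Subgroup.subset_closure (by simp)
    have m1' : E₁ ∈ Subgroup.closure {transl (-3) * E₁ * transl 3, E₂, E₃} := by
      have : E₁ = (E₂ * E₃)⁻¹ * (transl (-3) * E₁ * transl 3) * (E₂ * E₃) := by
        rw [hN]; group
      have m := mul_mem (mul_mem (inv_mem (mul_mem m2 m3)) m1) (mul_mem m2 m3)
      rwa [← this] at m
    rintro _ (rfl | rfl | rfl)
    exacts [m2, m3, m1']

/-- Cayley–Hamilton for `X * Y`, together with `Y⁻¹ = -Y`, gives `XYX = tr(XY) X + Y`. -/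
theorem triple_conj_entries {X Y : SL(2, ℤ)} (hX : X 1 1 = -X 0 0) (hY : Y 1 1 = -Y 0 0) :
    (X * Y * X) 0 0 = ((X * Y) 0 0 + (X * Y) 1 1) * X 0 0 + Y 0 0 ∧
      (X * Y * X) 1 0 = ((X * Y) 0 0 + (X * Y) 1 1) * X 1 0 + Y 1 0 ∧
      (X * Y * X) 1 1 = -(((X * Y) 0 0 + (X * Y) 1 1) * X 0 0 + Y 0 0) := by
  have dX := det_entries X
  rw [hX] at dX
  simp only [mul00, mul01, mul10, mul11, hX, hY]
  refine ⟨?_, ?_, ?_⟩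
  · linear_combination Y 0 0 * dX
  · linear_combination Y 1 0 * dX
  · linear_combination (-Y 0 0) * dX

/-- The mutation of a rational Markov triple at its middle entry. -/
theorem IsTriple.mutate (h : IsTriple p₁ q₁ p₂ q₂ p₃ q₃) (hpos : 0 < 3 * q₁ * q₃ - q₂) :
    IsTriple p₁ q₁ p₃ q₃ (3 * q₁ * p₃ - p₂) (3 * q₁ * q₃ - q₂) := by
  have h13 := h.det₁₃
  obtain ⟨⟨h1, h2, h3, hm⟩, h12, h23⟩ := h
  exact ⟨⟨h1, h3, hpos, by linear_combination hm⟩, h13, by linear_combination h23⟩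

/-- Undoing the mutation: by `triple_conj_entries` the conjugate is `3q₁E₃ - E₄`, whose first column
is `(p₂, q₂)`. -/
theorem IsSystem.of_mutate {E₄ : SL(2, ℤ)} (h : IsTriple p₁ q₁ p₂ q₂ p₃ q₃)
    (hpos : 0 < 3 * q₁ * q₃ - q₂)
    (s : IsSystem p₁ q₁ p₃ q₃ (3 * q₁ * p₃ - p₂) (3 * q₁ * q₃ - q₂) E₁ E₃ E₄) :
    IsSystem p₁ q₁ p₂ q₂ p₃ q₃ E₁ (E₃ * E₄ * E₃⁻¹) E₃ := by
  obtain ⟨n0, n1, n2⟩ := prod23_entries (h.mutate hpos) s.inv₂ s.inv₃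
  obtain ⟨t0, t1, t2⟩ := triple_conj_entries s.inv₂.trace s.inv₃.trace
  have e3 := inv_of_trace_zero s.inv₂.trace
  rw [n0, n2, s.inv₂.1, s.inv₃.1] at t0 t2
  rw [n0, n2, s.inv₂.2.1, s.inv₃.2.1] at t1
  refine ⟨s.inv₁, ⟨?_, ?_, ?_⟩, s.inv₂, ?_, ?_, ?_⟩
  · rw [e3, mul_neg, neg_entry, t0]; ring
  · rw [e3, mul_neg, neg_entry, t1]; ring
  · rw [e3, mul_neg, neg_entry, t2]; ring
  · have : E₁ * (E₃ * E₄ * E₃⁻¹) = -(E₁ * E₃ * (E₃ * E₄)⁻¹) := by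
      rw [mul_inv_rev, inv_of_trace_zero s.inv₃.trace, e3]
      simp [mul_assoc]
    rw [this]
    exact neg_mem_torusGroupPM (mul_mem s.even₁₂ (inv_mem s.even₂₃))
  · simpa using s.even₂₃
  · refine s.gen.trans ((Subgroup.closure_le _).mpr ?_)
    have m1 : E₁ ∈ Subgroup.closure {E₁, E₃ * E₄ * E₃⁻¹, E₃} := Subgroup.subset_closure (by simp)
    have m3 : E₃ ∈ Subgroup.closure {E₁, E₃ * E₄ * E₃⁻¹, E₃} := Subgroup.subset_closure (by simp)
    have m2 : E₃ * E₄ * E₃⁻¹ ∈ Subgroup.closure {E₁, E₃ * E₄ * E₃⁻¹, E₃} :=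
      Subgroup.subset_closure (by simp)
    have m4 : E₄ ∈ Subgroup.closure {E₁, E₃ * E₄ * E₃⁻¹, E₃} := by
      have : E₄ = E₃⁻¹ * (E₃ * E₄ * E₃⁻¹) * E₃ := by group
      have m := mul_mem (mul_mem (inv_mem m3) m2) m3
      rwa [← this] at m
    rintro _ (rfl | rfl | rfl)
    exacts [m1, m3, m4]

end prod

/-! ### The base triples -/

theorem torusMatA_entries : torusMatA 0 0 = 1 ∧ torusMatA 0 1 = -1 ∧ torusMatA 1 0 = -1 ∧
    torusMatA 1 1 = 2 := by simp [torusMatA]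

theorem torusMatB_entries : torusMatB 0 0 = 1 ∧ torusMatB 0 1 = 1 ∧ torusMatB 1 0 = 1 ∧
    torusMatB 1 1 = 2 := by simp [torusMatB]

theorem torusMatA_mem : torusMatA ∈ torusGroup := Subgroup.subset_closure (by simp)
theorem torusMatB_mem : torusMatB ∈ torusGroup := Subgroup.subset_closure (by simp)

theorem T_entries : ModularGroup.T 0 0 = 1 ∧ ModularGroup.T 0 1 = 1 ∧ ModularGroup.T 1 0 = 0 ∧
    ModularGroup.T 1 1 = 1 := by simp [ModularGroup.T]

theorem conj_T_A : ModularGroup.T * torusMatA * ModularGroup.T⁻¹ = torusMatB * torusMatA := by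
  rw [mul_inv_eq_iff_eq_mul]
  obtain ⟨a0, a1, a2, a3⟩ := torusMatA_entries
  obtain ⟨b0, b1, b2, b3⟩ := torusMatB_entries
  obtain ⟨t0, t1, t2, t3⟩ := T_entries
  apply sl_ext <;>
    simp [mul00, mul01, mul10, mul11, a0, a1, a2, a3, b0, b1, b2, b3, t0, t1, t2, t3,
      -Matrix.SpecialLinearGroup.coe_mul]

theorem conj_T_B : ModularGroup.T * torusMatB * ModularGroup.T⁻¹ = torusMatA⁻¹ := by
  rw [mul_inv_eq_iff_eq_mul, eq_inv_mul_iff_mul_eq]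
  obtain ⟨a0, a1, a2, a3⟩ := torusMatA_entries
  obtain ⟨b0, b1, b2, b3⟩ := torusMatB_entries
  obtain ⟨t0, t1, t2, t3⟩ := T_entries
  apply sl_ext <;>
    simp [mul00, mul01, mul10, mul11, a0, a1, a2, a3, b0, b1, b2, b3, t0, t1, t2, t3,
      -Matrix.SpecialLinearGroup.coe_mul]

/-- The descent ends at three consecutive integers; that `T` normalizes the torus group reduces them
to `0, 1, 2`. -/
theorem conj_mem_torusGroup {g : SL(2, ℤ)} (hg : g ∈ torusGroup) :
    ModularGroup.T * g * ModularGroup.T⁻¹ ∈ torusGroup ∧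
      ModularGroup.T⁻¹ * g * ModularGroup.T ∈ torusGroup := by
  have hB : torusMatB = ModularGroup.T⁻¹ * torusMatA⁻¹ * ModularGroup.T := by
    rw [← conj_T_B]; group
  have hA : torusMatA = ModularGroup.T⁻¹ * torusMatB * ModularGroup.T * torusMatB⁻¹ := by
    have h := conj_T_A
    have : torusMatA = ModularGroup.T⁻¹ * (torusMatB * torusMatA) * ModularGroup.T := by
      rw [← h]; group
    rw [hB] at this ⊢
    conv_lhs => rw [this]
    group
  have iA : ModularGroup.T⁻¹ * torusMatA * ModularGroup.T = torusMatB⁻¹ := by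
    rw [hB]; group
  have iB : ModularGroup.T⁻¹ * torusMatB * ModularGroup.T = torusMatA * torusMatB := by
    conv_rhs => rw [hA]
    group
  constructor
  · induction hg using Subgroup.closure_induction with
    | mem x hx =>
      rcases hx with rfl | rfl
      · rw [conj_T_A]; exact mul_mem torusMatB_mem torusMatA_mem
      · rw [conj_T_B]; exact inv_mem torusMatA_mem
    | one => simp
    | mul x y _ _ hx hy =>
      have : ModularGroup.T * (x * y) * ModularGroup.T⁻¹ =
        (ModularGroup.T * x * ModularGroup.T⁻¹) * (ModularGroup.T * y * ModularGroup.T⁻¹) := by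
        group
      rw [this]; exact mul_mem hx hy
    | inv x _ hx =>
      have : ModularGroup.T * x⁻¹ * ModularGroup.T⁻¹ =
        (ModularGroup.T * x * ModularGroup.T⁻¹)⁻¹ := by group
      rw [this]; exact inv_mem hx
  · induction hg using Subgroup.closure_induction with
    | mem x hx =>
      rcases hx with rfl | rfl
      · rw [iA]; exact inv_mem torusMatB_mem
      · rw [iB]; exact mul_mem torusMatA_mem torusMatB_mem
    | one => simp
    | mul x y _ _ hx hy =>
      have : ModularGroup.T⁻¹ * (x * y) * ModularGroup.T =
        (ModularGroup.T⁻¹ * x * ModularGroup.T) * (ModularGroup.T⁻¹ * y * ModularGroup.T) := by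
        group
      rw [this]; exact mul_mem hx hy
    | inv x _ hx =>
      have : ModularGroup.T⁻¹ * x⁻¹ * ModularGroup.T =
        (ModularGroup.T⁻¹ * x * ModularGroup.T)⁻¹ := by group
      rw [this]; exact inv_mem hx

theorem transl_conj_mem_torusGroup {g : SL(2, ℤ)} (hg : g ∈ torusGroup) (n : ℤ) :
    transl n * g * transl (-n) ∈ torusGroup := by
  induction n using Int.induction_on with
  | zero => simpa using hg
  | succ i hi =>
    have := (conj_mem_torusGroup hi).1
    convert this using 1
    simp only [transl]
    group
  | pred i hi =>
    have := (conj_mem_torusGroup hi).2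
    convert this using 1
    simp only [transl]
    group

theorem transl_conj_mem_torusGroupPM {g : SL(2, ℤ)} (hg : g ∈ torusGroupPM) (n : ℤ) :
    transl n * g * transl (-n) ∈ torusGroupPM := by
  rcases hg with hg | hg
  · exact Or.inl (transl_conj_mem_torusGroup hg n)
  · right
    have := transl_conj_mem_torusGroup hg n
    simpa using this

theorem IsSystem.conj_transl {p₁ q₁ p₂ q₂ p₃ q₃ : ℤ} {E₁ E₂ E₃ : SL(2, ℤ)}
    (s : IsSystem p₁ q₁ p₂ q₂ p₃ q₃ E₁ E₂ E₃) (n : ℤ) :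
    IsSystem (p₁ + n * q₁) q₁ (p₂ + n * q₂) q₂ (p₃ + n * q₃) q₃ (transl n * E₁ * transl (-n))
      (transl n * E₂ * transl (-n)) (transl n * E₃ * transl (-n)) := by
  have conj_mul : ∀ X Y : SL(2, ℤ), transl n * X * transl (-n) * (transl n * Y * transl (-n)) =
      transl n * (X * Y) * transl (-n) := by
    intro X Y; simp only [transl]; group
  refine ⟨s.inv₁.conj_transl n, s.inv₂.conj_transl n, s.inv₃.conj_transl n, ?_, ?_, ?_⟩
  · rw [conj_mul]; exact transl_conj_mem_torusGroupPM s.even₁₂ n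
  · rw [conj_mul]; exact transl_conj_mem_torusGroupPM s.even₂₃ n
  · intro g hg
    have h1 := s.gen (transl_conj_mem_torusGroup hg (-n))
    have h2 : ∀ x ∈ Subgroup.closure {E₁, E₂, E₃}, transl n * x * transl (-n) ∈
        Subgroup.closure {transl n * E₁ * transl (-n), transl n * E₂ * transl (-n),
          transl n * E₃ * transl (-n)} := by
      intro x hx
      induction hx using Subgroup.closure_induction with
      | mem x hx =>
        apply Subgroup.subset_closure
        rcases hx with rfl | rfl | rfl <;> simp
      | one => 
        have : transl n * 1 * transl (-n) = 1 := by simp only [transl]; group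
        rw [this]; exact one_mem _
      | mul x y _ _ hx hy => rw [← conj_mul]; exact mul_mem hx hy
      | inv x _ hx =>
        have : transl n * x⁻¹ * transl (-n) = (transl n * x * transl (-n))⁻¹ := by
          simp only [transl]; group
        rw [this]; exact inv_mem hx
    have h3 := h2 _ h1
    convert h3 using 1
    simp only [transl]
    group

/-- The involution exchanging `∞` and an integer. -/
def intInvolution (n : ℤ) : SL(2, ℤ) :=
  ⟨!![n, -(n ^ 2 + 1); 1, -n], by rw [Matrix.det_fin_two_of]; ring⟩

theorem intInvolution_entries (n : ℤ) : intInvolution n 0 0 = n ∧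
    intInvolution n 0 1 = -(n ^ 2 + 1) ∧ intInvolution n 1 0 = 1 ∧ intInvolution n 1 1 = -n := by
  simp [intInvolution]

theorem isInvolution_int (n : ℤ) : IsInvolution n 1 (intInvolution n) := by
  simp [IsInvolution, intInvolution]

/-- Base of the descent: the products of consecutive half-turns are `-A` and `-BA`, so they give
back the generators of the torus group. -/
theorem isSystem_zero : IsSystem 0 1 1 1 2 1 (intInvolution 0) (intInvolution 1)
    (intInvolution 2) := by
  obtain ⟨a0, a1, a2, a3⟩ := torusMatA_entries
  obtain ⟨b0, b1, b2, b3⟩ := torusMatB_entries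
  have h12 : intInvolution 0 * intInvolution 1 = -torusMatA := by
    apply sl_ext <;>
      simp [mul00, mul01, mul10, mul11, a0, a1, a2, a3, intInvolution_entries,
        -Matrix.SpecialLinearGroup.coe_mul]
  have h23 : intInvolution 1 * intInvolution 2 = -(torusMatB * torusMatA) := by
    apply sl_ext <;>
      simp [mul00, mul01, mul10, mul11, a0, a1, a2, a3, b0, b1, b2, b3, intInvolution_entries,
        -Matrix.SpecialLinearGroup.coe_mul]
  refine ⟨isInvolution_int 0, isInvolution_int 1, isInvolution_int 2, ?_, ?_, ?_⟩
  · rw [h12]; exact neg_mem_torusGroupPM (Or.inl torusMatA_mem)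
  · rw [h23]; exact neg_mem_torusGroupPM (Or.inl (mul_mem torusMatB_mem torusMatA_mem))
  · set H := Subgroup.closure {intInvolution 0, intInvolution 1, intInvolution 2} with hH
    have m0 : intInvolution 0 ∈ H := Subgroup.subset_closure (by simp)
    have m1 : intInvolution 1 ∈ H := Subgroup.subset_closure (by simp)
    have m2 : intInvolution 2 ∈ H := Subgroup.subset_closure (by simp)
    have hn : (-1 : SL(2, ℤ)) ∈ H := neg_one_mem_of_trace_zero m0 (isInvolution_int 0).trace
    have hA : torusMatA ∈ H := by
      have : torusMatA = -1 * (intInvolution 0 * intInvolution 1) := by rw [h12]; simp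
      rw [this]; exact mul_mem hn (mul_mem m0 m1)
    have hB : torusMatB ∈ H := by
      have : torusMatB = -1 * (intInvolution 1 * intInvolution 2) * torusMatA⁻¹ := by
        rw [h23]; simp [mul_assoc]
      rw [this]; exact mul_mem (mul_mem hn (mul_mem m1 m2)) (inv_mem hA)
    refine (Subgroup.closure_le _).mpr ?_
    rintro _ (rfl | rfl)
    exacts [hA, hB]

/-! ### Descent along Markov triples -/

/-- Vieta descent: `q₂` and `3q₁q₃ - q₂` are the roots of one quadratic, with product `q₁² + q₃²`.
Mutation lowers the largest denominator unless all three are `1`. -/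
theorem exists_system_of_max_middle {p₁ q₁ p₂ q₂ p₃ q₃ : ℤ} (h : IsTriple p₁ q₁ p₂ q₂ p₃ q₃)
    (h12 : q₁ ≤ q₂) (h32 : q₃ ≤ q₂)
    (ih : ∀ p₁' q₁' p₂' q₂' p₃' q₃' : ℤ, q₁' + q₂' + q₃' < q₁ + q₂ + q₃ →
      IsTriple p₁' q₁' p₂' q₂' p₃' q₃' → ∃ E₁ E₂ E₃, IsSystem p₁' q₁' p₂' q₂' p₃' q₃' E₁ E₂ E₃) :
    ∃ E₁ E₂ E₃, IsSystem p₁ q₁ p₂ q₂ p₃ q₃ E₁ E₂ E₃ := by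
  obtain ⟨⟨h1, h2, h3, hm⟩, d12, d23⟩ := id h
  have hprod : q₂ * (3 * q₁ * q₃ - q₂) = q₁ ^ 2 + q₃ ^ 2 := by linear_combination -hm
  have hpos : 0 < 3 * q₁ * q₃ - q₂ := by
    have : 0 < q₂ * (3 * q₁ * q₃ - q₂) := by rw [hprod]; positivity
    exact (mul_pos_iff_of_pos_left h2).mp this
  rcases lt_or_ge (3 * q₁ * q₃ - q₂) q₂ with hlt | hge
  · obtain ⟨E₁, E₃, E₄, s⟩ := ih _ _ _ _ _ _ (by linarith) (h.mutate hpos)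
    exact ⟨_, _, _, s.of_mutate h hpos⟩
  -- Without a decrease the Markov equation gives `3q₁q₂q₃ ≤ 2(q₁² + q₃²)`; as `q₂` is the largest,
  -- this leaves only `q₁ = q₃ = 1`.
  · have hq2 : q₂ ^ 2 ≤ q₁ ^ 2 + q₃ ^ 2 := by nlinarith
    have hone : q₁ = 1 ∧ q₃ = 1 := by
      rcases le_total q₁ q₃ with hle | hle
      · have h13 : 3 * q₁ * q₃ * q₂ ≤ q₁ ^ 2 + q₃ ^ 2 + (q₁ ^ 2 + q₃ ^ 2) := by nlinarith
        have hq3 : 3 * q₁ * (q₃ * q₃) ≤ 3 * q₁ * (q₃ * q₂) := by gcongr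
        have hq1 : q₁ ^ 2 ≤ q₁ * q₃ := by nlinarith
        by_contra hne
        have hq1' : q₁ = 1 := by
          by_contra hne1
          have : 2 ≤ q₁ := by omega
          nlinarith [mul_pos h1 h3, mul_pos h3 h3]
        subst hq1'
        have : 2 ≤ q₃ := by
          rcases lt_or_ge q₃ 2 with h | h
          · exact absurd ⟨rfl, by omega⟩ hne
          · exact h
        nlinarith
      · have h13 : 3 * q₁ * q₃ * q₂ ≤ q₁ ^ 2 + q₃ ^ 2 + (q₁ ^ 2 + q₃ ^ 2) := by nlinarith
        have hq3 : 3 * q₃ * (q₁ * q₁) ≤ 3 * q₃ * (q₁ * q₂) := by gcongr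
        by_contra hne
        have hq1' : q₃ = 1 := by
          by_contra hne1
          have : 2 ≤ q₃ := by omega
          nlinarith [mul_pos h1 h3, mul_pos h1 h1]
        subst hq1'
        have : 2 ≤ q₁ := by
          rcases lt_or_ge q₁ 2 with h | h
          · exact absurd ⟨by omega, rfl⟩ hne
          · exact h
        nlinarith
    obtain ⟨rfl, rfl⟩ := hone
    have hq : q₂ = 1 := by nlinarith
    subst hq
    have hp2 : p₂ = p₁ + 1 := by linarith
    have hp3 : p₃ = p₁ + 2 := by linarith
    subst hp2 hp3
    have := isSystem_zero.conj_transl p₁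
    rw [mul_one, zero_add, add_comm 1, add_comm 2] at this
    exact ⟨_, _, _, this⟩

/-- Induction on the sum of the denominators, which rotation leaves unchanged; the cases only rotate
the largest one into the middle. -/
theorem exists_system {p₁ q₁ p₂ q₂ p₃ q₃ : ℤ} (h : IsTriple p₁ q₁ p₂ q₂ p₃ q₃) :
    ∃ E₁ E₂ E₃, IsSystem p₁ q₁ p₂ q₂ p₃ q₃ E₁ E₂ E₃ := by
  have key : ∀ n : ℕ, ∀ p₁ q₁ p₂ q₂ p₃ q₃ : ℤ, q₁ + q₂ + q₃ < n →
      IsTriple p₁ q₁ p₂ q₂ p₃ q₃ → ∃ E₁ E₂ E₃, IsSystem p₁ q₁ p₂ q₂ p₃ q₃ E₁ E₂ E₃ := by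
    intro n
    induction n with
    | zero =>
      intro p₁ q₁ p₂ q₂ p₃ q₃ hn h
      obtain ⟨h1, h2, h3, -⟩ := h.1
      push_cast at hn
      linarith
    | succ n ih =>
      intro p₁ q₁ p₂ q₂ p₃ q₃ hn h
      push_cast at hn
      rcases le_total q₁ q₂ with h12 | h12 <;> rcases le_total q₂ q₃ with h23 | h23
      · obtain ⟨E₁, E₂, E₃, s⟩ := exists_system_of_max_middle h.rot h23 (h12.trans h23)
          fun _ _ _ _ _ _ hlt ht => ih _ _ _ _ _ _ (by linarith) ht
        exact ⟨_, _, _, s.rot_back h⟩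
      · exact exists_system_of_max_middle h h12 h23
          fun _ _ _ _ _ _ hlt ht => ih _ _ _ _ _ _ (by linarith) ht
      · rcases le_total q₁ q₃ with h13 | h13
        · obtain ⟨E₁, E₂, E₃, s⟩ := exists_system_of_max_middle h.rot h23 h13
            fun _ _ _ _ _ _ hlt ht => ih _ _ _ _ _ _ (by linarith) ht
          exact ⟨_, _, _, s.rot_back h⟩
        · have h' := h.rot.rot
          obtain ⟨E₁, E₂, E₃, s⟩ := exists_system_of_max_middle h' h13 h12
            fun _ _ _ _ _ _ hlt ht => ih _ _ _ _ _ _ (by linarith) ht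
          exact ⟨_, _, _, (s.rot_back h.rot).rot_back h⟩
      · have h' := h.rot.rot
        obtain ⟨E₁, E₂, E₃, s⟩ := exists_system_of_max_middle h' (h23.trans h12) h12
          fun _ _ _ _ _ _ hlt ht => ih _ _ _ _ _ _ (by linarith) ht
        exact ⟨_, _, _, (s.rot_back h.rot).rot_back h⟩
  exact key (q₁ + q₂ + q₃ + 1).toNat _ _ _ _ _ _
    (by have := h.1; obtain ⟨h1, h2, h3, -⟩ := this; omega) h

/-! ### Congruences -/

/-- In `SL(2, 𝔽₃)` the matrices that are diagonal or of trace zero form the quaternion group, which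
contains no unipotent matrix except the identity. The left factor has trace zero and determinant
one. -/
theorem mod_three_step : ∀ x y z a b c d : ZMod 3, x * x + y * z = -1 → a * d - b * c = 1 →
    ((b = 0 ∧ c = 0) ∨ a + d = 0) →
    ((x * b + y * d = 0 ∧ z * a - x * c = 0) ∨ (x * a + y * c) + (z * b - x * d) = 0) := by
  decide

/-- The image modulo `3` of a product of elliptic involutions lies in the quaternion group. -/
theorem quaternion_mod_three {S : Set SL(2, ℤ)} (hS : ∀ E ∈ S, E 1 1 = -E 0 0) {g : SL(2, ℤ)}
    (hg : g ∈ Subgroup.closure S) :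
    (((g 0 1 : ℤ) : ZMod 3) = 0 ∧ ((g 1 0 : ℤ) : ZMod 3) = 0) ∨
      ((g 0 0 : ℤ) : ZMod 3) + ((g 1 1 : ℤ) : ZMod 3) = 0 := by
  have key : ∀ E g : SL(2, ℤ), E 1 1 = -E 0 0 →
      ((((g 0 1 : ℤ) : ZMod 3) = 0 ∧ ((g 1 0 : ℤ) : ZMod 3) = 0) ∨
      ((g 0 0 : ℤ) : ZMod 3) + ((g 1 1 : ℤ) : ZMod 3) = 0) →
      (((((E * g) 0 1 : ℤ) : ZMod 3) = 0 ∧ (((E * g) 1 0 : ℤ) : ZMod 3) = 0) ∨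
      (((E * g) 0 0 : ℤ) : ZMod 3) + (((E * g) 1 1 : ℤ) : ZMod 3) = 0) := by
    intro E g hE ih
    have dE := congrArg (Int.cast : ℤ → ZMod 3) (det_entries E)
    have dg := congrArg (Int.cast : ℤ → ZMod 3) (det_entries g)
    rw [hE] at dE
    push_cast at dE dg
    have := mod_three_step (E 0 0) (E 0 1) (E 1 0) (g 0 0) (g 0 1) (g 1 0) (g 1 1)
      (by linear_combination -dE) dg ih
    simp only [mul00, mul01, mul10, mul11, hE]
    push_cast
    convert this using 2 <;> ring_nf
  induction hg using Subgroup.closure_induction_left with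
  | one => left; simp
  | mul_left x hx y hy ih => exact key x y (hS x hx) ih
  | inv_mul_cancel x hx y hy ih =>
    refine key x⁻¹ y ?_ ih
    rw [inv00, inv11, hS x hx, neg_neg]

/-- The stabilizer of `∞` in a group generated by elliptic involutions consists of translations
by multiples of `3`, up to sign. -/
theorem eq_transl_of_fix_inf {S : Set SL(2, ℤ)} (hS : ∀ E ∈ S, E 1 1 = -E 0 0) {g : SL(2, ℤ)}
    (hg : g ∈ Subgroup.closure S) (hc : g 1 0 = 0) :
    ∃ m : ℤ, g = transl (3 * m) ∨ g = -transl (3 * m) := by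
  have hq := quaternion_mod_three hS hg
  have hd := det_entries g
  rw [hc, mul_zero, sub_zero] at hd
  have h0 : (g 0 0 = 1 ∧ g 1 1 = 1) ∨ (g 0 0 = -1 ∧ g 1 1 = -1) := Int.mul_eq_one_iff_eq_one_or_neg_one.mp hd
  -- The trace is `±2`, nonzero modulo `3`, so the residue must be diagonal.
  have hb : ((g 0 1 : ℤ) : ZMod 3) = 0 := by
    rcases hq with hq | hq
    · exact hq.1
    · exfalso
      rcases h0 with ⟨h1, h2⟩ | ⟨h1, h2⟩ <;> rw [h1, h2] at hq <;> revert hq <;> decide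
  obtain ⟨m, hm⟩ := (ZMod.intCast_zmod_eq_zero_iff_dvd _ 3).mp hb
  push_cast at hm
  rcases h0 with ⟨h1, h2⟩ | ⟨h1, h2⟩
  · refine ⟨m, Or.inl (sl_ext ?_ ?_ ?_ ?_)⟩
    · rw [h1, transl00]
    · rw [hm, transl01]
    · rw [hc, transl10]
    · rw [h2, transl11]
  · refine ⟨-m, Or.inr (sl_ext ?_ ?_ ?_ ?_)⟩
    · rw [neg_entry, h1, transl00]
    · rw [neg_entry, hm, transl01]; ring
    · rw [neg_entry, hc, transl10]; rfl
    · rw [neg_entry, h2, transl11]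

/-- In `SL(2, 𝔽₂)` the identity and the matrices of trace one form the subgroup of order three. `A`
and `B` agree modulo `2`; the two conclusions concern left multiplication by this residue and by its
inverse. -/
theorem mod_two_step : ∀ a b c d : ZMod 2, a * d - b * c = 1 → ((b = 0 ∧ c = 0) ∨ a + d = 1) →
    ((b + d = 0 ∧ a = 0) ∨ (a + c) + b = 1) ∧ ((d = 0 ∧ a + c = 0) ∨ c + (b + d) = 1) := by
  decide

theorem torusGroup_mod_two {g : SL(2, ℤ)} (hg : g ∈ torusGroup) :
    (((g 0 1 : ℤ) : ZMod 2) = 0 ∧ ((g 1 0 : ℤ) : ZMod 2) = 0) ∨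
      ((g 0 0 : ℤ) : ZMod 2) + ((g 1 1 : ℤ) : ZMod 2) = 1 := by
  obtain ⟨a0, a1, a2, a3⟩ := torusMatA_entries
  obtain ⟨b0, b1, b2, b3⟩ := torusMatB_entries
  have two : (2 : ZMod 2) = 0 := by decide
  have neg : ∀ x : ZMod 2, -x = x := by decide
  induction hg using Subgroup.closure_induction_left with
  | one => left; simp
  | mul_left x hx y hy ih =>
    have dg := congrArg (Int.cast : ℤ → ZMod 2) (det_entries y)
    push_cast at dg
    have := (mod_two_step _ _ _ _ dg ih).1
    rcases hx with rfl | rfl <;> simp only [mul00, mul01, mul10, mul11, a0, a1, a2, a3, b0, b1,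
      b2, b3] <;> push_cast <;> simpa [two, neg] using this
  | inv_mul_cancel x hx y hy ih =>
    have dg := congrArg (Int.cast : ℤ → ZMod 2) (det_entries y)
    push_cast at dg
    have := (mod_two_step _ _ _ _ dg ih).2
    rcases hx with rfl | rfl <;> simp only [mul00, mul01, mul10, mul11, inv00, inv01, inv10, inv11,
      a0, a1, a2, a3, b0, b1, b2, b3] <;> push_cast <;> simpa [two, neg] using this

/-- The torus group contains no elliptic involution. -/
theorem trace_ne_zero_of_mem_torusGroup {g : SL(2, ℤ)} (hg : g ∈ torusGroup) :
    g 1 1 ≠ -g 0 0 := by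
  intro h
  have hd := det_entries g
  have h2 := torusGroup_mod_two hg
  rw [h] at h2 hd
  have : ¬ (((g 0 0 : ℤ) : ZMod 2) + ((-g 0 0 : ℤ) : ZMod 2) = 1) := by
    rw [Int.cast_neg, add_neg_cancel]; decide
  obtain ⟨hb, hc⟩ := h2.resolve_right this
  obtain ⟨b, hb⟩ := (ZMod.intCast_zmod_eq_zero_iff_dvd _ 2).mp hb
  obtain ⟨c, hc⟩ := (ZMod.intCast_zmod_eq_zero_iff_dvd _ 2).mp hc
  rw [hb, hc] at hd
  push_cast at hd
  -- With even off-diagonal entries and trace zero, the determinant makes `-1` a square modulo `4`.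
  have h4 : (g 0 0) ^ 2 % 4 = 3 := by
    have : (g 0 0) ^ 2 = 4 * (-1 - b * c) + 3 := by linear_combination -hd
    omega
  rcases Int.even_or_odd (g 0 0) with ⟨k, hk⟩ | ⟨k, hk⟩
  · rw [hk] at h4; ring_nf at h4; omega
  · rw [hk] at h4; ring_nf at h4; omega

/-! ### Words in involutions and ping-pong -/

/-- The product of a word of letters. -/
def wordProd {ι : Type*} (F : ι → SL(2, ℤ)) (l : List ι) : SL(2, ℤ) := (l.map F).prod

section words
variable {ι : Type*} {F : ι → SL(2, ℤ)}

theorem wordProd_nil : wordProd F [] = 1 := rfl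

theorem wordProd_cons (i : ι) (l : List ι) : wordProd F (i :: l) = F i * wordProd F l := by
  simp [wordProd]

theorem wordProd_append (l m : List ι) :
    wordProd F (l ++ m) = wordProd F l * wordProd F m := by simp [wordProd]

theorem wordProd_mem {H : Subgroup SL(2, ℤ)} (hF : ∀ i, F i ∈ H) (l : List ι) :
    wordProd F l ∈ H := by
  induction l with
  | nil => exact one_mem H
  | cons i l ih => rw [wordProd_cons]; exact mul_mem (hF i) ih

theorem wordProd_cancel (hF : ∀ i, F i * F i = -1) (l₁ l₂ : List ι) (i : ι) :
    wordProd F (l₁ ++ i :: i :: l₂) = -wordProd F (l₁ ++ l₂) := by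
  rw [wordProd_append, wordProd_cons, wordProd_cons, ← mul_assoc (F i), hF, wordProd_append]
  simp

/-- Every element of a group generated by involutions is a word, up to sign. -/
theorem exists_word (hF : ∀ i, F i * F i = -1) {g : SL(2, ℤ)}
    (hg : g ∈ Subgroup.closure (Set.range F)) : ∃ l, wordProd F l = g ∨ wordProd F l = -g := by
  induction hg using Subgroup.closure_induction_left with
  | one => exact ⟨[], Or.inl rfl⟩
  | mul_left x hx y hy ih =>
    obtain ⟨i, rfl⟩ := hx
    obtain ⟨l, hl⟩ := ih
    refine ⟨i :: l, ?_⟩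
    rw [wordProd_cons]
    rcases hl with hl | hl <;> rw [hl]
    · exact Or.inl rfl
    · exact Or.inr (mul_neg _ _)
  | inv_mul_cancel x hx y hy ih =>
    obtain ⟨i, rfl⟩ := hx
    obtain ⟨l, hl⟩ := ih
    have : (F i)⁻¹ = -F i := by
      rw [inv_eq_iff_mul_eq_one, mul_neg, hF, neg_neg]
    refine ⟨i :: l, ?_⟩
    rw [wordProd_cons, this]
    rcases hl with hl | hl <;> rw [hl]
    · exact Or.inr (by simp)
    · exact Or.inl (by simp)

theorem exists_shortest {P : List ι → Prop} (hP : ∃ l, P l) :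
    ∃ l, P l ∧ ∀ m, P m → l.length ≤ m.length := by
  classical
  have hex : ∃ n, ∃ l, P l ∧ l.length = n := by
    obtain ⟨l, hl⟩ := hP
    exact ⟨_, l, hl, rfl⟩
  obtain ⟨l, hl, hn⟩ := Nat.find_spec hex
  exact ⟨l, hl, fun m hm => by rw [hn]; exact Nat.find_min' hex ⟨m, hm, rfl⟩⟩

/-- A shortest list with a property that is invariant under cancellation is reduced. -/
theorem isChain_of_shortest {P : List ι → Prop}
    (hc : ∀ l₁ l₂ i, P (l₁ ++ i :: i :: l₂) → P (l₁ ++ l₂)) {l : List ι} (hl : P l)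
    (hmin : ∀ m, P m → l.length ≤ m.length) : l.IsChain (· ≠ ·) := by
  rw [List.isChain_iff_forall_rel_of_append_cons_cons]
  rintro a b l₁ l₂ rfl rfl
  have := hmin _ (hc _ _ _ hl)
  simp at this

end words

/-- Ping-pong for involutions: the half-plane `0 ≤ Q i` is exchanged with the half-plane
`Q i ≤ 0` by the involution `F i`, and distinct half-planes `0 ≤ Q i` do not overlap. -/
structure IsPingPong {ι : Type*} (F : ι → SL(2, ℤ)) (Q : ι → ℝ × ℝ → ℝ) : Prop where
  sq : ∀ i, F i * F i = -1
  flip : ∀ i r, Q i (act (F i) r) = -Q i r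
  disj : ∀ i j r, i ≠ j → 0 ≤ Q i r → Q j r ≤ 0
  homog : ∀ i (c : ℝ) r, Q i (c • r) = c ^ 2 * Q i r

section pingpong
variable {ι : Type*} {F : ι → SL(2, ℤ)} {Q : ι → ℝ × ℝ → ℝ}

theorem IsPingPong.neg (hp : IsPingPong F Q) (i : ι) (r : ℝ × ℝ) : Q i (-r) = Q i r := by
  have := hp.homog i (-1) r
  simpa using this

/-- The last letter flips the point into its own half-plane. Each further letter differs from the
one before, so it finds the point outside its own half-plane and flips it in. -/
theorem IsPingPong.play (hp : IsPingPong F Q) (j : ι) (l : List ι) (i : ι)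
    (hl : (i :: l).IsChain (· ≠ ·)) (hj : (i :: l).getLast (by simp) = j)
    {r : ℝ × ℝ} (hr : Q j r ≤ 0) : 0 ≤ Q i (act (wordProd F (i :: l)) r) := by
  induction l generalizing i with
  | nil =>
    simp only [List.getLast_singleton] at hj
    subst hj
    rw [wordProd_cons, wordProd_nil, mul_one, hp.flip]
    linarith
  | cons k l ih =>
    rw [List.isChain_cons_cons] at hl
    have := ih k hl.2 (by simpa using hj)
    rw [wordProd_cons, act_mul, hp.flip]
    have := hp.disj k i _ hl.1.symm this
    linarith

end pingpong

section pingpong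
variable {ι : Type*} {F : ι → SL(2, ℤ)} {Q : ι → ℝ × ℝ → ℝ}

theorem IsPingPong.act_of_eq_or_neg (hp : IsPingPong F Q) {g h : SL(2, ℤ)}
    (hgh : g = h ∨ g = -h) (i : ι) (r : ℝ × ℝ) : Q i (act g r) = Q i (act h r) := by
  rcases hgh with rfl | rfl
  · rfl
  · rw [act_neg, hp.neg]

/-- The translates of the geodesic of a letter do not cross it. -/
theorem IsPingPong.noncross (hp : IsPingPong F Q) (i : ι) {u v : ℝ × ℝ} (hu : ∀ j, Q j u ≤ 0)
    (hv : ∀ j, Q j v ≤ 0) (hu0 : Q i u = 0) {g : SL(2, ℤ)}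
    (hg : g ∈ Subgroup.closure (Set.range F)) : 0 ≤ Q i (act g u) * Q i (act g v) := by
  let P : List ι → Prop := fun l => wordProd F l = g ∨ wordProd F l = -g
  have hc : ∀ l₁ l₂ i, P (l₁ ++ i :: i :: l₂) → P (l₁ ++ l₂) := by
    intro l₁ l₂ i h
    simp only [P, wordProd_cancel hp.sq] at h ⊢
    rcases h with h | h
    · exact Or.inr (by rw [← h, neg_neg])
    · exact Or.inl (neg_injective h)
  obtain ⟨l, hl, hmin⟩ := exists_shortest (P := P) (exists_word hp.sq hg)
  have hch := isChain_of_shortest hc hl hmin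
  rw [← hp.act_of_eq_or_neg hl, ← hp.act_of_eq_or_neg hl]
  cases l with
  | nil => rw [wordProd_nil, act_one, act_one, hu0, zero_mul]
  | cons k l =>
    have h1 := hp.play _ l k hch rfl (hu _)
    have h2 := hp.play _ l k hch rfl (hv _)
    -- Both images lie in the half-plane of the first letter `k`: that of `i` itself, or one outside
    -- it.
    by_cases hk : k = i
    · subst hk
      exact mul_nonneg h1 h2
    · exact mul_nonneg_of_nonpos_of_nonpos (hp.disj _ _ _ hk h1) (hp.disj _ _ _ hk h2)

theorem act_pow_eigen {w : SL(2, ℤ)} {r : ℝ × ℝ} {a : ℝ} (h : act w r = a • r) (n : ℕ) :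
    act (w ^ n) r = a ^ n • r := by
  induction n with
  | zero => simp [act_one]
  | succ n ih => rw [pow_succ, act_mul, h, act_smul, ih, smul_smul, pow_succ, mul_comm]

theorem act_inv_eigen {w : SL(2, ℤ)} {r : ℝ × ℝ} {a : ℝ} (ha : a ≠ 0) (h : act w r = a • r) :
    act w⁻¹ r = a⁻¹ • r := by
  have : act w⁻¹ (act w r) = r := act_inv_act w r
  rw [h, act_smul] at this
  rw [← this, smul_smul, inv_mul_cancel₀ ha, one_smul, this]

theorem eq_combination (r s e : ℝ × ℝ) (h : br r s ≠ 0) :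
    e = (br e s / br r s) • r + (br r e / br r s) • s := by
  simp only [br] at h ⊢
  ext
  · simp only [Prod.fst_add, Prod.smul_fst, smul_eq_mul]
    rw [div_mul_eq_mul_div, div_mul_eq_mul_div, ← add_div, eq_div_iff h]
    ring
  · simp only [Prod.snd_add, Prod.smul_snd, smul_eq_mul]
    rw [div_mul_eq_mul_div, div_mul_eq_mul_div, ← add_div, eq_div_iff h]
    ring

/-- If a continuous form is nonnegative along the iterates of a vector, then it is nonnegative
at the attracting eigenvector. -/
theorem nonneg_of_iterate {q : ℝ × ℝ → ℝ} (hq : Continuous q)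
    (hhom : ∀ (c : ℝ) r, q (c • r) = c ^ 2 * q r) {w : SL(2, ℤ)} {r s : ℝ × ℝ} {a : ℝ}
    (ha : a ≠ 0) (ha1 : a ^ 2 < 1) (hr : act w r = a • r) (hs : act w s = a⁻¹ • s) {x y : ℝ}
    (hy : y ≠ 0) (h : ∀ n : ℕ, 0 ≤ q (act (w ^ (n + 1)) (x • r + y • s))) : 0 ≤ q s := by
  have h1 : ∀ n : ℕ, 0 ≤ q ((x * (a ^ 2) ^ (n + 1)) • r + y • s) := by
    intro n
    -- After pulling out `a⁻¹ ^ (n + 1)`, which does not affect the sign of `q`, the component along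
    -- `r` decays like `(a ^ 2) ^ (n + 1)`.
    have h2 : act (w ^ (n + 1)) (x • r + y • s) =
        (a⁻¹ ^ (n + 1)) • ((x * (a ^ 2) ^ (n + 1)) • r + y • s) := by
      rw [act_add, act_smul, act_smul, act_pow_eigen hr, act_pow_eigen hs, smul_add, smul_smul,
        smul_smul, smul_smul, smul_smul]
      congr 2
      · rw [inv_pow]
        field_simp
        ring
      · ring
    have h3 := h n
    rw [h2, hhom] at h3
    exact nonneg_of_mul_nonneg_right h3 (by positivity)
  have h2 : Filter.Tendsto (fun n : ℕ => q ((x * (a ^ 2) ^ (n + 1)) • r + y • s)) Filter.atTop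
      (nhds (q ((x * 0) • r + y • s))) := by
    refine (hq.tendsto _).comp ?_
    refine Filter.Tendsto.add_const _ (Filter.Tendsto.smul_const ?_ _)
    refine Filter.Tendsto.const_mul _ ?_
    exact (tendsto_pow_atTop_nhds_zero_of_lt_one (sq_nonneg a) ha1).comp
      (Filter.tendsto_add_atTop_nat 1)
  have h3 := ge_of_tendsto' h2 h1
  rw [mul_zero, zero_smul, zero_add, hhom] at h3
  exact nonneg_of_mul_nonneg_right h3 (by positivity)

theorem conj_eigen {g w : SL(2, ℤ)} {r : ℝ × ℝ} {a : ℝ} (h : act w r = a • r) :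
    act (g * w * g⁻¹) (act g r) = a • act g r := by
  rw [act_mul, act_mul, act_inv_act, h, act_smul]

theorem act_ne_zero {g : SL(2, ℤ)} {r : ℝ × ℝ} (hr : r ≠ 0) : act g r ≠ 0 := by
  intro h
  apply hr
  rw [← act_inv_act g r, h]
  ext <;> simp [act]

/-- An eigenvalue of an integral matrix is not a square root of `-1`. -/
theorem mul_self_ne_neg_one {w : SL(2, ℤ)} {r : ℝ × ℝ} {a : ℝ} (hr : r ≠ 0)
    (h : act w r = a • r) : w * w ≠ -1 := by
  intro hw
  have h1 : act (w * w) r = (a * a) • r := by rw [act_mul, h, act_smul, h, smul_smul]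
  rw [hw, act_neg, act_one] at h1
  have h2 : (a * a + 1) • r = 0 := by rw [add_smul, ← h1, one_smul, neg_add_cancel]
  rcases smul_eq_zero.mp h2 with h3 | h3
  · nlinarith [mul_self_nonneg a]
  · exact hr h3

/-- A hyperbolic element whose axis crosses no translate of the geodesic of the letter `i` is
conjugate to a word without the letter `i`. -/
theorem IsPingPong.exists_conj_word (hp : IsPingPong F Q) {i : ι} (hcont : Continuous (Q i))
    {e : ℝ × ℝ} (he0 : ∀ j, Q j e ≤ 0)
    (hne : ∀ (w : SL(2, ℤ)) (r : ℝ × ℝ) (a : ℝ), r ≠ 0 → act w r = a • r → a ^ 2 ≠ 1 →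
      Q i r ≠ 0 ∧ br e r ≠ 0)
    {w : SL(2, ℤ)} (hw : w ∈ Subgroup.closure (Set.range F)) {r s : ℝ × ℝ} {a : ℝ}
    (hrs : br r s ≠ 0) (ha : a ≠ 0) (ha1 : a ^ 2 < 1) (hr : act w r = a • r)
    (hs : act w s = a⁻¹ • s)
    (hno : ∀ g ∈ Subgroup.closure (Set.range F), 0 ≤ Q i (act g r) * Q i (act g s)) :
    ∃ g ∈ Subgroup.closure (Set.range F), ∃ l : List ι, i ∉ l ∧
      (wordProd F l = g * w * g⁻¹ ∨ wordProd F l = -(g * w * g⁻¹)) := by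
  set Γ := Subgroup.closure (Set.range F) with hΓ
  have hFm : ∀ j, F j ∈ Γ := fun j => Subgroup.subset_closure ⟨j, rfl⟩
  -- Words for conjugates of `w`, up to sign. The property survives cancellation and cyclic
  -- rotation, so a shortest word is cyclically reduced.
  let P : List ι → Prop := fun l => ∃ g ∈ Γ,
    (wordProd F l = g * w * g⁻¹ ∨ wordProd F l = -(g * w * g⁻¹))
  have hc : ∀ l₁ l₂ i, P (l₁ ++ i :: i :: l₂) → P (l₁ ++ l₂) := by
    rintro l₁ l₂ i ⟨g, hg, h⟩
    refine ⟨g, hg, ?_⟩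
    rw [wordProd_cancel hp.sq] at h
    rcases h with h | h
    · exact Or.inr (by rw [← h, neg_neg])
    · exact Or.inl (neg_injective h)
  have hrot : ∀ l₁ l₂, P (l₁ ++ l₂) → P (l₂ ++ l₁) := by
    rintro l₁ l₂ ⟨g, hg, h⟩
    refine ⟨(wordProd F l₁)⁻¹ * g, mul_mem (inv_mem (wordProd_mem hFm l₁)) hg, ?_⟩
    have h1 : wordProd F (l₂ ++ l₁) = (wordProd F l₁)⁻¹ * wordProd F (l₁ ++ l₂) *
        wordProd F l₁ := by
      rw [wordProd_append, wordProd_append]; group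
    rw [h1]
    rcases h with h | h <;> rw [h]
    · left; group
    · right; simp only [mul_neg, neg_mul]; congr 1; group
  obtain ⟨l₀, hl₀⟩ := exists_word hp.sq hw
  obtain ⟨l, hl, hmin⟩ := exists_shortest (P := P)
    ⟨l₀, 1, one_mem _, by rw [one_mul, inv_one, mul_one]; exact hl₀⟩
  by_cases hi : i ∉ l
  · obtain ⟨g, hg, h⟩ := hl
    exact ⟨g, hg, l, hi, h⟩
  exfalso
  push Not at hi
  obtain ⟨l₁, l₂, rfl⟩ := List.append_of_mem hi
  -- If the letter `i` occurs, rotate it to the front.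
  obtain ⟨m, hm, hmmin⟩ : ∃ m, P (i :: m) ∧ ∀ n, P n → (i :: m).length ≤ n.length := by
    refine ⟨l₂ ++ l₁, hrot _ _ hl, fun n hn => ?_⟩
    have := hmin n hn
    simp only [List.length_append, List.length_cons] at this ⊢
    omega
  have hch := isChain_of_shortest hc hm hmmin
  obtain ⟨g, hg, hgw⟩ := id hm
  have hne0 : r ≠ 0 := by rintro rfl; simp [br] at hrs
  have hne0' : s ≠ 0 := by rintro rfl; simp [br] at hrs
  have er := conj_eigen (g := g) hr
  have es := conj_eigen (g := g) hs
  have hr0 := act_ne_zero (g := g) hne0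
  have hs0 := act_ne_zero (g := g) hne0'
  have hrs' : br (act g r) (act g s) ≠ 0 := by rwa [br_act]
  have hno' := hno g hg
  set w' := g * w * g⁻¹
  set r' := act g r
  set s' := act g s
  rcases List.eq_nil_or_concat' m with rfl | ⟨m', j, rfl⟩
  · have h2 : w' * w' = -1 := by
      rw [wordProd_cons, wordProd_nil, mul_one] at hgw
      rcases hgw with h | h
      · rw [← h, hp.sq]
      · rw [← neg_mul_neg, ← h, hp.sq]
    exact mul_self_ne_neg_one hr0 er h2
  -- Equal first and last letters could be rotated together and cancelled.
  have hji : j ≠ i := by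
    rintro rfl
    have h1 : P (m' ++ j :: j :: []) := by
      have := hrot [j] (m' ++ [j]) (by simpa using hm)
      simpa using this
    have := hmmin _ (hc _ _ _ h1)
    simp at this
  have hQ : ∀ k v, Q k (act w' v) = Q k (act (wordProd F (i :: (m' ++ [j]))) v) := by
    intro k v
    refine (hp.act_of_eq_or_neg hgw k v).symm
  have step : ∀ v, Q j v ≤ 0 → 0 ≤ Q i (act w' v) := by
    intro v hv
    rw [hQ]
    exact hp.play j _ i hch (by simp) hv
  have hinv : ∀ l : List ι, (wordProd F l)⁻¹ = wordProd F l.reverse ∨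
      (wordProd F l)⁻¹ = -wordProd F l.reverse := by
    intro l
    induction l with
    | nil => left; simp [wordProd_nil]
    | cons k l ih =>
      have : (F k)⁻¹ = -F k := by rw [inv_eq_iff_mul_eq_one, mul_neg, hp.sq, neg_neg]
      rw [wordProd_cons, mul_inv_rev, this, List.reverse_cons, wordProd_append, wordProd_cons,
        wordProd_nil, mul_one]
      rcases ih with h | h <;> rw [h]
      · right; simp
      · left; simp
  have hrev : (i :: (m' ++ [j])).reverse = j :: (m'.reverse ++ [i]) := by simp
  have hchr : (j :: (m'.reverse ++ [i])).IsChain (· ≠ ·) := by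
    rw [← hrev, List.isChain_reverse]
    exact hch.imp fun _ _ h => h.symm
  have stepinv : ∀ v, Q i v ≤ 0 → 0 ≤ Q j (act w'⁻¹ v) := by
    intro v hv
    have h1 : w'⁻¹ = wordProd F (j :: (m'.reverse ++ [i])) ∨
        w'⁻¹ = -wordProd F (j :: (m'.reverse ++ [i])) := by
      rw [← hrev]
      rcases hgw with h | h
      · rw [← h]; exact hinv _
      · have h2 : w' = -wordProd F (i :: (m' ++ [j])) := by rw [h, neg_neg]
        rw [h2, inv_neg]
        rcases hinv (i :: (m' ++ [j])) with h3 | h3 <;> rw [h3]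
        · exact Or.inr rfl
        · exact Or.inl (neg_neg _)
    rw [hp.act_of_eq_or_neg h1]
    exact hp.play i _ j hchr (by simp) hv
  -- Forward iterates of `e` stay in the half-plane of `i`, backward ones in that of `j`, hence
  -- outside that of `i`. In the limit the two fixed points lie on opposite sides of the geodesic of
  -- `i`, against `hno`.
  have iter : ∀ n : ℕ, 0 ≤ Q i (act (w' ^ (n + 1)) e) := by
    intro n
    induction n with
    | zero => rw [zero_add, pow_one]; exact step _ (he0 j)
    | succ n ih =>
      rw [pow_succ', act_mul]
      exact step _ (hp.disj i j _ hji.symm ih)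
  have iterinv : ∀ n : ℕ, 0 ≤ -Q i (act (w'⁻¹ ^ (n + 1)) e) := by
    intro n
    induction n with
    | zero =>
      rw [zero_add, pow_one]
      have := hp.disj j i _ hji (stepinv _ (he0 i))
      linarith
    | succ n ih =>
      rw [pow_succ', act_mul]
      have := hp.disj j i _ hji (stepinv (act (w'⁻¹ ^ (n + 1)) e) (by linarith))
      linarith
  have ha1' : a ^ 2 ≠ 1 := ha1.ne
  have ha1'' : a⁻¹ ^ 2 ≠ 1 := by
    rw [inv_pow]
    intro h
    exact ha1' (inv_eq_one.mp h)
  obtain ⟨nr, nr'⟩ := hne w' r' a hr0 er ha1'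
  obtain ⟨ns, ns'⟩ := hne w' s' a⁻¹ hs0 es ha1''
  have hcomb := eq_combination r' s' e hrs'
  have p1 : 0 ≤ Q i s' := by
    refine nonneg_of_iterate hcont (hp.homog i) ha ha1 er es
      (x := br e s' / br r' s') (y := br r' e / br r' s') ?_ ?_
    · rw [br_swap r' e]
      exact div_ne_zero (neg_ne_zero.mpr nr') hrs'
    · intro n
      rw [← hcomb]
      exact iter n
  have p2 : 0 ≤ -Q i r' := by
    refine nonneg_of_iterate (q := fun v => -Q i v) hcont.neg (fun c v => by rw [hp.homog]; ring)
      ha ha1 (act_inv_eigen (inv_ne_zero ha) es |>.trans (by rw [inv_inv]))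
      (act_inv_eigen ha er) (x := br r' e / br r' s') (y := br e s' / br r' s') ?_ ?_
    · exact div_ne_zero ns' hrs'
    · intro n
      rw [add_comm (_ • s'), ← hcomb]
      exact iterinv n
  have p3 : 0 < Q i s' := lt_of_le_of_ne p1 (Ne.symm ns)
  have p4 : Q i r' < 0 := lt_of_le_of_ne (by linarith) nr
  nlinarith

end pingpong

/-! ### The arc of a Markov fraction as a side of an ideal triangle -/

/-- The vector of the rational number `p / q`. -/
def vecInt (p q : ℤ) : ℝ × ℝ := ((p : ℝ), (q : ℝ))

theorem IsInvolution.act_vecInf {p q : ℤ} {E : SL(2, ℤ)} (h : IsInvolution p q E) :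
    act E vecInf = vecInt p q := by
  rw [_root_.act_vecInf, h.1, h.2.1]; rfl

/-- The properties of the arc joining `∞` to a Markov fraction `p / q` on which the geometric
arguments are based: `N` generates the stabilizer of the closed geodesic disjoint from the arc, `E`
is an involution that reverses this geodesic, `F` is the involution that reverses the arc, and `Γ`
is generated by the torus group and the elliptic involution of the torus. -/
structure IsMarkovArc (p q : ℤ) (N E F : SL(2, ℤ)) (Γ : Subgroup SL(2, ℤ)) : Prop where
  pos : 0 < q
  N00 : N 0 0 = -p
  N10 : N 1 0 = -q
  N11 : N 1 1 = p + 3 * q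
  N_mem_PM : N ∈ torusGroupPM
  N_mem : N ∈ Γ
  le : torusGroup ≤ Γ
  E_conj : E * N * E⁻¹ = N⁻¹
  E_index : ∀ g ∈ Γ, g ∈ torusGroupPM ∨ E * g ∈ torusGroupPM
  F_inv : IsInvolution p q F
  F_index : ∀ g ∈ Γ, g ∈ torusGroupPM ∨ F * g ∈ torusGroupPM
  noncross : ∀ g ∈ Γ, 0 ≤ crossSign (act g vecInf) (act g (vecInt p q)) vecInf (vecInt p q)
  stab : ∀ g ∈ Γ, g 1 0 = 0 → ∃ m : ℤ, g = transl (3 * m) ∨ g = -transl (3 * m)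
  hyper : ∀ w ∈ Γ, ∀ (r s : ℝ × ℝ) (a : ℝ), br r s ≠ 0 → a ≠ 0 → a ^ 2 < 1 →
    act w r = a • r → act w s = a⁻¹ • s →
    (∀ g ∈ Γ, 0 ≤ crossSign (act g r) (act g s) vecInf (vecInt p q)) →
    ∃ g ∈ Γ, ∃ j : ℤ, g * w * g⁻¹ = N ^ j ∨ g * w * g⁻¹ = -N ^ j

section build
variable {p₁ q₁ p₂ q₂ p₃ q₃ : ℤ} {E₁ E₂ E₃ : SL(2, ℤ)}

/-- The letters of the ping-pong on the triangle `∞, x₁, x₂`. -/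
def letters (E₁ E₂ E₃ : SL(2, ℤ)) : Fin 3 → SL(2, ℤ) := ![E₁, E₂, E₂ * E₃ * E₂⁻¹]

/-- The quadratic forms that define the sides of the triangle `∞, x₁, x₂`. -/
def sideForms (p₁ q₁ p₂ q₂ : ℤ) : Fin 3 → ℝ × ℝ → ℝ :=
  ![fun r => br vecInf r * br (vecInt p₁ q₁) r,
    fun r => -(br vecInf r * br (vecInt p₂ q₂) r),
    fun r => -(br (vecInt p₁ q₁) r * br (vecInt p₂ q₂) r)]

/-- Since `E₃` exchanges `∞` and `x₃`, this makes `E₂ * E₃ * E₂⁻¹` exchange `x₁` and `x₂`: it is the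
half-turn for the third side of the triangle. -/
theorem IsSystem.act_E₂ (h : IsTriple p₁ q₁ p₂ q₂ p₃ q₃)
    (s : IsSystem p₁ q₁ p₂ q₂ p₃ q₃ E₁ E₂ E₃) :
    act E₂ (vecInt p₁ q₁) = -vecInt p₃ q₃ := by
  have hq2 := h.1.2.1
  obtain ⟨-, d12, d23⟩ := h
  have d2 := s.inv₂.det
  obtain ⟨a, b, c⟩ := s.inv₂
  have e1 : E₂ 0 0 * p₁ + E₂ 0 1 * q₁ = -p₃ := by
    rw [a]
    apply mul_left_cancel₀ hq2.ne'
    linear_combination q₁ * d2 - p₂ * d12 + d23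
  have e2 : E₂ 1 0 * p₁ + E₂ 1 1 * q₁ = -q₃ := by
    rw [b, c]; linear_combination -d12
  ext
  · simp only [act, vecInt, Prod.fst_neg]; exact_mod_cast e1
  · simp only [act, vecInt, Prod.snd_neg]; exact_mod_cast e2

theorem act_sq_neg {E : SL(2, ℤ)} (h : E * E = -1) (v : ℝ × ℝ) : act E (act E v) = -v := by
  rw [← act_mul, h, act_neg, act_one]

/-- Each letter exchanges the ends of one side of the triangle `∞, x₁, x₂`, hence also the two
half-planes of this side. The half-planes beyond the three sides do not overlap. -/
theorem isPingPong_letters (h : IsTriple p₁ q₁ p₂ q₂ p₃ q₃)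
    (s : IsSystem p₁ q₁ p₂ q₂ p₃ q₃ E₁ E₂ E₃) :
    IsPingPong (letters E₁ E₂ E₃) (sideForms p₁ q₁ p₂ q₂) := by
  have sq1 := mul_self_of_trace_zero s.inv₁.trace
  have sq2 := mul_self_of_trace_zero s.inv₂.trace
  have sq3 := mul_self_of_trace_zero s.inv₃.trace
  have i1 := inv_of_trace_zero s.inv₁.trace
  have i2 := inv_of_trace_zero s.inv₂.trace
  have i3 := inv_of_trace_zero s.inv₃.trace
  have a1 := s.inv₁.act_vecInf
  have a2 := s.inv₂.act_vecInf
  have a3 := s.inv₃.act_vecInf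
  have a1' : act E₁ (vecInt p₁ q₁) = -vecInf := by rw [← a1, act_sq_neg sq1]
  have a2' : act E₂ (vecInt p₂ q₂) = -vecInf := by rw [← a2, act_sq_neg sq2]
  have a3' : act E₃ (vecInt p₃ q₃) = -vecInf := by rw [← a3, act_sq_neg sq3]
  have b := s.act_E₂ h
  have b' : act E₂ (vecInt p₃ q₃) = vecInt p₁ q₁ := by
    have := act_sq_neg sq2 (vecInt p₁ q₁)
    rw [b] at this
    have h2 : act E₂ (-vecInt p₃ q₃) = -act E₂ (vecInt p₃ q₃) := by
      have := act_smul E₂ (-1) (vecInt p₃ q₃)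
      simpa using this
    rw [h2] at this
    exact neg_injective this
  obtain ⟨⟨hq1, hq2, hq3, hm⟩, d12, d23⟩ := id h
  have r1 : (0 : ℝ) < q₁ := by exact_mod_cast hq1
  have r2 : (0 : ℝ) < q₂ := by exact_mod_cast hq2
  have r3 : (0 : ℝ) < q₃ := by exact_mod_cast hq3
  have d12' : (p₂ : ℝ) * q₁ - p₁ * q₂ = q₃ := by exact_mod_cast d12
  -- The linear relation between the three vertices has positive coefficients. Multiplied by one of
  -- the brackets, it compares two side forms up to a square, which is what disjointness needs.
  have rel : ∀ r, (q₁ : ℝ) * br (vecInt p₂ q₂) r = q₂ * br (vecInt p₁ q₁) r + q₃ * br vecInf r := by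
    intro r
    simp only [br, vecInt, vecInf]
    linear_combination r.2 * d12'
  have neg_v : ∀ (E : SL(2, ℤ)) v, act E (-v) = -act E v := by
    intro E v
    have := act_smul E (-1) v
    simpa using this
  refine ⟨?_, ?_, ?_, ?_⟩
  · intro i
    fin_cases i
    · exact sq1
    · exact sq2
    · change E₂ * E₃ * E₂⁻¹ * (E₂ * E₃ * E₂⁻¹) = -1
      rw [show E₂ * E₃ * E₂⁻¹ * (E₂ * E₃ * E₂⁻¹) = E₂ * (E₃ * E₃) * E₂⁻¹ by group, sq3]
      simp
  · intro i r
    fin_cases i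
    · change br vecInf (act E₁ r) * br (vecInt p₁ q₁) (act E₁ r) =
        -(br vecInf r * br (vecInt p₁ q₁) r)
      rw [br_act_right, br_act_right, i1, act_neg, act_neg, a1, a1', neg_neg, br_neg_left]
      ring
    · change -(br vecInf (act E₂ r) * br (vecInt p₂ q₂) (act E₂ r)) =
        - -(br vecInf r * br (vecInt p₂ q₂) r)
      rw [br_act_right, br_act_right, i2, act_neg, act_neg, a2, a2', neg_neg, br_neg_left]
      ring
    · change -(br (vecInt p₁ q₁) (act (E₂ * E₃ * E₂⁻¹) r) *
        br (vecInt p₂ q₂) (act (E₂ * E₃ * E₂⁻¹) r)) =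
        - -(br (vecInt p₁ q₁) r * br (vecInt p₂ q₂) r)
      rw [br_act_right, br_act_right]
      have hinv : (E₂ * E₃ * E₂⁻¹)⁻¹ = E₂ * (E₃ * E₂) := by
        simp only [mul_inv_rev, i2, i3, inv_neg]; simp
      rw [hinv, act_mul, act_mul, act_mul, act_mul, b, a2', neg_v, neg_v, neg_v, neg_v, a3, a3',
        neg_v, b', a2]
      simp only [br_neg_left, neg_neg]
      ring
  · intro i j r hij hi
    have hr := rel r
    fin_cases i <;> fin_cases j <;> simp only [sideForms, Fin.zero_eta, Fin.mk_one,
      Fin.reduceFinMk, Matrix.cons_val_zero, Matrix.cons_val_one, Matrix.cons_val] at hi ⊢ <;>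
      first | exact absurd rfl hij | skip
    all_goals
      set a := br vecInf r
      set b := br (vecInt p₁ q₁) r
      set c := br (vecInt p₂ q₂) r
      clear_value a b c
    · have : (q₁ : ℝ) * (a * c) = q₂ * (a * b) + q₃ * a ^ 2 := by linear_combination a * hr
      have h2 : 0 ≤ (q₁ : ℝ) * (a * c) := by rw [this]; positivity
      linarith [nonneg_of_mul_nonneg_right h2 r1]
    · have : (q₁ : ℝ) * (b * c) = q₂ * b ^ 2 + q₃ * (a * b) := by linear_combination b * hr
      have h2 : 0 ≤ (q₁ : ℝ) * (b * c) := by rw [this]; positivity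
      linarith [nonneg_of_mul_nonneg_right h2 r1]
    · have : (q₂ : ℝ) * (-(a * b)) = q₁ * (-(a * c)) + q₃ * a ^ 2 := by linear_combination a * hr
      have h2 : 0 ≤ (q₂ : ℝ) * (-(a * b)) := by rw [this]; positivity
      linarith [nonneg_of_mul_nonneg_right h2 r2]
    · have : (q₂ : ℝ) * (b * c) = q₁ * c ^ 2 + q₃ * (-(a * c)) := by linear_combination (-c) * hr
      have h2 : 0 ≤ (q₂ : ℝ) * (b * c) := by rw [this]; positivity
      linarith [nonneg_of_mul_nonneg_right h2 r2]
    · have : (q₃ : ℝ) * (-(a * b)) = q₂ * b ^ 2 + q₁ * (-(b * c)) := by linear_combination b * hr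
      have h2 : 0 ≤ (q₃ : ℝ) * (-(a * b)) := by rw [this]; positivity
      linarith [nonneg_of_mul_nonneg_right h2 r3]
    · have : (q₃ : ℝ) * (a * c) = q₁ * c ^ 2 + q₂ * (-(b * c)) := by linear_combination (-c) * hr
      have h2 : 0 ≤ (q₃ : ℝ) * (a * c) := by rw [this]; positivity
      linarith [nonneg_of_mul_nonneg_right h2 r3]
  · intro i c r
    fin_cases i <;> simp [sideForms, br_smul_right] <;> ring

/-- As `E` inverts `N`, the two remaining letters `E` and `E * N⁻¹` generate a dihedral group up to
sign. -/
theorem word_dihedral {E N F' : SL(2, ℤ)} (hE : E * E = -1) (hconj : E * N * E⁻¹ = N⁻¹)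
    (hF' : F' = E * N⁻¹) {F : Fin 3 → SL(2, ℤ)} (h1 : F 1 = E) (h2 : F 2 = F')
    (l : List (Fin 3)) (hl : 0 ∉ l) :
    ∃ j : ℤ, wordProd F l = N ^ j ∨ wordProd F l = -N ^ j ∨ wordProd F l = E * N ^ j ∨
      wordProd F l = -(E * N ^ j) := by
  have hc : ∀ j : ℤ, N ^ j * E = E * N ^ (-j) := by
    intro j
    have : E * N ^ (-j) * E⁻¹ = N ^ j := by
      have h3 : (E * N * E⁻¹) ^ (-j) = E * N ^ (-j) * E⁻¹ := conj_zpow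
      rw [← h3, hconj, inv_zpow, zpow_neg, inv_inv]
    rw [← this]; group
  have hE' : ∀ g : SL(2, ℤ), E * (E * g) = -g := by
    intro g; rw [← mul_assoc, hE, neg_one_mul]
  induction l with
  | nil => exact ⟨0, Or.inl (by simp [wordProd_nil])⟩
  | cons i l ih =>
    simp only [List.mem_cons, not_or] at hl
    obtain ⟨j, hj⟩ := ih hl.2
    rw [wordProd_cons]
    have hi : i = 1 ∨ i = 2 := by
      have := hl.1
      revert this
      fin_cases i <;> decide
    rcases hi with rfl | rfl
    · rw [h1]
      rcases hj with hj | hj | hj | hj <;> rw [hj]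
      · exact ⟨j, Or.inr (Or.inr (Or.inl rfl))⟩
      · exact ⟨j, Or.inr (Or.inr (Or.inr (mul_neg _ _)))⟩
      · exact ⟨j, Or.inr (Or.inl (hE' _))⟩
      · exact ⟨j, Or.inl (by rw [mul_neg, hE', neg_neg])⟩
    · rw [h2, hF']
      have e1 : ∀ j : ℤ, E * N⁻¹ * N ^ j = E * N ^ (j - 1) := by
        intro j; rw [mul_assoc, ← zpow_neg_one, ← zpow_add]; congr 2; ring
      have e2 : ∀ j : ℤ, E * N⁻¹ * (E * N ^ j) = -N ^ (j + 1) := by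
        intro j
        have := hc (-1)
        rw [zpow_neg_one, neg_neg, zpow_one] at this
        rw [mul_assoc, ← mul_assoc N⁻¹, this, mul_assoc, hE', ← zpow_one_add, add_comm]
      rcases hj with hj | hj | hj | hj <;> rw [hj]
      · exact ⟨_, Or.inr (Or.inr (Or.inl (e1 j)))⟩
      · exact ⟨_, Or.inr (Or.inr (Or.inr (by rw [mul_neg, e1])))⟩
      · exact ⟨_, Or.inr (Or.inl (e2 j))⟩
      · exact ⟨_, Or.inl (by rw [mul_neg, e2, neg_neg])⟩

/-- A rational Markov triple gives rise to an arc. -/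
theorem isMarkovArc_of_system (h : IsTriple p₁ q₁ p₂ q₂ p₃ q₃)
    (s : IsSystem p₁ q₁ p₂ q₂ p₃ q₃ E₁ E₂ E₃) :
    IsMarkovArc p₁ q₁ (-(E₂ * E₃)) E₂ E₁ (Subgroup.closure {E₁, E₂, E₃}) := by
  have sq1 := mul_self_of_trace_zero s.inv₁.trace
  have sq2 := mul_self_of_trace_zero s.inv₂.trace
  have sq3 := mul_self_of_trace_zero s.inv₃.trace
  have i1 := inv_of_trace_zero s.inv₁.trace
  have i2 := inv_of_trace_zero s.inv₂.trace
  have i3 := inv_of_trace_zero s.inv₃.trace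
  have hp := isPingPong_letters h s
  obtain ⟨n0, n1, n2⟩ := prod23_entries h s.inv₂ s.inv₃
  set Γ := Subgroup.closure {E₁, E₂, E₃} with hΓ
  have m1 : E₁ ∈ Γ := Subgroup.subset_closure (by simp)
  have m2 : E₂ ∈ Γ := Subgroup.subset_closure (by simp)
  have m3 : E₃ ∈ Γ := Subgroup.subset_closure (by simp)
  have hneg : (-1 : SL(2, ℤ)) ∈ Γ := neg_one_mem_of_trace_zero m1 s.inv₁.trace
  have hΓ' : Γ = Subgroup.closure (Set.range (letters E₁ E₂ E₃)) := by
    apply le_antisymm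
    · rw [hΓ, Subgroup.closure_le]
      have k1 : E₁ ∈ Subgroup.closure (Set.range (letters E₁ E₂ E₃)) :=
        Subgroup.subset_closure ⟨0, rfl⟩
      have k2 : E₂ ∈ Subgroup.closure (Set.range (letters E₁ E₂ E₃)) :=
        Subgroup.subset_closure ⟨1, rfl⟩
      have k3 : E₂ * E₃ * E₂⁻¹ ∈ Subgroup.closure (Set.range (letters E₁ E₂ E₃)) :=
        Subgroup.subset_closure ⟨2, rfl⟩
      have k3' : E₃ ∈ Subgroup.closure (Set.range (letters E₁ E₂ E₃)) := by
        have : E₃ = E₂⁻¹ * (E₂ * E₃ * E₂⁻¹) * E₂ := by group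
        have m := mul_mem (mul_mem (inv_mem k2) k3) k2
        rwa [← this] at m
      rintro _ (rfl | rfl | rfl)
      exacts [k1, k2, k3']
    · rw [Subgroup.closure_le]
      rintro _ ⟨i, rfl⟩
      fin_cases i
      · exact m1
      · exact m2
      · exact mul_mem (mul_mem m2 m3) (inv_mem m2)
  have hS : ∀ E ∈ ({E₁, E₂, E₃} : Set SL(2, ℤ)), E 1 1 = -E 0 0 := by
    rintro _ (rfl | rfl | rfl)
    exacts [s.inv₁.trace, s.inv₂.trace, s.inv₃.trace]
  have neg1PM : (-1 : SL(2, ℤ)) ∈ torusGroupPM := neg_mem_torusGroupPM (one_mem _)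
  have even : ∀ E ∈ ({E₁, E₂, E₃} : Set SL(2, ℤ)), ∀ E' ∈ ({E₁, E₂, E₃} : Set SL(2, ℤ)),
      E * E' ∈ torusGroupPM := by
    have k12 := s.even₁₂
    have k23 := s.even₂₃
    have k13 : E₁ * E₃ ∈ torusGroupPM := by
      have : E₁ * E₃ = -((E₁ * E₂) * (E₂ * E₃)) := by
        rw [show (E₁ * E₂) * (E₂ * E₃) = E₁ * (E₂ * E₂) * E₃ by group, sq2]; simp
      rw [this]; exact neg_mem_torusGroupPM (mul_mem k12 k23)
    have k21 : E₂ * E₁ ∈ torusGroupPM := by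
      have : E₂ * E₁ = (E₁ * E₂)⁻¹ := by simp [mul_inv_rev, i1, i2]
      rw [this]; exact inv_mem k12
    have k32 : E₃ * E₂ ∈ torusGroupPM := by
      have : E₃ * E₂ = (E₂ * E₃)⁻¹ := by simp [mul_inv_rev, i3, i2]
      rw [this]; exact inv_mem k23
    have k31 : E₃ * E₁ ∈ torusGroupPM := by
      have : E₃ * E₁ = (E₁ * E₃)⁻¹ := by simp [mul_inv_rev, i3, i1]
      rw [this]; exact inv_mem k13
    rintro _ (rfl | rfl | rfl) _ (rfl | rfl | rfl)
    exacts [sq1 ▸ neg1PM, k12, k13, k21, sq2 ▸ neg1PM, k23, k31, k32, sq3 ▸ neg1PM]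
  have index : ∀ E ∈ ({E₁, E₂, E₃} : Set SL(2, ℤ)), ∀ g ∈ Γ,
      g ∈ torusGroupPM ∨ E * g ∈ torusGroupPM := by
    intro E hE g hg
    have hEE := mul_self_of_trace_zero (hS E hE)
    have step : ∀ x ∈ ({E₁, E₂, E₃} : Set SL(2, ℤ)), ∀ y : SL(2, ℤ),
        (y ∈ torusGroupPM ∨ E * y ∈ torusGroupPM) →
        (x * y ∈ torusGroupPM ∨ E * (x * y) ∈ torusGroupPM) := by
      intro x hx y ih
      rcases ih with ih | ih
      · right
        rw [← mul_assoc]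
        exact mul_mem (even E hE x hx) ih
      · left
        have : x * y = -((x * E) * (E * y)) := by
          rw [show (x * E) * (E * y) = x * (E * E) * y by group, hEE]; simp
        rw [this]
        exact neg_mem_torusGroupPM (mul_mem (even x hx E hE) ih)
    induction hg using Subgroup.closure_induction_left with
    | one => exact Or.inl (one_mem _)
    | mul_left x hx y hy ih => exact step x hx y ih
    | inv_mul_cancel x hx y hy ih =>
      rw [inv_of_trace_zero (hS x hx)]
      have := step x hx y ih
      rw [neg_mul, mul_neg]
      exact this.imp neg_mem_torusGroupPM neg_mem_torusGroupPM
  have hconj : E₂ * (-(E₂ * E₃)) * E₂⁻¹ = (-(E₂ * E₃))⁻¹ := by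
    rw [mul_neg, ← mul_assoc, sq2, inv_neg, mul_inv_rev, i2, i3]; simp
  have a1 := s.inv₁.act_vecInf
  have hq1 : (0 : ℝ) < q₁ := by exact_mod_cast h.1.1
  have hq2 : (0 : ℝ) < q₂ := by exact_mod_cast h.1.2.1
  have hq3 : (0 : ℝ) < q₃ := by exact_mod_cast h.1.2.2.1
  have d12' : (p₂ : ℝ) * q₁ - p₁ * q₂ = q₃ := by exact_mod_cast h.2.1
  have cross_eq : ∀ u v : ℝ × ℝ, crossSign u v vecInf (vecInt p₁ q₁) =
      sideForms p₁ q₁ p₂ q₂ 0 u * sideForms p₁ q₁ p₂ q₂ 0 v := by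
    intro u v
    simp only [sideForms, crossSign, Matrix.cons_val_zero, br]
    ring
  have hu : ∀ j, sideForms p₁ q₁ p₂ q₂ j vecInf ≤ 0 := by
    intro j
    fin_cases j <;> simp [sideForms, br, vecInf, vecInt]
    positivity
  have hv : ∀ j, sideForms p₁ q₁ p₂ q₂ j (vecInt p₁ q₁) ≤ 0 := by
    intro j
    fin_cases j <;> simp [sideForms, br, vecInf, vecInt]
    · rw [mul_comm (p₁ : ℝ) q₁]; simp
    · rw [mul_comm (q₂ : ℝ) p₁, d12']; positivity
    · rw [mul_comm (p₁ : ℝ) q₁]; simp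
  refine ⟨h.1.1, ?_, ?_, ?_, neg_mem_torusGroupPM s.even₂₃, ?_, s.gen, hconj,
    index _ (by simp), s.inv₁, index _ (by simp), ?_, fun g hg => eq_transl_of_fix_inf hS hg,
    ?_⟩
  · rw [neg_entry, n0]
  · rw [neg_entry, n1]
  · rw [neg_entry, n2, neg_neg]
  · rw [← neg_one_mul]; exact mul_mem hneg (mul_mem m2 m3)
  · intro g hg
    rw [cross_eq]
    rw [hΓ'] at hg
    exact hp.noncross 0 hu hv (by simp [sideForms, br, vecInf]) hg
  · intro w hw r t a hrt ha ha1 hr ht hno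
    rw [hΓ'] at hw
    obtain ⟨g, hg, l, hl, hgl⟩ := hp.exists_conj_word (i := 0) (e := vecInf)
      (by simp only [sideForms, Matrix.cons_val_zero, br]; fun_prop) hu
      (by
        intro w r a hr0 hwr ha
        have e1 := br_vecInf_ne_zero_of_eigen hr0 hwr ha
        refine ⟨?_, e1⟩
        simp only [sideForms, Matrix.cons_val_zero]
        refine mul_ne_zero e1 ?_
        rw [← a1, br_act_left]
        exact br_vecInf_ne_zero_of_eigen (act_ne_zero hr0) (conj_eigen (g := E₁⁻¹) hwr) ha)
      hw hrt ha ha1 hr ht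
      (by intro g hg; rw [← cross_eq]; exact hno g (by rw [hΓ']; exact hg))
    refine ⟨g, by rw [hΓ']; exact hg, ?_⟩
    obtain ⟨j, hj⟩ := word_dihedral (F' := E₂ * E₃ * E₂⁻¹) sq2 hconj (by
        rw [inv_neg, mul_inv_rev, i2, i3]; simp [mul_assoc])
      (F := letters E₁ E₂ E₃) rfl rfl l hl
    have hr0 : r ≠ 0 := by rintro rfl; simp [br] at hrt
    have hns := mul_self_ne_neg_one (act_ne_zero (g := g) hr0) (conj_eigen (g := g) hr)
    -- The reflections of the dihedral group square to `-1`, so they have no real eigenvector and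
    -- cannot be conjugate to `w`.
    have hsq : ∀ j : ℤ, E₂ * (-(E₂ * E₃)) ^ j * (E₂ * (-(E₂ * E₃)) ^ j) = -1 := by
      intro j
      have h3 : E₂ * (-(E₂ * E₃)) ^ j * E₂⁻¹ = (-(E₂ * E₃)) ^ (-j) := by
        rw [← conj_zpow, hconj, inv_zpow, zpow_neg]
      calc E₂ * (-(E₂ * E₃)) ^ j * (E₂ * (-(E₂ * E₃)) ^ j)
          = (E₂ * (-(E₂ * E₃)) ^ j * E₂⁻¹) * (E₂ * E₂) * (-(E₂ * E₃)) ^ j := by group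
        _ = -1 := by rw [h3, sq2]; simp
    generalize wordProd (letters E₁ E₂ E₃) l = W at hgl hj
    generalize g * w * g⁻¹ = w' at hgl hns
    generalize (-(E₂ * E₃)) = N at hj hsq
    refine ⟨j, ?_⟩
    have hW : w' = W ∨ w' = -W := by
      rcases hgl with h | h
      · exact Or.inl h.symm
      · exact Or.inr (by rw [h, neg_neg])
    rcases hj with hj | hj | hj | hj
    · rcases hW with h | h <;> rw [h, hj]
      · exact Or.inl rfl
      · exact Or.inr rfl
    · rcases hW with h | h <;> rw [h, hj]
      · exact Or.inr rfl
      · exact Or.inl (neg_neg _)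
    · exfalso; apply hns
      rcases hW with h | h <;> rw [h, hj]
      · exact hsq j
      · rw [neg_mul_neg]; exact hsq j
    · exfalso; apply hns
      rcases hW with h | h <;> rw [h, hj]
      · rw [neg_mul_neg]; exact hsq j
      · rw [neg_neg]; exact hsq j

end build

/-- Every Markov fraction gives rise to an arc. -/
theorem exists_isMarkovArc {x : ℚ} (hx : IsMarkovFraction x) :
    ∃ (p q : ℤ) (N E F : SL(2, ℤ)) (Γ : Subgroup SL(2, ℤ)), IsMarkovArc p q N E F Γ ∧
      x = p / q := by
  have key : ∀ p₁ q₁ p₂ q₂ p₃ q₃ : ℤ, IsTriple p₁ q₁ p₂ q₂ p₃ q₃ →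
      ∃ (N E F : SL(2, ℤ)) (Γ : Subgroup SL(2, ℤ)), IsMarkovArc p₁ q₁ N E F Γ := by
    intro p₁ q₁ p₂ q₂ p₃ q₃ h
    obtain ⟨E₁, E₂, E₃, s⟩ := exists_system h
    exact ⟨_, _, _, _, isMarkovArc_of_system h s⟩
  obtain ⟨x₁, x₂, x₃, ⟨p₁, p₂, p₃, q₁, q₂, q₃, hm, h1, h2, h3, d12, d23⟩, hx⟩ := hx
  have ht : IsTriple p₁ q₁ p₂ q₂ p₃ q₃ := ⟨hm, d12, d23⟩
  rcases hx with rfl | rfl | rfl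
  · obtain ⟨N, E, F, Γ, h⟩ := key _ _ _ _ _ _ ht
    exact ⟨_, _, N, E, F, Γ, h, h1⟩
  · obtain ⟨N, E, F, Γ, h⟩ := key _ _ _ _ _ _ ht.rot
    exact ⟨_, _, N, E, F, Γ, h, h2⟩
  · obtain ⟨N, E, F, Γ, h⟩ := key _ _ _ _ _ _ ht.rot.rot
    exact ⟨_, _, N, E, F, Γ, h, h3⟩

/-! ### The chain of cusps along the closed geodesic -/

/-- The chain of cusps `N ^ k • ∞`, as vectors. -/
def chain (N : SL(2, ℤ)) (k : ℤ) : ℝ × ℝ := act (N ^ k) vecInf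

/-- The companion sequence, extended to all integers. -/
noncomputable def seqU (q : ℤ) (N : SL(2, ℤ)) (k : ℤ) : ℝ := -(chain N k).2 / q

/-- The position of a cusp in the chain. -/
noncomputable def chainPt (N : SL(2, ℤ)) (k : ℤ) : ℝ := (chain N k).1 / (chain N k).2

theorem chain_zero (N : SL(2, ℤ)) : chain N 0 = vecInf := by simp [chain, act_one]

theorem act_zpow_chain (N : SL(2, ℤ)) (m k : ℤ) : act (N ^ m) (chain N k) = chain N (m + k) := by
  rw [chain, chain, ← act_mul, zpow_add]

theorem crossSign_zpow (N w : SL(2, ℤ)) (i j k l m : ℤ) :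
    crossSign (act w (chain N i)) (act w (chain N j)) (chain N k) (chain N l) =
      crossSign (act (N ^ m * w) (chain N i)) (act (N ^ m * w) (chain N j))
        (chain N (m + k)) (chain N (m + l)) := by
  rw [act_mul, act_mul, ← act_zpow_chain, ← act_zpow_chain, crossSign_act]

/-- A sequence without sign changes between consecutive terms vanishes somewhere between two
terms of opposite sign. -/
theorem exists_zero_between {h : ℤ → ℝ} (hh : ∀ a, 0 ≤ h a * h (a + 1)) {k l : ℤ} (hkl : k < l)
    (hneg : h k * h l < 0) : ∃ a, k < a ∧ a < l ∧ h a = 0 := by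
  by_contra hno
  push Not at hno
  have hk : h k ≠ 0 := by rintro h0; simp [h0] at hneg
  have hl : h l ≠ 0 := by rintro h0; simp [h0] at hneg
  have key : ∀ n : ℕ, k + n ≤ l → 0 < h k * h (k + n) := by
    intro n
    induction n with
    | zero => intro _; simp only [Nat.cast_zero, add_zero]; exact mul_self_pos.mpr hk
    | succ n ih =>
      intro hn
      push_cast at hn ⊢
      have h1 := ih (by linarith)
      have h2 := hh (k + n)
      rw [add_assoc] at h2
      have h3 : h (k + (n + 1)) ≠ 0 := by
        rcases lt_or_eq_of_le hn with h | h
        · exact hno _ (by omega) h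
        · rw [h]; exact hl
      by_contra hcon
      have h4 : h k * h (k + (n + 1)) < 0 :=
        lt_of_le_of_ne (not_lt.mp hcon) (mul_ne_zero hk h3)
      have h5 : 0 < h (k + n) * h (k + n) := by
        have : h (k + n) ≠ 0 := by rintro h0; simp [h0] at h1
        exact mul_self_pos.mpr this
      have h6 : (h k * h (k + n)) * (h (k + n) * h (k + (n + 1))) =
        (h k * h (k + (n + 1))) * (h (k + n) * h (k + n)) := by ring
      have h7 : 0 ≤ (h k * h (k + n)) * (h (k + n) * h (k + (n + 1))) := mul_nonneg h1.le h2
      rw [h6] at h7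
      nlinarith
  have h1 := key (l - k).toNat (by omega)
  have h2 : k + ((l - k).toNat : ℤ) = l := by omega
  rw [h2] at h1
  linarith

/-- `w` is a power of `N`, up to sign. -/
def IsPowPM (N w : SL(2, ℤ)) : Prop := ∃ m : ℤ, w = N ^ m ∨ w = -N ^ m

theorem seqU_zero (q : ℤ) (N : SL(2, ℤ)) : seqU q N 0 = 0 := by simp [seqU, chain_zero, vecInf]

theorem act_transl_vecOf (n : ℤ) (y : ℝ) : act (transl n) (vecOf y) = vecOf (y + n) := by
  ext <;> simp only [act, vecOf, transl00, transl01, transl10, transl11] <;> push_cast <;> ring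

theorem act_transl_vecInf (n : ℤ) : act (transl n) vecInf = vecInf := by
  rw [act_vecInf, transl00, transl10]; simp [vecInf]

theorem br_vecOf (y z : ℝ) : br (vecOf y) (vecOf z) = y - z := by simp [br, vecOf]

theorem crossSign_of_isPow {N w : SL(2, ℤ)} {m : ℤ} (hm : w = N ^ m ∨ w = -N ^ m) (i j : ℤ)
    (r s : ℝ × ℝ) :
    crossSign (act w (chain N i)) (act w (chain N j)) r s =
      crossSign (chain N (m + i)) (chain N (m + j)) r s := by
  rcases hm with rfl | rfl
  · rw [act_zpow_chain, act_zpow_chain]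
  · rw [crossSign_act_neg_left, act_zpow_chain, act_zpow_chain]

namespace IsMarkovArc

variable {p q : ℤ} {N E F : SL(2, ℤ)} {Γ : Subgroup SL(2, ℤ)} (A : IsMarkovArc p q N E F Γ)
include A

theorem q_pos : (0 : ℝ) < q := by exact_mod_cast A.pos

theorem one_le_q : (1 : ℝ) ≤ q := by exact_mod_cast A.pos

theorem zpow_mem_PM (m : ℤ) : N ^ m ∈ torusGroupPM := zpow_mem A.N_mem_PM m

theorem zpow_mem_gamma (m : ℤ) : N ^ m ∈ Γ := zpow_mem A.N_mem m

theorem chain_one : chain N 1 = -vecInt p q := by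
  rw [chain, zpow_one, act_vecInf, A.N00, A.N10]
  simp [vecInt]

/-- Cayley–Hamilton for trace `3q`; this is the source of the recursion of the companion sequence.
-/
theorem act_add_act_inv (v : ℝ × ℝ) : act N v + act N⁻¹ v = (3 * q : ℝ) • v := by
  ext
  · simp only [act, inv00, inv01, A.N00, A.N11, Prod.fst_add, Prod.smul_fst, smul_eq_mul]
    push_cast; ring
  · simp only [act, inv10, inv11, A.N00, A.N11, Prod.snd_add, Prod.smul_snd, smul_eq_mul]
    push_cast; ring

theorem chain_rec (k : ℤ) : chain N (k + 1) + chain N (k - 1) = (3 * q : ℝ) • chain N k := by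
  rw [← A.act_add_act_inv, add_comm k 1, ← act_zpow_chain N 1 k, zpow_one, sub_eq_neg_add,
    ← act_zpow_chain N (-1) k, zpow_neg_one]

theorem chain_snd (k : ℤ) : (chain N k).2 = -(q * seqU q N k) := by
  have := A.q_pos.ne'
  rw [seqU]; field_simp

/-- Only the difference of the indices matters, because `N` preserves the bracket. -/
theorem br_chain (i j : ℤ) : br (chain N i) (chain N j) = -(q * seqU q N (j - i)) := by
  rw [← A.chain_snd, ← br_vecInf_left, ← br_act (N ^ i) vecInf, act_zpow_chain,
    add_sub_cancel, chain]

theorem U_one : seqU q N 1 = 1 := by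
  have := A.q_pos.ne'
  rw [seqU, A.chain_one]
  simp [vecInt, this]

theorem U_rec (k : ℤ) : seqU q N (k + 1) = 3 * q * seqU q N k - seqU q N (k - 1) := by
  have := congrArg Prod.snd (A.chain_rec k)
  simp only [Prod.snd_add, Prod.smul_snd, smul_eq_mul] at this
  rw [A.chain_snd, A.chain_snd, A.chain_snd] at this
  apply mul_left_cancel₀ A.q_pos.ne'
  linarith

theorem U_neg (k : ℤ) : seqU q N (-k) = -seqU q N k := by
  have h1 := A.br_chain 0 k
  have h2 := A.br_chain k 0
  rw [br_swap, h1] at h2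
  simp only [sub_zero, zero_sub] at h2
  apply mul_left_cancel₀ A.q_pos.ne'
  linarith

theorem U_nat (k : ℕ) : seqU q N k = companionSeq q k := by
  induction k using Nat.twoStepInduction with
  | zero => simp [companionSeq, seqU_zero]
  | one => simp [companionSeq, A.U_one]
  | more k h1 h2 =>
    have := A.U_rec (k + 1)
    push_cast at h2 ⊢
    rw [add_sub_cancel_right, h1, h2] at this
    rw [show (k : ℤ) + 2 = k + 1 + 1 by ring, this, companionSeq]
    push_cast; ring

/-- Since `3q ≥ 3`, growth by at least one reproduces itself under the recursion. -/
theorem U_nat_aux (k : ℕ) : 0 ≤ seqU q N k ∧ seqU q N k + 1 ≤ seqU q N (k + 1) := by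
  induction k with
  | zero => simp [seqU_zero, A.U_one]
  | succ k ih =>
    have h1 := A.U_rec (k + 1)
    rw [add_sub_cancel_right] at h1
    push_cast
    refine ⟨by linarith, ?_⟩
    rw [h1]
    nlinarith [A.one_le_q]

theorem U_lt_succ (k : ℤ) : seqU q N k < seqU q N (k + 1) := by
  rcases le_or_gt 0 k with hk | hk
  · lift k to ℕ using hk
    linarith [(A.U_nat_aux k).2]
  · obtain ⟨m, hm⟩ : ∃ m : ℕ, k = -(m + 1 : ℤ) := ⟨(-k - 1).toNat, by omega⟩
    have := (A.U_nat_aux m).2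
    rw [hm, A.U_neg, show -((m : ℤ) + 1) + 1 = -(m : ℤ) by ring, A.U_neg]
    linarith

theorem U_strictMono : StrictMono (seqU q N) := strictMono_int_of_lt_succ A.U_lt_succ

theorem U_pos {k : ℤ} (hk : 0 < k) : 0 < seqU q N k := by
  rw [← seqU_zero]; exact A.U_strictMono hk

theorem U_neg_of_neg {k : ℤ} (hk : k < 0) : seqU q N k < 0 := by
  rw [← seqU_zero]; exact A.U_strictMono hk

theorem U_ne_zero {k : ℤ} (hk : k ≠ 0) : seqU q N k ≠ 0 := by
  rcases lt_or_gt_of_ne hk with h | h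
  · exact (A.U_neg_of_neg h).ne
  · exact (A.U_pos h).ne'

/-- The sequence changes sign only by passing through `u₀ = 0`. Through `crossSign_chain` this says
that an edge of the chain crosses no chord of it. -/
theorem U_mul_succ_nonneg (k : ℤ) : 0 ≤ seqU q N k * seqU q N (k + 1) := by
  rcases le_or_gt 0 k with hk | hk
  · have h1 : 0 ≤ seqU q N k := by
      rw [← seqU_zero]; exact A.U_strictMono.monotone hk
    exact mul_nonneg h1 (A.U_pos (by omega)).le
  · have h1 : seqU q N (k + 1) ≤ 0 := by
      rw [← seqU_zero]; exact A.U_strictMono.monotone (by omega)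
    exact mul_nonneg_of_nonpos_of_nonpos (A.U_neg_of_neg hk).le h1

theorem crossSign_chain (i j k l : ℤ) :
    crossSign (chain N i) (chain N j) (chain N k) (chain N l) =
      (q : ℝ) ^ 4 * (seqU q N (k - i) * seqU q N (l - i) *
        (seqU q N (k - j) * seqU q N (l - j))) := by
  simp only [crossSign, A.br_chain]; ring

theorem chain_neg_one : chain N (-1) = vecInt (p + 3 * q) q := by
  rw [chain, zpow_neg_one, act_vecInf, inv00, inv10, A.N11, A.N10]
  simp [vecInt]

theorem chain_snd_ne_zero {k : ℤ} (hk : k ≠ 0) : (chain N k).2 ≠ 0 := by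
  rw [A.chain_snd]
  exact neg_ne_zero.mpr (mul_ne_zero A.q_pos.ne' (A.U_ne_zero hk))

/-- Expand the bracket of `chain N k` with `chain N 1`, which represents `p / q`. This identifies
the cusps of the chain with the companions. -/
theorem chainPt_eq {k : ℤ} (hk : k ≠ 0) :
    chainPt N k = p / q + seqU q N (k - 1) / (q * seqU q N k) := by
  have h1 := A.br_chain 1 k
  rw [A.chain_one, br_neg_left] at h1
  simp only [br, vecInt] at h1
  have hq := A.q_pos.ne'
  have hU := A.U_ne_zero hk
  have hs := A.chain_snd_ne_zero hk
  have hc := A.chain_snd k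
  rw [chainPt, div_eq_iff hs]
  rw [hc] at h1 ⊢
  field_simp
  apply mul_left_cancel₀ hq
  linear_combination h1

theorem chainPt_eq' {k : ℤ} (hk : k ≠ 0) :
    chainPt N k = p / q + 3 - seqU q N (k + 1) / (q * seqU q N k) := by
  have hq := A.q_pos.ne'
  have hU := A.U_ne_zero hk
  rw [A.chainPt_eq hk, A.U_rec]
  field_simp
  ring

/-- With `chainPt_le`, the finite cusps of the chain fit into an interval of length `3`, the width
of the cusp stabilizer. -/
theorem le_chainPt {k : ℤ} (hk : k ≠ 0) : (p : ℝ) / q ≤ chainPt N k := by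
  rw [A.chainPt_eq hk]
  have h := A.U_mul_succ_nonneg (k - 1)
  rw [sub_add_cancel] at h
  have : seqU q N (k - 1) / (q * seqU q N k) =
      (seqU q N (k - 1) * seqU q N k) / (q * seqU q N k ^ 2) := by
    have hq := A.q_pos.ne'
    have hU := A.U_ne_zero hk
    field_simp
  rw [this]
  have hq := A.q_pos
  have : 0 ≤ (seqU q N (k - 1) * seqU q N k) / (q * seqU q N k ^ 2) := by positivity
  linarith

theorem chainPt_le {k : ℤ} (hk : k ≠ 0) : chainPt N k ≤ p / q + 3 := by
  rw [A.chainPt_eq' hk]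
  have h := A.U_mul_succ_nonneg k
  have : seqU q N (k + 1) / (q * seqU q N k) =
      (seqU q N k * seqU q N (k + 1)) / (q * seqU q N k ^ 2) := by
    have hq := A.q_pos.ne'
    have hU := A.U_ne_zero hk
    field_simp
  rw [this]
  have hq := A.q_pos
  have : 0 ≤ (seqU q N k * seqU q N (k + 1)) / (q * seqU q N k ^ 2) := by positivity
  linarith

theorem chain_eq_smul {k : ℤ} (hk : k ≠ 0) : chain N k = (chain N k).2 • vecOf (chainPt N k) := by
  have := A.chain_snd_ne_zero hk
  ext
  · simp only [vecOf, chainPt, Prod.smul_fst, smul_eq_mul]; field_simp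
  · simp [vecOf]

/-- A translate of a chord of the chain ending at `∞` that crosses a chord enclosing `∞` is not
properly translated. -/
theorem transl_eq_zero {i k l m : ℤ} (hk : k ≠ 0) (hl : l ≠ 0)
    (h : crossSign vecInf (act (transl (3 * m)) (chain N i)) (chain N k) (chain N l) < 0) :
    m = 0 := by
  by_cases hi : i = 0
  · exfalso
    rw [hi, chain_zero, act_transl_vecInf] at h
    simp only [crossSign] at h
    nlinarith [mul_self_nonneg (br vecInf (chain N k) * br vecInf (chain N l))]
  rw [A.chain_eq_smul hi, A.chain_eq_smul hk, A.chain_eq_smul hl, act_smul,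
    act_transl_vecOf, ← one_smul ℝ vecInf, crossSign_smul_left, crossSign_smul_right] at h
  have h1 := A.chain_snd_ne_zero hi
  have h2 := A.chain_snd_ne_zero hk
  have h3 := A.chain_snd_ne_zero hl
  simp only [crossSign, br_vecOf, br_vecInf_left] at h
  simp only [vecOf] at h
  -- Crossing means that the shifted foot lies strictly between two points of an interval of length
  -- `3` that already contains the unshifted foot.
  have h4 : (chainPt N i + ((3 * m : ℤ) : ℝ) - chainPt N k) *
      (chainPt N i + ((3 * m : ℤ) : ℝ) - chainPt N l) < 0 := by
    by_contra hcon
    rw [not_lt] at hcon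
    have : 0 ≤ (1 * (chain N i).2) ^ 2 * (((chain N k).2 * (chain N l).2) ^ 2 * (1 * 1 *
      ((chainPt N i + ((3 * m : ℤ) : ℝ) - chainPt N k) *
        (chainPt N i + ((3 * m : ℤ) : ℝ) - chainPt N l)))) := by
      rw [one_mul 1, one_mul ((_ : ℝ) * _)]
      exact mul_nonneg (sq_nonneg _) (mul_nonneg (sq_nonneg _) hcon)
    linarith
  have a1 := A.le_chainPt hi
  have a2 := A.chainPt_le hi
  have b1 := A.le_chainPt hk
  have b2 := A.chainPt_le hk
  have c1 := A.le_chainPt hl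
  have c2 := A.chainPt_le hl
  push_cast at h4
  have u1 : (m : ℝ) < 1 := by
    by_contra hcon
    nlinarith
  have u2 : (-1 : ℝ) < m := by
    by_contra hcon
    nlinarith
  have u1' : m < 1 := by exact_mod_cast u1
  have u2' : -1 < m := by exact_mod_cast u2
  omega

/-! ### Translates of the chords of the chain -/

theorem stab_of_br {g : SL(2, ℤ)} (hg : g ∈ Γ) (h : br (act g vecInf) vecInf = 0) :
    ∃ m : ℤ, g = transl (3 * m) ∨ g = -transl (3 * m) := by
  apply A.stab g hg
  rw [br_vecInf_right, act_vecInf] at h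
  have : (g 1 0 : ℝ) = 0 := by simpa using h
  exact_mod_cast this

/-- A group element that moves a cusp of the chain to a cusp of the chain is, up to powers of
`N`, a translation. -/
theorem stab_chain {w : SL(2, ℤ)} (hw : w ∈ Γ) {i a : ℤ}
    (h : br (act w (chain N i)) (chain N a) = 0) :
    ∃ m : ℤ, w = N ^ a * transl (3 * m) * N ^ (-i) ∨ w = -(N ^ a * transl (3 * m) * N ^ (-i)) := by
  have h1 : br (act (N ^ (-a) * w * N ^ i) vecInf) vecInf = 0 := by
    rw [act_mul, act_mul, ← chain, br_act_left, zpow_neg, inv_inv, ← chain]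
    exact h
  obtain ⟨m, hm⟩ := A.stab_of_br
    (mul_mem (mul_mem (A.zpow_mem_gamma _) hw) (A.zpow_mem_gamma _)) h1
  refine ⟨m, ?_⟩
  have h2 : w = N ^ a * (N ^ (-a) * w * N ^ i) * N ^ (-i) := by group
  rcases hm with hm | hm <;> rw [hm] at h2
  · exact Or.inl h2
  · right; rw [h2]; simp

/-- The translated chord ends at a cusp of the chain strictly between cusps `k` and `l`. Moving that
cusp to `∞` by `N ^ (-a)` leaves a translation by `3m`, which `transl_eq_zero` shows to be trivial.
-/
theorem isPowPM_of_zero {w : SL(2, ℤ)} (hw : w ∈ Γ) {i j k l a : ℤ} (hka : k < a) (hal : a < l)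
    (hneg : crossSign (act w (chain N i)) (act w (chain N j)) (chain N k) (chain N l) < 0)
    (h : br (act w (chain N i)) (chain N a) = 0) : IsPowPM N w := by
  obtain ⟨m, hm⟩ := A.stab_chain hw h
  have h1 : crossSign vecInf (act (transl (3 * m)) (chain N (j - i))) (chain N (-a + k))
      (chain N (-a + l)) < 0 := by
    rw [crossSign_zpow N w i j k l (-a)] at hneg
    have e1 : act (N ^ a * transl (3 * m) * N ^ (-i)) (chain N i) = act (N ^ a) vecInf := by
      rw [act_mul, act_mul, act_zpow_chain, neg_add_cancel, chain_zero, act_transl_vecInf]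
    have e2 : act (N ^ a * transl (3 * m) * N ^ (-i)) (chain N j) =
        act (N ^ a) (act (transl (3 * m)) (chain N (j - i))) := by
      rw [act_mul, act_mul, act_zpow_chain, neg_add_eq_sub]
    rw [act_mul, act_mul] at hneg
    have e3 : ∀ v, act (N ^ (-a)) (act (N ^ a) v) = v := by
      intro v; rw [zpow_neg, act_inv_act]
    rcases hm with hm | hm
    · rw [hm, e1, e2, e3, e3] at hneg
      exact hneg
    · rw [hm, act_neg, act_neg, e1, e2] at hneg
      have e4 : ∀ v, act (N ^ (-a)) (-act (N ^ a) v) = -v := by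
        intro v
        have := act_smul (N ^ (-a)) (-1) (act (N ^ a) v)
        rw [e3] at this
        simpa using this
      rw [e4, e4, crossSign_neg_left] at hneg
      exact hneg
  have hm0 := A.transl_eq_zero (by omega) (by omega) h1
  subst hm0
  refine ⟨a - i, ?_⟩
  rw [mul_zero, transl, zpow_zero, mul_one, ← zpow_add, ← sub_eq_add_neg] at hm
  exact hm

/-- The sign of `f a` tells on which side of the translated chord cusp `a` lies. It cannot flip
between neighbours, yet it differs at `k` and `l`; so it vanishes in between, and the translated
chord ends at a cusp of the chain. -/
theorem isPowPM_of_cross {w : SL(2, ℤ)} (hw : w ∈ Γ) {i j k l : ℤ}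
    (hedge : ∀ a, 0 ≤ crossSign (act w (chain N i)) (act w (chain N j)) (chain N a)
      (chain N (a + 1)))
    (hneg : crossSign (act w (chain N i)) (act w (chain N j)) (chain N k) (chain N l) < 0) :
    IsPowPM N w := by
  wlog hkl : k < l generalizing k l
  · rcases lt_or_eq_of_le (not_lt.mp hkl) with h | h
    · exact this (by rwa [crossSign_swap_right] at hneg) h
    · exfalso
      rw [h] at hneg
      simp only [crossSign] at hneg
      nlinarith [mul_self_nonneg (br (act w (chain N i)) (chain N k) *
        br (act w (chain N j)) (chain N k))]
  let f : ℤ → ℝ := fun a => br (act w (chain N i)) (chain N a) * br (act w (chain N j)) (chain N a)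
  have hf : ∀ a b, crossSign (act w (chain N i)) (act w (chain N j)) (chain N a) (chain N b) =
      f a * f b := by
    intro a b; simp only [crossSign, f]; ring
  obtain ⟨a, hka, hal, ha⟩ := exists_zero_between (h := f)
    (fun a => by rw [← hf]; exact hedge a) hkl (by rwa [← hf])
  rcases mul_eq_zero.mp ha with h | h
  · exact A.isPowPM_of_zero hw hka hal hneg h
  · rw [crossSign_swap_left] at hneg
    exact A.isPowPM_of_zero hw hka hal hneg h

/-- Powers of `N` carry both edges to the arc, so this is `noncross`. -/
theorem edge_edge {w : SL(2, ℤ)} (hw : w ∈ Γ) (i a : ℤ) :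
    0 ≤ crossSign (act w (chain N i)) (act w (chain N (i + 1))) (chain N a) (chain N (a + 1)) := by
  have h := A.noncross (N ^ (-a) * w * N ^ i)
    (mul_mem (mul_mem (A.zpow_mem_gamma _) hw) (A.zpow_mem_gamma _))
  have h1 : vecInt p q = -chain N 1 := by rw [A.chain_one, neg_neg]
  have neg_v : ∀ (g : SL(2, ℤ)) v, act g (-v) = -act g v := by
    intro g v
    have := act_smul g (-1) v
    simpa using this
  rw [h1, neg_v, crossSign_neg_second, crossSign_comm, crossSign_neg_second, crossSign_comm, act_mul, act_mul, act_mul, act_mul, act_zpow_chain, ← chain,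
    crossSign_act_left, zpow_neg, inv_inv, act_zpow_chain, ← chain] at h
  exact h

/-- The translates of the edges of the chain do not cross the chords of the chain. -/
theorem edge_chord {w : SL(2, ℤ)} (hw : w ∈ Γ) (i k l : ℤ) :
    0 ≤ crossSign (act w (chain N i)) (act w (chain N (i + 1))) (chain N k) (chain N l) := by
  by_contra hneg
  rw [not_le] at hneg
  -- A crossing would make the translated edge an edge of the chain, and those cross no chord.
  obtain ⟨m, hm⟩ := A.isPowPM_of_cross hw (A.edge_edge hw i) hneg
  rw [crossSign_of_isPow hm, A.crossSign_chain] at hneg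
  have h1 := A.U_mul_succ_nonneg (k - (m + (i + 1)))
  have h2 := A.U_mul_succ_nonneg (l - (m + (i + 1)))
  rw [show k - (m + (i + 1)) + 1 = k - (m + i) by ring] at h1
  rw [show l - (m + (i + 1)) + 1 = l - (m + i) by ring] at h2
  have h3 : 0 ≤ (q : ℝ) ^ 4 * (seqU q N (k - (m + i)) * seqU q N (l - (m + i)) *
        (seqU q N (k - (m + (i + 1))) * seqU q N (l - (m + (i + 1))))) := by
    have : seqU q N (k - (m + i)) * seqU q N (l - (m + i)) *
        (seqU q N (k - (m + (i + 1))) * seqU q N (l - (m + (i + 1)))) =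
        (seqU q N (k - (m + (i + 1))) * seqU q N (k - (m + i))) *
        (seqU q N (l - (m + (i + 1))) * seqU q N (l - (m + i))) := by ring
    rw [this]
    positivity
  linarith

theorem chord_edge {w : SL(2, ℤ)} (hw : w ∈ Γ) (i j a : ℤ) :
    0 ≤ crossSign (act w (chain N i)) (act w (chain N j)) (chain N a) (chain N (a + 1)) := by
  rw [crossSign_act_left, crossSign_comm]
  exact A.edge_chord (inv_mem hw) a i j

/-- If a translate of a chord of the chain crosses a chord of the chain, then the translation is
a power of `N`. -/
theorem chord_chord {w : SL(2, ℤ)} (hw : w ∈ Γ) {i j k l : ℤ}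
    (hneg : crossSign (act w (chain N i)) (act w (chain N j)) (chain N k) (chain N l) < 0) :
    IsPowPM N w :=
  A.isPowPM_of_cross hw (A.chord_edge hw i j) hneg

end IsMarkovArc

/-! ### The axis of `N` -/

/-- Half of the distance between the endpoints of the axis. -/
noncomputable def axisRadius (q : ℤ) : ℝ := Real.sqrt (9 / 4 - 1 / (q : ℝ) ^ 2)

/-- The attracting endpoint of the axis. -/
noncomputable def axisLeft (p q : ℤ) : ℝ := p / q + 3 / 2 - axisRadius q

/-- The repelling endpoint of the axis. -/
noncomputable def axisRight (p q : ℤ) : ℝ := p / q + 3 / 2 + axisRadius q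

/-- The large eigenvalue of `N`. -/
noncomputable def axisEigen (q : ℤ) : ℝ := q * (3 / 2 + axisRadius q)

theorem act_zpow_eigen {w : SL(2, ℤ)} {r : ℝ × ℝ} {a : ℝ} (ha : a ≠ 0) (h : act w r = a • r)
    (n : ℤ) : act (w ^ n) r = a ^ n • r := by
  cases n with
  | ofNat n => simpa using act_pow_eigen h n
  | negSucc n =>
    rw [zpow_negSucc, zpow_negSucc]
    exact act_inv_eigen (pow_ne_zero _ ha) (act_pow_eigen h (n + 1))

theorem trace_br (w : SL(2, ℤ)) (u v : ℝ × ℝ) :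
    ((w 0 0 : ℝ) + w 1 1) * br u v = br (act w u) v + br u (act w v) := by
  simp only [br, act]; ring

/-- A matrix that exchanges two points is an elliptic involution. -/
theorem trace_eq_zero_of_swap {w : SL(2, ℤ)} {u v : ℝ × ℝ} (huv : br u v ≠ 0)
    (h1 : br (act w u) v = 0) (h2 : br u (act w v) = 0) : w 1 1 = -w 0 0 := by
  have := trace_br w u v
  rw [h1, h2, add_zero] at this
  have h3 := (mul_eq_zero.mp this).resolve_right huv
  have : (w 1 1 : ℝ) = -w 0 0 := by linarith
  exact_mod_cast this

theorem eq_smul_of_br_vecOf {r : ℝ × ℝ} {y : ℝ} (h : br r (vecOf y) = 0) : r = r.2 • vecOf y := by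
  simp only [br, vecOf] at h
  ext
  · simp only [vecOf, Prod.smul_fst, smul_eq_mul]; linarith
  · simp [vecOf]

theorem br_left_right (p q : ℤ) :
    br (vecOf (axisLeft p q)) (vecOf (axisRight p q)) = -(2 * axisRadius q) := by
  rw [br_vecOf, axisLeft, axisRight]; ring

theorem vecOf_ne_zero (y : ℝ) : vecOf y ≠ 0 := by
  intro h
  have := congrArg Prod.snd h
  simp [vecOf] at this

namespace IsMarkovArc

variable {p q : ℤ} {N E F : SL(2, ℤ)} {Γ : Subgroup SL(2, ℤ)} (A : IsMarkovArc p q N E F Γ)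
include A

theorem radius_sq : axisRadius q ^ 2 = 9 / 4 - 1 / (q : ℝ) ^ 2 := by
  apply Real.sq_sqrt
  have h := A.one_le_q
  have : 1 / (q : ℝ) ^ 2 ≤ 1 := by
    rw [div_le_one (by positivity)]; nlinarith
  linarith

theorem radius_pos : 0 < axisRadius q := by
  apply Real.sqrt_pos.mpr
  have h := A.one_le_q
  have : 1 / (q : ℝ) ^ 2 ≤ 1 := by
    rw [div_le_one (by positivity)]; nlinarith
  linarith

theorem radius_lt : axisRadius q < 3 / 2 := by
  have h1 := A.radius_sq
  have h2 := A.radius_pos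
  have h3 : 0 < 1 / (q : ℝ) ^ 2 := by have := A.q_pos; positivity
  nlinarith

theorem radius_mul : (q : ℝ) ^ 2 * (9 / 4 - axisRadius q ^ 2) = 1 := by
  have := A.q_pos.ne'
  rw [A.radius_sq]; field_simp; ring

theorem one_lt_eigen : 1 < axisEigen q := by
  have h1 := A.one_le_q
  have h2 := A.radius_pos
  rw [axisEigen]; nlinarith

theorem eigen_pos : 0 < axisEigen q := zero_lt_one.trans A.one_lt_eigen

theorem eigen_inv : (axisEigen q)⁻¹ = q * (3 / 2 - axisRadius q) := by
  rw [inv_eq_iff_eq_inv]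
  apply eq_inv_of_mul_eq_one_left
  rw [axisEigen]
  linear_combination A.radius_mul

theorem eigen_sq_ne_one : axisEigen q ^ 2 ≠ 1 := by
  have := A.one_lt_eigen
  nlinarith

theorem eigen_inv_sq_ne_one : (axisEigen q)⁻¹ ^ 2 ≠ 1 := by
  rw [inv_pow]
  intro h
  exact A.eigen_sq_ne_one (inv_eq_one.mp h)

theorem N_det : (q : ℝ) * N 0 1 = 1 + p * (p + 3 * q) := by
  have := det_entries_real N
  rw [A.N00, A.N11, A.N10] at this
  push_cast at this
  linarith

theorem act_left : act N (vecOf (axisLeft p q)) = axisEigen q • vecOf (axisLeft p q) := by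
  have hq := A.q_pos.ne'
  have hd := A.N_det
  have hr := A.radius_mul
  have hx : (q : ℝ) * (p / q) = p := by field_simp
  ext
  · simp only [act, vecOf, axisLeft, axisEigen, A.N00, Prod.smul_fst, smul_eq_mul]
    apply mul_left_cancel₀ hq
    push_cast
    linear_combination hd - hr + (-(p : ℝ) - (q : ℝ) * (3 / 2 + axisRadius q)) * hx
  · simp only [act, vecOf, axisLeft, axisEigen, A.N10, A.N11, Prod.smul_snd, smul_eq_mul]
    push_cast
    linear_combination -hx

theorem act_right : act N (vecOf (axisRight p q)) = (axisEigen q)⁻¹ • vecOf (axisRight p q) := by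
  have hq := A.q_pos.ne'
  have hd := A.N_det
  have hr := A.radius_mul
  have hx : (q : ℝ) * (p / q) = p := by field_simp
  rw [A.eigen_inv]
  ext
  · simp only [act, vecOf, axisRight, A.N00, Prod.smul_fst, smul_eq_mul]
    apply mul_left_cancel₀ hq
    push_cast
    linear_combination hd - hr + (-(p : ℝ) - (q : ℝ) * (3 / 2 - axisRadius q)) * hx
  · simp only [act, vecOf, axisRight, A.N10, A.N11, Prod.smul_snd, smul_eq_mul]
    push_cast
    linear_combination -hx

theorem zpow_left (m : ℤ) :
    act (N ^ m) (vecOf (axisLeft p q)) = axisEigen q ^ m • vecOf (axisLeft p q) :=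
  act_zpow_eigen A.eigen_pos.ne' A.act_left m

theorem zpow_right (m : ℤ) :
    act (N ^ m) (vecOf (axisRight p q)) = (axisEigen q)⁻¹ ^ m • vecOf (axisRight p q) :=
  act_zpow_eigen (inv_ne_zero A.eigen_pos.ne') A.act_right m

/-- Binet's formula: decompose `∞` into eigenvectors of `N`. -/
theorem chain_formula (k : ℤ) : chain N k = (2 * axisRadius q)⁻¹ •
    ((axisEigen q)⁻¹ ^ k • vecOf (axisRight p q) - axisEigen q ^ k • vecOf (axisLeft p q)) := by
  have hr := A.radius_pos.ne'
  have h0 : vecInf = (2 * axisRadius q)⁻¹ • (vecOf (axisRight p q) - vecOf (axisLeft p q)) := by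
    ext
    · simp only [vecInf, vecOf, axisLeft, axisRight, Prod.smul_fst, Prod.fst_sub, smul_eq_mul]
      field_simp; ring
    · simp [vecInf, vecOf]
  rw [chain, h0, act_smul, act_sub, A.zpow_left, A.zpow_right]

/-- A geodesic that crosses the axis crosses long chords of the chain. -/
theorem exists_chord_of_axis {r s : ℝ × ℝ}
    (h : crossSign (vecOf (axisLeft p q)) (vecOf (axisRight p q)) r s < 0) :
    ∃ k l : ℤ, crossSign (chain N k) (chain N l) r s < 0 := by
  set X := vecOf (axisLeft p q)
  set Y := vecOf (axisRight p q)
  set lam := axisEigen q with hlam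
  have hl : 1 < lam := A.one_lt_eigen
  have hl0 : 0 < lam := A.eigen_pos
  have hpow : ∀ n' : ℕ, lam ^ n' * ((lam ^ 2)⁻¹) ^ n' = lam⁻¹ ^ n' := by
    intro n'; rw [← mul_pow]; congr 1; field_simp
  -- For `ε = λ^{-2n}` these vectors are proportional to `chain N n` and `chain N (-n)`, which tend
  -- to the ends of the axis; crossing is an open condition.
  let f : ℝ → ℝ := fun ε => crossSign (ε • Y - X) (Y - ε • X) r s
  have hf : Continuous f := by simp only [f, crossSign, br]; fun_prop
  have hf0 : f 0 < 0 := by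
    have : f 0 = crossSign X Y r s := by
      simp only [f, zero_smul, zero_sub, sub_zero, crossSign, br_neg_left]; ring
    rwa [this]
  have ht : Filter.Tendsto (fun n : ℕ => f (((lam ^ 2)⁻¹) ^ n)) Filter.atTop (nhds (f 0)) := by
    refine (hf.tendsto 0).comp (tendsto_pow_atTop_nhds_zero_of_lt_one (by positivity) ?_)
    apply inv_lt_one_of_one_lt₀
    nlinarith
  obtain ⟨n, hn⟩ := (ht.eventually_lt_const hf0).exists
  refine ⟨n, -n, ?_⟩
  have e1 : chain N n = ((2 * axisRadius q)⁻¹ * lam ^ n) • ((((lam ^ 2)⁻¹) ^ n) • Y - X) := by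
    rw [A.chain_formula, ← hlam, mul_smul]
    congr 1
    rw [smul_sub, smul_smul, zpow_natCast, zpow_natCast]
    rw [hpow]
  have e2 : chain N (-n) = ((2 * axisRadius q)⁻¹ * lam ^ n) • (Y - (((lam ^ 2)⁻¹) ^ n) • X) := by
    rw [A.chain_formula, ← hlam, mul_smul]
    congr 1
    rw [smul_sub, smul_smul, zpow_neg, zpow_natCast, zpow_neg, zpow_natCast]
    rw [hpow, inv_pow, inv_inv]
  rw [e1, e2, crossSign_smul_left]
  have := A.radius_pos
  exact mul_neg_of_pos_of_neg (by positivity) hn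

theorem br_left_chain (k : ℤ) : br (vecOf (axisLeft p q)) (chain N k) = -(axisEigen q)⁻¹ ^ k := by
  have hr := A.radius_pos.ne'
  rw [A.chain_formula, br_smul_right, sub_eq_add_neg]
  have : br (vecOf (axisLeft p q)) ((axisEigen q)⁻¹ ^ k • vecOf (axisRight p q) +
    -(axisEigen q ^ k • vecOf (axisLeft p q))) =
    (axisEigen q)⁻¹ ^ k * br (vecOf (axisLeft p q)) (vecOf (axisRight p q)) := by
    simp [br, vecOf]; ring
  rw [this, br_left_right]
  field_simp

/-- The brackets with the two ends are `-λ^{-k}` and `-λ^k`: the whole chain lies on one side of the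
axis. -/
theorem crossSign_axis_chain (k l : ℤ) :
    crossSign (vecOf (axisLeft p q)) (vecOf (axisRight p q)) (chain N k) (chain N l) = 1 := by
  have hr := A.radius_pos.ne'
  have hl := A.eigen_pos.ne'
  have e1 := A.br_left_chain
  have e2 : ∀ k, br (vecOf (axisRight p q)) (chain N k) = -axisEigen q ^ k := by
    intro k
    rw [A.chain_formula, br_smul_right, sub_eq_add_neg]
    have : br (vecOf (axisRight p q)) ((axisEigen q)⁻¹ ^ k • vecOf (axisRight p q) +
      -(axisEigen q ^ k • vecOf (axisLeft p q))) =
      axisEigen q ^ k * br (vecOf (axisLeft p q)) (vecOf (axisRight p q)) := by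
      simp [br, vecOf]; ring
    rw [this, br_left_right]
    field_simp
  simp only [crossSign, e1, e2, inv_zpow]
  have h1 := zpow_ne_zero k hl
  have h2 := zpow_ne_zero l hl
  field_simp

theorem crossSign_axis_of_pow {w : SL(2, ℤ)} (hw : IsPowPM N w) (r s : ℝ × ℝ) :
    ∃ c : ℝ, crossSign (act w (vecOf (axisLeft p q))) (act w (vecOf (axisRight p q))) r s =
      c ^ 2 * crossSign (vecOf (axisLeft p q)) (vecOf (axisRight p q)) r s := by
  obtain ⟨m, hm⟩ := hw
  refine ⟨axisEigen q ^ m * (axisEigen q)⁻¹ ^ m, ?_⟩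
  rcases hm with rfl | rfl
  · rw [A.zpow_left, A.zpow_right, crossSign_smul_left]
  · rw [crossSign_act_neg_left, A.zpow_left, A.zpow_right, crossSign_smul_left]

/-- The translates of the axis do not cross the chords of the chain. -/
theorem axis_chord {w : SL(2, ℤ)} (hw : w ∈ Γ) (k l : ℤ) :
    0 ≤ crossSign (act w (vecOf (axisLeft p q))) (act w (vecOf (axisRight p q)))
      (chain N k) (chain N l) := by
  by_contra hneg
  rw [not_le] at hneg
  obtain ⟨i, j, hij⟩ := A.exists_chord_of_axis (by rw [crossSign_act_left] at hneg; exact hneg)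
  rw [← crossSign_act_left] at hij
  obtain ⟨c, hc⟩ := A.crossSign_axis_of_pow (A.chord_chord hw hij) (chain N k) (chain N l)
  rw [hc, A.crossSign_axis_chain] at hneg
  nlinarith [sq_nonneg c]

/-- The translates of the axis do not cross the axis. -/
theorem axis_axis {w : SL(2, ℤ)} (hw : w ∈ Γ) :
    0 ≤ crossSign (act w (vecOf (axisLeft p q))) (act w (vecOf (axisRight p q)))
      (vecOf (axisLeft p q)) (vecOf (axisRight p q)) := by
  by_contra hneg
  rw [not_le, crossSign_comm] at hneg
  obtain ⟨i, j, hij⟩ := A.exists_chord_of_axis hneg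
  rw [crossSign_comm] at hij
  linarith [A.axis_chord hw i j]

theorem br_vecInf_left_ne (w : SL(2, ℤ)) : br vecInf (act w (vecOf (axisLeft p q))) ≠ 0 :=
  br_vecInf_ne_zero_of_eigen (act_ne_zero (vecOf_ne_zero _)) (conj_eigen A.act_left)
    A.eigen_sq_ne_one

theorem br_vecInf_right_ne (w : SL(2, ℤ)) : br vecInf (act w (vecOf (axisRight p q))) ≠ 0 :=
  br_vecInf_ne_zero_of_eigen (act_ne_zero (vecOf_ne_zero _)) (conj_eigen A.act_right)
    A.eigen_inv_sq_ne_one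

/-- The stabilizer of the endpoints of the axis is generated by `N`. -/
theorem isPowPM_of_fix_axis {w : SL(2, ℤ)} (hw : w ∈ Γ)
    (h1 : br (act w (vecOf (axisLeft p q))) (vecOf (axisLeft p q)) = 0)
    (h2 : br (act w (vecOf (axisRight p q))) (vecOf (axisRight p q)) = 0) : IsPowPM N w := by
  -- The representative with the smallest lower left entry will turn out to fix `∞`.
  obtain ⟨k, hk⟩ : ∃ k : ℤ, ∀ l : ℤ, ((N ^ k * w) 1 0).natAbs ≤ ((N ^ l * w) 1 0).natAbs :=
    ⟨_, fun l => Function.argmin_le (fun l : ℤ => ((N ^ l * w) 1 0).natAbs) l⟩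
  set w' := N ^ k * w with hw'
  have hw'm : w' ∈ Γ := mul_mem (A.zpow_mem_gamma k) hw
  obtain ⟨μ, hμ⟩ : ∃ μ : ℝ, act w' (vecOf (axisLeft p q)) = μ • vecOf (axisLeft p q) := by
    refine ⟨(act w (vecOf (axisLeft p q))).2 * axisEigen q ^ k, ?_⟩
    conv_lhs => rw [hw', act_mul, eq_smul_of_br_vecOf h1, act_smul, A.zpow_left, smul_smul]
  obtain ⟨ν, hν⟩ : ∃ ν : ℝ, act w' (vecOf (axisRight p q)) = ν • vecOf (axisRight p q) := by
    refine ⟨(act w (vecOf (axisRight p q))).2 * (axisEigen q)⁻¹ ^ k, ?_⟩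
    conv_lhs => rw [hw', act_mul, eq_smul_of_br_vecOf h2, act_smul, A.zpow_right, smul_smul]
  have hr := A.radius_pos
  have hμν : μ * ν = 1 := by
    have h := br_act w' (vecOf (axisLeft p q)) (vecOf (axisRight p q))
    rw [hμ, hν, br_smul_left, br_smul_right, br_left_right] at h
    have h3 : -(2 * axisRadius q) ≠ 0 := neg_ne_zero.mpr (by positivity)
    apply mul_right_cancel₀ h3
    linear_combination h
  have hB : ∀ i j : ℤ, br (act w' (chain N i)) (chain N j) = (2 * axisRadius q)⁻¹ *
      (μ * (axisEigen q ^ i * (axisEigen q)⁻¹ ^ j) -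
        ν * ((axisEigen q)⁻¹ ^ i * axisEigen q ^ j)) := by
    intro i j
    rw [A.chain_formula i, A.chain_formula j, act_smul, act_sub, act_smul, act_smul, hμ, hν,
      br_smul_left, br_smul_right]
    have h := br_left_right p q
    generalize vecOf (axisLeft p q) = X at h
    generalize vecOf (axisRight p q) = Y at h
    have h3 : ∀ a b c d : ℝ, br (a • Y - b • X) (c • Y - d • X) = (a * d - b * c) * br X Y := by
      intro a b c d; simp [br]; ring
    rw [smul_smul, smul_smul, h3, h]
    field_simp
    ring
  have hl := A.one_lt_eigen
  have hl0 := A.eigen_pos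
  have hent : ∀ j : ℤ, br (act w' (chain N 0)) (chain N j) ^ 2 =
      (((N ^ (k - j) * w) 1 0).natAbs : ℝ) ^ 2 := by
    intro j
    rw [chain_zero, chain, br_act_right, ← act_mul, hw', ← zpow_neg, ← mul_assoc, ← zpow_add,
      neg_add_eq_sub, br_vecInf_right, act_vecInf, Nat.cast_natAbs, Int.cast_abs, sq_abs, neg_sq]
  have hmin : ∀ j : ℤ, br (act w' (chain N 0)) (chain N 0) ^ 2 ≤
      br (act w' (chain N 0)) (chain N j) ^ 2 := by
    intro j
    rw [hent, hent, sub_zero]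
    have : (((N ^ k * w) 1 0).natAbs : ℝ) ≤ ((N ^ (k - j) * w) 1 0).natAbs := by
      exact_mod_cast hk (k - j)
    gcongr
  have m1 := hmin 1
  have m2 := hmin (-1)
  have e := A.edge_edge hw'm 0 0
  simp only [zero_add, crossSign] at e
  have e11 : br (act w' (chain N 1)) (chain N 1) = br (act w' (chain N 0)) (chain N 0) := by
    rw [hB, hB]; simp [hl0.ne']
  have e10 : br (act w' (chain N 1)) (chain N 0) = br (act w' (chain N 0)) (chain N (-1)) := by
    rw [hB, hB]; simp
  -- In terms of the brackets `x, y, z` of `w' • ∞` with cusps `0, 1, -1`: the difference `x² - yz`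
  -- is a positive square, because `w'` is diagonal in the eigenbasis of `N`.
  have hdisc : br (act w' (chain N 0)) (chain N 1) * br (act w' (chain N 0)) (chain N (-1)) <
      br (act w' (chain N 0)) (chain N 0) ^ 2 := by
    have : br (act w' (chain N 0)) (chain N 0) ^ 2 - br (act w' (chain N 0)) (chain N 1) *
        br (act w' (chain N 0)) (chain N (-1)) =
        ((2 * axisRadius q)⁻¹ * (axisEigen q - (axisEigen q)⁻¹)) ^ 2 := by
      rw [hB, hB, hB]
      have h3 : axisEigen q * (axisEigen q)⁻¹ = 1 := mul_inv_cancel₀ hl0.ne'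
      simp only [zpow_zero, zpow_one, zpow_neg, inv_inv, mul_one, one_mul]
      generalize (axisEigen q)⁻¹ = b at h3
      linear_combination ((2 * axisRadius q)⁻¹ ^ 2) *
        ((axisEigen q ^ 2 + b ^ 2 - 2) * hμν + (2 - μ ^ 2 - ν ^ 2) * h3)
    have h4 : 0 < ((2 * axisRadius q)⁻¹ * (axisEigen q - (axisEigen q)⁻¹)) ^ 2 := by
      have : (axisEigen q)⁻¹ < 1 := inv_lt_one_of_one_lt₀ hl
      have : 0 < axisEigen q - (axisEigen q)⁻¹ := by linarith
      positivity
    linarith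
  rw [e11, e10] at e
  -- If `x ≠ 0`, non-crossing of an edge and its image gives `yz ≥ 0`, and minimality gives `x² ≤
  -- y²` and `x² ≤ z²`; hence `x² ≤ yz`, against `hdisc`.
  have h0 : br (act w' (chain N 0)) (chain N 0) = 0 := by
    by_contra hne
    set x := br (act w' (chain N 0)) (chain N 0)
    set y := br (act w' (chain N 0)) (chain N 1)
    set z := br (act w' (chain N 0)) (chain N (-1))
    have hx : 0 < x ^ 2 := by positivity
    have hyz : 0 ≤ y * z := by
      by_contra hcon
      rw [not_le] at hcon
      have : x * y * (z * x) = x ^ 2 * (y * z) := by ring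
      rw [this] at e
      nlinarith
    have h5 : x ^ 2 * x ^ 2 ≤ (y * z) * (y * z) := by
      calc x ^ 2 * x ^ 2 ≤ y ^ 2 * z ^ 2 := by gcongr
        _ = _ := by ring
    nlinarith
  rw [chain_zero] at h0
  obtain ⟨m, hm⟩ := A.stab_of_br hw'm h0
  have hm0 : m = 0 := by
    have h3 : br (act w' (vecOf (axisLeft p q))) (vecOf (axisLeft p q)) = 0 := by
      rw [hμ, br_smul_left, br_self, mul_zero]
    have h4 : axisLeft p q + ((3 * m : ℤ) : ℝ) - axisLeft p q = 0 := by
      rcases hm with hm | hm <;> rw [hm] at h3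
      · rwa [act_transl_vecOf, br_vecOf] at h3
      · rwa [act_neg, act_transl_vecOf, br_neg_left, br_vecOf, neg_eq_zero] at h3
    have h5 : ((3 * m : ℤ) : ℝ) = 0 := by linarith
    have h6 : 3 * m = 0 := by exact_mod_cast h5
    omega
  subst hm0
  rw [mul_zero, transl, zpow_zero] at hm
  refine ⟨-k, ?_⟩
  have h7 : w = N ^ (-k) * w' := by rw [hw']; group
  rcases hm with hm | hm <;> rw [hm] at h7
  · left; rw [h7, mul_one]
  · right; rw [h7, mul_neg, mul_one]

end IsMarkovArc

/-! ### Counting self-intersections -/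

/-- A curve whose coincidences are symmetric about a point of time, and whose coincidence gaps are
`L 1, …, L K`, has `K` self-intersections. -/
theorem hasSelfIntersections_of_gaps {c : ℝ → ModularTorus} {K : ℕ} {C : ℝ} {L : ℕ → ℝ}
    (hpos : ∀ m, 1 ≤ m → m ≤ K → 0 < L m)
    (hinj : ∀ m n, 1 ≤ m → m < n → n ≤ K → L m < L n)
    (H : ∀ s t, (s ≠ t ∧ c s = c t) ↔ (s + t = C ∧ ∃ m, 1 ≤ m ∧ m ≤ K ∧ |t - s| = L m)) :
    HasSelfIntersections c K := by
  -- `τ m` is the later and `C - τ m` the earlier passage through the `m`-th point.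
  let τ : ℕ → ℝ := fun m => (C + L m) / 2
  have hτ : ∀ m, 1 ≤ m → m ≤ K → τ m ≠ C - τ m ∧ c (τ m) = c (C - τ m) := by
    intro m h1 h2
    refine (H _ _).mpr ⟨by ring, m, h1, h2, ?_⟩
    have : C - τ m - τ m = -L m := by simp only [τ]; ring
    rw [this, abs_neg, abs_of_pos (hpos m h1 h2)]
  have hset : selfIntersections c = (fun m => c (τ m)) '' (Finset.Icc 1 K : Finset ℕ) := by
    ext P
    constructor
    · rintro ⟨s, t, hst, hs, ht⟩
      obtain ⟨hC, m, h1, h2, hL⟩ := (H s t).mp ⟨hst, hs.trans ht.symm⟩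
      refine ⟨m, by simp [h1, h2], ?_⟩
      simp only
      rcases abs_cases (t - s) with ⟨ha, -⟩ | ⟨ha, -⟩
      · have : τ m = t := by simp only [τ]; linarith
        rw [this, ht]
      · have : τ m = s := by simp only [τ]; linarith
        rw [this, hs]
    · rintro ⟨m, hm, rfl⟩
      simp only [Finset.coe_Icc, Set.mem_Icc] at hm
      obtain ⟨h1, h2⟩ := hτ m hm.1 hm.2
      exact ⟨_, _, h1, rfl, h2.symm⟩
  constructor
  · rw [hset, Set.InjOn.encard_image, Set.encard_coe_eq_coe_finsetCard]
    · simp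
    · intro m hm n hn hmn
      simp only [Finset.coe_Icc, Set.mem_Icc] at hm hn hmn
      by_contra hne
      have hne' : τ m ≠ τ n := by
        simp only [τ]
        rcases lt_or_gt_of_ne hne with h | h
        · have := hinj m n hm.1 h hn.2; intro h'; linarith
        · have := hinj n m hn.1 h hm.2; intro h'; linarith
      obtain ⟨hC, -⟩ := (H _ _).mp ⟨hne', hmn⟩
      simp only [τ] at hC
      have := hpos m hm.1 hm.2
      have := hpos n hn.1 hn.2
      linarith
  · rw [hset]
    rintro _ ⟨m, hm, rfl⟩
    simp only [Finset.coe_Icc, Set.mem_Icc] at hm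
    obtain ⟨h1, h2⟩ := hτ m hm.1 hm.2
    have : c ⁻¹' {c (τ m)} = {τ m, C - τ m} := by
      ext s
      simp only [Set.mem_preimage, Set.mem_singleton_iff, Set.mem_insert_iff]
      constructor
      · intro hs
        by_cases hne : s = τ m
        · exact Or.inl hne
        · obtain ⟨hC, -⟩ := (H _ _).mp ⟨hne, hs⟩
          right; linarith
      · rintro (rfl | rfl)
        · rfl
        · exact h2.symm
    simp only
    rw [this, Set.encard_pair h1]

/-! ### Coincidences of geodesics in the torus -/

theorem exists_of_torusProj_eq {σ τ : SL(2, ℝ)} {s t : ℝ}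
    (h : torusProj (geodesicLine σ s) = torusProj (geodesicLine τ t)) :
    ∃ w ∈ torusGroup, geodesicLine (toReal w * τ) t = geodesicLine σ s := by
  obtain ⟨w, hw, h⟩ := (torusProj_eq_iff _ _).mp h
  exact ⟨w, hw, by rw [← smul_geodesicLine, h]⟩

theorem torusProj_toReal_mul {w : SL(2, ℤ)} (hw : w ∈ torusGroupPM) (σ : SL(2, ℝ)) (t : ℝ) :
    torusProj (geodesicLine (toReal w * σ) t) = torusProj (geodesicLine σ t) := by
  rw [← smul_geodesicLine, torusProj_smul hw]

theorem geodesicLine_toReal_neg (w : SL(2, ℤ)) (σ : SL(2, ℝ)) (t : ℝ) :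
    geodesicLine (toReal (-w) * σ) t = geodesicLine (toReal w * σ) t := by
  rw [← smul_geodesicLine, ModularGroup.SL_neg_smul, smul_geodesicLine]

theorem projVertical_eq (y t : ℝ) : projVertical y t = torusProj (geodesicLine (vertMat y) t) := by
  rw [projVertical, verticalPoint_eq]

/-- A geodesic line that traces the axis of `N`. -/
def IsAxisMat (p q : ℤ) (σ : SL(2, ℝ)) : Prop :=
  ∃ c : ℝ, c ≠ 0 ∧ headVec σ = c • vecOf (axisRight p q) ∧ tailVec σ = c • vecOf (axisLeft p q)

theorem crossSign_axisMat {p q : ℤ} {σ : SL(2, ℝ)} (hσ : IsAxisMat p q σ) (w : SL(2, ℤ)) (r s : ℝ × ℝ) :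
    ∃ c : ℝ, c ≠ 0 ∧ crossSign (act w (headVec σ)) (act w (tailVec σ)) r s =
      c ^ 2 * crossSign (act w (vecOf (axisLeft p q))) (act w (vecOf (axisRight p q))) r s := by
  obtain ⟨c, hc, h1, h2⟩ := hσ
  refine ⟨c * c, mul_ne_zero hc hc, ?_⟩
  rw [h1, h2, act_smul, act_smul, crossSign_smul_left, crossSign_swap_left]

namespace IsMarkovArc

variable {p q : ℤ} {N E F : SL(2, ℤ)} {Γ : Subgroup SL(2, ℤ)} (A : IsMarkovArc p q N E F Γ)
include A

theorem exists_axisMat : ∃ σ, IsAxisMat p q σ := by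
  have hr := A.radius_pos
  have hs : Real.sqrt (2 * axisRadius q) ^ 2 = 2 * axisRadius q := Real.sq_sqrt (by linarith)
  have hs0 : 0 < Real.sqrt (2 * axisRadius q) := Real.sqrt_pos.mpr (by linarith)
  -- Chosen so that the determinant `c² (axisRight - axisLeft)` is `1`.
  set c := (Real.sqrt (2 * axisRadius q))⁻¹ with hc
  refine ⟨⟨!![c * axisRight p q, c * axisLeft p q; c, c], ?_⟩, c, by positivity, ?_, ?_⟩
  · rw [Matrix.det_fin_two_of]
    have : axisRight p q - axisLeft p q = 2 * axisRadius q := by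
      simp only [axisRight, axisLeft]; ring
    calc _ = c ^ 2 * (axisRight p q - axisLeft p q) := by ring
      _ = 1 := by rw [this, ← hs, hc]; field_simp
  · simp [headVec, vecOf]
  · simp [tailVec, vecOf]

/-- The length of the closed geodesic. -/
theorem axis_zpow_iff {σ : SL(2, ℝ)} (hσ : IsAxisMat p q σ) (m : ℤ) (s t : ℝ) :
    geodesicLine (toReal (N ^ m) * σ) t = geodesicLine σ s ↔
      s = t - m * (2 * Real.log (axisEigen q)) := by
  obtain ⟨c, hc, h1, h2⟩ := hσ
  have hr := A.radius_pos
  have hl := A.eigen_pos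
  rw [geodesicLine_eq_iff, headVec_toReal_mul, tailVec_toReal_mul, h1, h2, act_smul, act_smul,
    A.zpow_left, A.zpow_right]
  simp only [br_smul_left, br_smul_right, br_self, mul_zero, neg_zero, zero_mul, true_and]
  rw [br_swap, br_left_right]
  -- The line runs from the attracting to the repelling end of `N`, which is why `N ^ m` shifts time
  -- backwards for `m > 0`.
  have hz : 0 < axisEigen q ^ m := zpow_pos hl m
  have e1 : axisEigen q ^ m = Real.exp (m * Real.log (axisEigen q)) := by
    rw [mul_comm, Real.exp_mul, Real.exp_log hl, Real.rpow_intCast]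
  have e2 : (axisEigen q)⁻¹ ^ m = Real.exp (-(m * Real.log (axisEigen q))) := by
    rw [inv_zpow, e1, Real.exp_neg]
  have h3 : ∀ a b : ℝ, c * (c * (a * - -(2 * axisRadius q))) * Real.exp t =
      c * (c * (b * - -(2 * axisRadius q))) * Real.exp s ↔ a * Real.exp t = b * Real.exp s := by
    intro a b
    constructor
    · intro h
      have : c ^ 2 * (2 * axisRadius q) ≠ 0 := by positivity
      apply mul_left_cancel₀ this
      linear_combination h
    · intro h
      linear_combination (c ^ 2 * (2 * axisRadius q)) * h
  constructor
  · intro h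
    have h4 : (axisEigen q)⁻¹ ^ m * Real.exp t = axisEigen q ^ m * Real.exp s :=
      (h3 _ _).mp (by linarith)
    rw [e1, e2, ← Real.exp_add, ← Real.exp_add] at h4
    have := Real.exp_injective h4
    linarith
  · intro h
    have h4 : (axisEigen q)⁻¹ ^ m * Real.exp t = axisEigen q ^ m * Real.exp s := by
      rw [e1, e2, ← Real.exp_add, ← Real.exp_add, h]
      congr 1; ring
    have := (h3 _ _).mpr h4
    linarith

/-- The axis projects to a simple closed geodesic. -/
theorem isSimpleClosedGeodesic_axis {σ : SL(2, ℝ)} (hσ : IsAxisMat p q σ) :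
    IsSimpleClosedGeodesic (Set.range fun t => torusProj (geodesicLine σ t)) := by
  have hlog : 0 < Real.log (axisEigen q) := Real.log_pos A.one_lt_eigen
  refine ⟨σ, 2 * Real.log (axisEigen q), by positivity, fun s t => ⟨fun h => ?_, ?_⟩, rfl⟩
  · obtain ⟨w, hw, hwst⟩ := exists_of_torusProj_eq h
    have hwΓ := A.le hw
    have hpow : IsPowPM N w := by
      rcases cross_or_same hwst with h | h | h
      · exfalso
        rw [headVec_toReal_mul, tailVec_toReal_mul] at h
        obtain ⟨c, hc, h'⟩ := crossSign_axisMat hσ w (headVec σ) (tailVec σ)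
        have h2 := A.axis_axis hwΓ
        rw [crossSign_comm] at h2
        obtain ⟨d, hd, h''⟩ := crossSign_axisMat hσ 1
          (act w (vecOf (axisLeft p q))) (act w (vecOf (axisRight p q)))
        simp only [act_one] at h''
        rw [h', crossSign_comm, h''] at h
        have := mul_nonneg (sq_nonneg c) (mul_nonneg (sq_nonneg d) h2)
        linarith
      · exfalso
        rw [headVec_toReal_mul, tailVec_toReal_mul] at h
        -- An element exchanging the ends of the axis would be an elliptic involution.
        refine trace_ne_zero_of_mem_torusGroup hw
          (trace_eq_zero_of_swap (u := headVec σ) (v := tailVec σ) ?_ h.1 h.2)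
        rw [br_head_tail]; exact one_ne_zero
      · rw [headVec_toReal_mul, tailVec_toReal_mul] at h
        obtain ⟨c, hc, h1, h2⟩ := hσ
        rw [h1, h2, act_smul, act_smul] at h
        simp only [br_smul_left, br_smul_right, mul_eq_zero, hc, false_or] at h
        exact A.isPowPM_of_fix_axis hwΓ h.2 (by rw [br_swap, h.1, neg_zero])
    obtain ⟨m, hm⟩ := hpow
    have hst : geodesicLine (toReal (N ^ m) * σ) t = geodesicLine σ s := by
      rcases hm with hm | hm
      · rwa [hm] at hwst
      · rwa [hm, geodesicLine_toReal_neg] at hwst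
    rw [A.axis_zpow_iff hσ] at hst
    exact ⟨-m, by rw [hst]; push_cast; ring⟩
  · rintro ⟨n, hn⟩
    have hst : geodesicLine (toReal (N ^ (-n)) * σ) t = geodesicLine σ s := by
      rw [A.axis_zpow_iff hσ]; push_cast; linarith
    rw [← hst]
    exact torusProj_toReal_mul (A.zpow_mem_PM _) σ t

theorem vecOf_chainPt {k : ℤ} (hk : k ≠ 0) :
    vecOf (chainPt N k) = (chain N k).2⁻¹ • chain N k := by
  have h := A.chain_snd_ne_zero hk
  conv_rhs => rw [A.chain_eq_smul hk]
  rw [smul_smul]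
  simp [vecOf, h]

theorem chainPt_one : chainPt N 1 = p / q := by
  rw [A.chainPt_eq one_ne_zero, sub_self, seqU_zero]; simp

theorem lt_chainPt {k : ℤ} (hk : 2 ≤ k) : (p : ℝ) / q < chainPt N k := by
  rw [A.chainPt_eq (by omega)]
  have h1 := A.U_pos (k := k - 1) (by omega)
  have h2 := A.U_pos (k := k) (by omega)
  have := A.q_pos
  have : 0 < seqU q N (k - 1) / (q * seqU q N k) := by positivity
  linarith

theorem chainPt_lt {k : ℤ} (hk : 1 ≤ k) : chainPt N k < p / q + 3 := by
  rw [A.chainPt_eq' (by omega)]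
  have h1 := A.U_pos (k := k + 1) (by omega)
  have h2 := A.U_pos (k := k) (by omega)
  have := A.q_pos
  have : 0 < seqU q N (k + 1) / (q * seqU q N k) := by positivity
  linarith

/-- A vertical geodesic ending at a cusp of the chain is disjoint from the closed geodesic. -/
theorem disjoint_axis {σ : SL(2, ℝ)} (hσ : IsAxisMat p q σ) {k : ℤ} (hk : k ≠ 0) :
    Disjoint (Set.range (projVertical (chainPt N k)))
      (Set.range fun t => torusProj (geodesicLine σ t)) := by
  rw [Set.disjoint_left]
  rintro _ ⟨s, rfl⟩ ⟨t, ht⟩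
  simp only at ht
  rw [projVertical_eq] at ht
  obtain ⟨w, hw, h⟩ := exists_of_torusProj_eq ht.symm
  have hwΓ := A.le hw
  have hnb : ∀ u, u = headVec σ ∨ u = tailVec σ → br vecInf (act w u) ≠ 0 := by
    obtain ⟨c, hc, h1, h2⟩ := hσ
    rintro u (rfl | rfl)
    · rw [h1, act_smul, br_smul_right]
      exact mul_ne_zero hc (A.br_vecInf_right_ne w)
    · rw [h2, act_smul, br_smul_right]
      exact mul_ne_zero hc (A.br_vecInf_left_ne w)
  rcases cross_or_same h with h | h | h
  · rw [headVec_toReal_mul, tailVec_toReal_mul, headVec_vertMat, tailVec_vertMat,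
      A.vecOf_chainPt hk, ← chain_zero N, ← one_smul ℝ (chain N 0), crossSign_smul_right] at h
    obtain ⟨c, hc, h'⟩ := crossSign_axisMat hσ w (chain N 0) (chain N k)
    rw [h'] at h
    have := mul_nonneg (sq_nonneg (1 * (chain N k).2⁻¹))
      (mul_nonneg (sq_nonneg c) (A.axis_chord hwΓ 0 k))
    linarith
  · rw [headVec_toReal_mul, tailVec_toReal_mul, headVec_vertMat] at h
    exact hnb _ (Or.inr rfl) h.2
  · rw [headVec_toReal_mul, tailVec_toReal_mul, headVec_vertMat] at h
    exact hnb _ (Or.inl rfl) h.1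

/-- The alternatives for a vertical geodesic ending at a cusp of the chain that meets a translate
of another one. -/
theorem vertical_meet {k l : ℤ} (hk : k ≠ 0) (hl : l ≠ 0) {w : SL(2, ℤ)} {s t : ℝ}
    (h : geodesicLine (toReal w * vertMat (chainPt N k)) t =
      geodesicLine (vertMat (chainPt N l)) s) :
    crossSign (act w (chain N 0)) (act w (chain N k)) (chain N 0) (chain N l) < 0 ∨
      (br (act w vecInf) (vecOf (chainPt N l)) = 0 ∧
        br vecInf (act w (vecOf (chainPt N k))) = 0) ∨
      (br (act w vecInf) vecInf = 0 ∧
        br (act w (vecOf (chainPt N k))) (vecOf (chainPt N l)) = 0) := by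
  rcases cross_or_same h with h | h | h
  · left
    rw [headVec_toReal_mul, tailVec_toReal_mul, headVec_vertMat, tailVec_vertMat, headVec_vertMat,
      tailVec_vertMat, A.vecOf_chainPt hk, A.vecOf_chainPt hl, ← chain_zero N,
      ← one_smul ℝ (chain N 0), crossSign_smul_right, act_smul, act_smul, crossSign_smul_left] at h
    by_contra hcon
    rw [not_lt] at hcon
    have := mul_nonneg (sq_nonneg (1 * (chain N l).2⁻¹))
      (mul_nonneg (sq_nonneg (1 * (chain N k).2⁻¹)) hcon)
    linarith
  · right; left
    rwa [headVec_toReal_mul, tailVec_toReal_mul, headVec_vertMat, tailVec_vertMat, headVec_vertMat,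
      tailVec_vertMat] at h
  · right; right
    rw [headVec_toReal_mul, tailVec_toReal_mul, headVec_vertMat, tailVec_vertMat, headVec_vertMat,
      tailVec_vertMat, br_swap, neg_eq_zero] at h
    exact h

/-- The arcs of the companions do not meet the arc of the Markov fraction. -/
theorem disjoint_arc {k : ℤ} (hk : 2 ≤ k) :
    Disjoint (Set.range (projVertical (chainPt N k))) (Set.range (projVertical (p / q))) := by
  rw [Set.disjoint_left]
  rintro _ ⟨t, rfl⟩ ⟨s, hs⟩
  rw [projVertical_eq, projVertical_eq] at hs
  obtain ⟨w, hw, h⟩ := exists_of_torusProj_eq hs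
  have hwΓ := A.le hw
  rw [← A.chainPt_one] at h
  have b1 := A.lt_chainPt hk
  have b2 := A.chainPt_lt (k := k) (by omega)
  -- The foot lies strictly between `p / q` and `p / q + 3`, so no shift by a multiple of `3`
  -- reaches either of them.
  have hint : ∀ m : ℤ, chainPt N k + ((3 * m : ℤ) : ℝ) = p / q ∨
      chainPt N k + ((3 * m : ℤ) : ℝ) = p / q + 3 → False := by
    intro m hm
    push_cast at hm
    have u1 : (m : ℝ) < 1 := by
      rcases hm with hm | hm <;> linarith
    have u2 : (-1 : ℝ) < m := by
      rcases hm with hm | hm <;> linarith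
    have u1' : m < 1 := by exact_mod_cast u1
    have u2' : -1 < m := by exact_mod_cast u2
    have : m = 0 := by omega
    subst this
    simp only [Int.cast_zero, mul_zero, add_zero] at hm
    rcases hm with hm | hm <;> linarith
  rcases A.vertical_meet (by omega) one_ne_zero h with h | ⟨h1, h2⟩ | ⟨h1, h2⟩
  · have := A.chord_edge hwΓ 0 k 0
    rw [zero_add] at this
    linarith
  -- Here `w` sends `∞` to `p / q`, so it is `N` times a translation, and the foot would be a shift
  -- of `N⁻¹ • ∞`, which is `p / q + 3`.
  · rw [A.vecOf_chainPt one_ne_zero, br_smul_right, ← chain_zero N] at h1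
    have h1' := (mul_eq_zero.mp h1).resolve_left (inv_ne_zero (A.chain_snd_ne_zero one_ne_zero))
    obtain ⟨m, hm⟩ := A.stab_chain hwΓ h1'
    rw [neg_zero, zpow_zero, mul_one, zpow_one] at hm
    have h3 : br (vecInt (p + 3 * q) q) (vecOf (chainPt N k + ((3 * m : ℤ) : ℝ))) = 0 := by
      rw [← A.chain_neg_one, chain, zpow_neg_one, ← br_act_right, ← act_transl_vecOf, ← act_mul]
      rcases hm with hm | hm
      · rwa [hm] at h2
      · rwa [hm, act_neg, br_neg_right, neg_eq_zero] at h2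
    refine hint m (Or.inr ?_)
    have hq := A.q_pos.ne'
    simp only [br, vecInt, vecOf] at h3
    push_cast at h3 ⊢
    field_simp
    linarith
  · obtain ⟨m, hm⟩ := A.stab_of_br hwΓ h1
    refine hint m (Or.inl ?_)
    have h3 : br (vecOf (chainPt N k + ((3 * m : ℤ) : ℝ))) (vecOf (chainPt N 1)) = 0 := by
      rw [← act_transl_vecOf]
      rcases hm with hm | hm
      · rwa [hm] at h2
      · rwa [hm, act_neg, br_neg_left, neg_eq_zero] at h2
    rw [br_vecOf, A.chainPt_one] at h3
    linarith

/-! ### Coincidences and self-intersections of the companions -/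

/-- The times at which the translate by a power of `N` meets the vertical geodesic. -/
theorem zpow_meet_iff {k m : ℤ} (hk : k ≠ 0) (hm : m ≠ 0) (s t : ℝ) :
    geodesicLine (toReal (N ^ m) * vertMat (chainPt N k)) t =
      geodesicLine (vertMat (chainPt N k)) s ↔
      (q * seqU q N k) ^ 2 * (Real.exp s * Real.exp t) = 1 ∧
        seqU q N (k - m) * Real.exp t = seqU q N (k + m) * Real.exp s := by
  have hq := A.q_pos.ne'
  have hUk := A.U_ne_zero hk
  have hUm := A.U_ne_zero hm
  rw [geodesicLine_eq_iff, headVec_toReal_mul, tailVec_toReal_mul, headVec_vertMat,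
    tailVec_vertMat, A.vecOf_chainPt hk, ← chain_zero N, act_smul, act_zpow_chain, act_zpow_chain]
  simp only [br_smul_left, br_smul_right, A.br_chain, A.chain_snd, add_zero, sub_zero,
    sub_add_cancel_right, A.U_neg]
  rw [add_comm m k]
  constructor
  · rintro ⟨h1, h2⟩
    constructor
    · field_simp at h1
      have h1' : (q : ℝ) * seqU q N m * ((q * seqU q N k) ^ 2 * (Real.exp s * Real.exp t)) =
        (q : ℝ) * seqU q N m * 1 := by linear_combination (-(q : ℝ) * seqU q N m) * h1
      exact mul_left_cancel₀ (mul_ne_zero hq hUm) h1'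
    · field_simp at h2
      linarith
  · rintro ⟨h1, h2⟩
    constructor
    · field_simp
      linear_combination -h1
    · field_simp
      linarith

/-- The coincidences of the projection of a vertical geodesic ending at a cusp of the chain. -/
theorem coincidence_iff {k : ℤ} (hk : 1 ≤ k) (s t : ℝ) :
    (s ≠ t ∧ projVertical (chainPt N k) s = projVertical (chainPt N k) t) ↔
      ∃ m : ℤ, m ≠ 0 ∧ -k < m ∧ m < k ∧
        (q * seqU q N k) ^ 2 * (Real.exp s * Real.exp t) = 1 ∧
        seqU q N (k - m) * Real.exp t = seqU q N (k + m) * Real.exp s := by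
  have hk0 : k ≠ 0 := by omega
  constructor
  · rintro ⟨hst, h⟩
    rw [projVertical_eq, projVertical_eq] at h
    obtain ⟨w, hw, h⟩ := exists_of_torusProj_eq h
    have hwΓ := A.le hw
    rcases A.vertical_meet hk0 hk0 h with hc | ⟨h1, h2⟩ | ⟨h1, h2⟩
    · obtain ⟨m, hm⟩ := A.chord_chord hwΓ hc
      rw [crossSign_of_isPow hm, A.crossSign_chain] at hc
      rw [add_zero, zero_sub, zero_sub, show k - (m + k) = -m by ring, A.U_neg, A.U_neg]
        at hc
      have hm0 : m ≠ 0 := by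
        rintro rfl
        rw [seqU_zero] at hc
        simp at hc
      -- The cross sign is `-q⁴ u_m² u_{k-m} u_{k+m}`, so a crossing means `0 < |m| < k`.
      have hpos : 0 < seqU q N (k - m) * seqU q N (k + m) := by
        by_contra hcon
        rw [not_lt] at hcon
        have : 0 ≤ (q : ℝ) ^ 4 * (seqU q N m ^ 2 * -(seqU q N (k - m) * seqU q N (k + m))) := by
          have : 0 ≤ -(seqU q N (k - m) * seqU q N (k + m)) := by linarith
          positivity
        rw [add_comm m k] at hc
        linarith
      have hlt : -k < m ∧ m < k := by
        constructor
        · by_contra hcon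
          have h1 := A.U_pos (k := k - m) (by omega)
          have h2 : seqU q N (k + m) ≤ 0 := by
            rw [← seqU_zero q N]; exact A.U_strictMono.monotone (by omega)
          nlinarith
        · by_contra hcon
          have h1 := A.U_pos (k := k + m) (by omega)
          have h2 : seqU q N (k - m) ≤ 0 := by
            rw [← seqU_zero q N]; exact A.U_strictMono.monotone (by omega)
          nlinarith
      refine ⟨m, hm0, hlt.1, hlt.2, ?_⟩
      rw [← A.zpow_meet_iff hk0 hm0]
      rcases hm with hm | hm
      · rwa [hm] at h
      · rwa [hm, geodesicLine_toReal_neg] at h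
    · exfalso
      refine trace_ne_zero_of_mem_torusGroup hw (trace_eq_zero_of_swap ?_ h1 h2)
      simp [br, vecInf, vecOf]
    · exfalso
      -- A translation that keeps the foot is trivial, and then the two times agree.
      obtain ⟨m, hm⟩ := A.stab_of_br hwΓ h1
      have h3 : br (vecOf (chainPt N k + ((3 * m : ℤ) : ℝ))) (vecOf (chainPt N k)) = 0 := by
        rw [← act_transl_vecOf]
        rcases hm with hm | hm
        · rwa [hm] at h2
        · rwa [hm, act_neg, br_neg_left, neg_eq_zero] at h2
      rw [br_vecOf] at h3
      have h5 : ((3 * m : ℤ) : ℝ) = 0 := by linarith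
      have h6 : 3 * m = 0 := by exact_mod_cast h5
      rw [h6, transl, zpow_zero] at hm
      have h7 : geodesicLine (vertMat (chainPt N k)) t = geodesicLine (vertMat (chainPt N k)) s := by
        rw [← h, ← smul_geodesicLine]
        rcases hm with hm | hm
        · rw [hm, one_smul]
        · rw [hm, ModularGroup.SL_neg_smul, one_smul]
      rw [← verticalPoint_eq, ← verticalPoint_eq] at h7
      have h8 := congrArg UpperHalfPlane.im h7
      have h9 : Real.exp t = Real.exp s := h8
      exact hst (Real.exp_injective h9).symm
  · rintro ⟨m, hm0, hm1, hm2, h1, h2⟩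
    refine ⟨?_, ?_⟩
    · rintro rfl
      have h3 := mul_right_cancel₀ (Real.exp_pos s).ne' h2
      have h4 := A.U_strictMono.injective h3
      omega
    · have h := (A.zpow_meet_iff hk0 hm0 s t).mpr ⟨h1, h2⟩
      rw [projVertical_eq, projVertical_eq, ← h]
      exact torusProj_toReal_mul (A.zpow_mem_PM m) _ t

/-- The case `k = 1` of `coincidence_iff`: no nonzero `m` has `|m| < 1`. -/
theorem injective_arc : Function.Injective (projVertical (p / q)) := by
  intro s t h
  by_contra hst
  rw [← A.chainPt_one] at h
  obtain ⟨m, h0, h1, h2, -⟩ := (A.coincidence_iff le_rfl s t).mp ⟨hst, h⟩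
  omega

/-- The number of self-intersections of a companion. -/
theorem hasSelfIntersections_chainPt {k : ℕ} (hk : 1 ≤ k) :
    HasSelfIntersections (projVertical (chainPt N k)) (k - 1) := by
  have hk' : (1 : ℤ) ≤ k := by exact_mod_cast hk
  have hq := A.q_pos
  have hUk := A.U_pos (k := k) (by omega)
  have hU : ∀ m : ℤ, -k < m → m < k → 0 < seqU q N (k - m) ∧ 0 < seqU q N (k + m) :=
    fun m h1 h2 => ⟨A.U_pos (by omega), A.U_pos (by omega)⟩
  -- The second coincidence equation reads `t - s = L m`. As `L` is odd and increasing, `m` and `-m`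
  -- exchange the two times, and the gaps for `1 ≤ m < k` are distinct.
  let L : ℤ → ℝ := fun m => Real.log (seqU q N (k + m)) - Real.log (seqU q N (k - m))
  have hLodd : ∀ m, L (-m) = -L m := by
    intro m; simp only [L, sub_neg_eq_add, ← sub_eq_add_neg]; ring
  have hLmono : ∀ m n : ℤ, -k < m → m < n → n < k → L m < L n := by
    intro m n h1 h2 h3
    have a1 := Real.log_lt_log (hU m h1 (by omega)).2 (A.U_strictMono (show (k : ℤ) + m < k + n by omega))
    have a2 := Real.log_lt_log (hU n (by omega) h3).1 (A.U_strictMono (show (k : ℤ) - n < k - m by omega))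
    simp only [L]
    linarith
  have hL0 : L 0 = 0 := by simp [L]
  refine hasSelfIntersections_of_gaps (C := -(2 * Real.log (q * seqU q N k))) (L := fun m => L m)
    ?_ ?_ ?_
  · intro m h1 h2
    have := hLmono 0 m (by omega) (by omega) (by omega)
    rwa [hL0] at this
  · intro m n h1 h2 h3
    exact hLmono m n (by omega) (by omega) (by omega)
  · intro s t
    rw [A.coincidence_iff hk']
    have hsum : (q * seqU q N k) ^ 2 * (Real.exp s * Real.exp t) = 1 ↔
        s + t = -(2 * Real.log (q * seqU q N k)) := by
      have h0 : 0 < q * seqU q N k := by positivity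
      have h1 : (q * seqU q N k) ^ 2 = Real.exp (2 * Real.log (q * seqU q N k)) := by
        rw [two_mul, Real.exp_add, Real.exp_log h0, sq]
      rw [h1, ← Real.exp_add, ← Real.exp_add, Real.exp_eq_one_iff]
      constructor <;> intro h <;> linarith
    have hdiff : ∀ m : ℤ, -k < m → m < k →
        (seqU q N (k - m) * Real.exp t = seqU q N (k + m) * Real.exp s ↔ t - s = L m) := by
      intro m h1 h2
      obtain ⟨p1, p2⟩ := hU m h1 h2
      conv_lhs => rw [← Real.exp_log p1, ← Real.exp_log p2, ← Real.exp_add, ← Real.exp_add,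
        Real.exp_eq_exp]
      simp only [L]
      constructor <;> intro h <;> linarith
    constructor
    · rintro ⟨m, h0, h1, h2, h3, h4⟩
      rw [hsum] at h3
      rw [hdiff m h1 h2] at h4
      refine ⟨h3, m.natAbs, by omega, by omega, ?_⟩
      rw [h4]
      rcases lt_or_gt_of_ne h0 with h | h
      · have := hLmono m 0 h1 h (by omega)
        rw [hL0] at this
        rw [abs_of_neg this, show ((m.natAbs : ℕ) : ℤ) = -m by omega, hLodd]
      · have := hLmono 0 m (by omega) h h2
        rw [hL0] at this
        rw [abs_of_pos this, show ((m.natAbs : ℕ) : ℤ) = m by omega]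
    · rintro ⟨h3, m, h1, h2, h4⟩
      rw [← hsum] at h3
      rcases abs_cases (t - s) with ⟨ha, -⟩ | ⟨ha, -⟩
      · refine ⟨m, by omega, by omega, by omega, h3, ?_⟩
        rw [hdiff m (by omega) (by omega)]
        linarith
      · refine ⟨-m, by omega, by omega, by omega, h3, ?_⟩
        rw [hdiff (-m) (by omega) (by omega), hLodd]
        linarith

end IsMarkovArc

/-! ### Uniqueness of the closed geodesic -/

/-- A closed geodesic is the projection of the axis of a hyperbolic element. -/
theorem exists_eigen_of_periodic {σ : SL(2, ℝ)} {l : ℝ} (hl : 0 < l)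
    (h : ∀ t, torusProj (geodesicLine σ (t + l)) = torusProj (geodesicLine σ t)) :
    ∃ w ∈ torusGroup, ∃ a : ℝ, a ≠ 0 ∧ a ^ 2 < 1 ∧ act w (headVec σ) = a • headVec σ ∧
      act w (tailVec σ) = a⁻¹ • tailVec σ := by
  choose W hW hWt using fun t => exists_of_torusProj_eq (h t).symm
  -- There are uncountably many times but only countably many matrices.
  obtain ⟨t, s, hts, hne⟩ : ∃ t s, W t = W s ∧ t ≠ s := by
    by_contra hcon
    push Not at hcon
    have hinj : Function.Injective W := fun t s hts => hcon t s hts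
    have : Countable (Matrix (Fin 2) (Fin 2) ℤ) := inferInstanceAs (Countable (Fin 2 → Fin 2 → ℤ))
    have : Countable SL(2, ℤ) := Subtype.countable
    exact not_countable hinj.countable
  obtain ⟨t1, t2⟩ := (geodesicLine_eq_iff _ _ _ _).mp (hWt t)
  obtain ⟨s1, -⟩ := (geodesicLine_eq_iff _ _ _ _).mp (hWt s)
  rw [headVec_toReal_mul, tailVec_toReal_mul] at t1 t2 s1
  rw [← hts] at s1
  set w := W t
  have hlin := br_head_tail σ
  -- The first meeting equation holds for the same `w` with the distinct factors `e^{2t+l}` and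
  -- `e^{2s+l}`.
  have h1 : br (headVec σ) (act w (headVec σ)) = 0 := by
    have h2 : br (headVec σ) (act w (headVec σ)) *
        (Real.exp t * Real.exp (t + l) - Real.exp s * Real.exp (s + l)) = 0 := by linarith
    refine (mul_eq_zero.mp h2).resolve_right ?_
    rw [← Real.exp_add, ← Real.exp_add, sub_eq_zero]
    intro h3
    have := Real.exp_injective h3
    exact hne (by linarith)
  have h2 : br (act w (tailVec σ)) (tailVec σ) = 0 := by rw [t1, h1]; ring
  have e1 : act w (headVec σ) = br (act w (headVec σ)) (tailVec σ) • headVec σ := by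
    have := eq_combination (headVec σ) (tailVec σ) (act w (headVec σ)) (by rw [hlin]; simp)
    rw [h1, hlin, zero_div, zero_smul, add_zero, div_one] at this
    exact this
  have e2 : act w (tailVec σ) = br (headVec σ) (act w (tailVec σ)) • tailVec σ := by
    have := eq_combination (headVec σ) (tailVec σ) (act w (tailVec σ)) (by rw [hlin]; simp)
    rw [h2, hlin, zero_div, zero_smul, zero_add, div_one] at this
    exact this
  set a := br (act w (headVec σ)) (tailVec σ)
  set b := br (headVec σ) (act w (tailVec σ))
  have hab : a * b = 1 := by
    have := br_act w (headVec σ) (tailVec σ)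
    rw [e1, e2, br_smul_left, br_smul_right, hlin, mul_one] at this
    exact this
  have ha : a ≠ 0 := left_ne_zero_of_mul_eq_one hab
  have hb : b = a⁻¹ := eq_inv_of_mul_eq_one_right hab
  refine ⟨w, hW t, a, ha, ?_, e1, by rw [← hb]; exact e2⟩
  have h3 : a * Real.exp l = b := by
    rw [Real.exp_add] at t2
    have := (Real.exp_pos t).ne'
    apply mul_left_cancel₀ this
    linear_combination t2
  have h4 : a ^ 2 * Real.exp l = 1 := by rw [← hab, ← h3]; ring
  have h5 : 1 < Real.exp l := Real.one_lt_exp_iff.mpr hl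
  have h6 : 0 < a ^ 2 := by positivity
  nlinarith

namespace IsMarkovArc

variable {p q : ℤ} {N E F : SL(2, ℤ)} {Γ : Subgroup SL(2, ℤ)} (A : IsMarkovArc p q N E F Γ)
include A

theorem vecInt_eq : vecInt p q = (q : ℝ) • vecOf (p / q) := by
  have := A.q_pos.ne'
  ext
  · simp only [vecInt, vecOf, Prod.smul_fst, smul_eq_mul]; field_simp
  · simp [vecInt, vecOf]

/-- For the torus group, a crossing would project to an intersection. The other elements of `Γ`
reach it, up to sign, after multiplication by `F`, which maps the arc to itself. -/
theorem crossSign_nonneg_of_disjoint {σ : SL(2, ℝ)}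
    (h : Disjoint (Set.range (projVertical (p / q)))
      (Set.range fun t => torusProj (geodesicLine σ t))) {g : SL(2, ℤ)} (hg : g ∈ Γ) :
    0 ≤ crossSign (act g (headVec σ)) (act g (tailVec σ)) vecInf (vecInt p q) := by
  have key : ∀ g ∈ torusGroupPM,
      0 ≤ crossSign (act g (headVec σ)) (act g (tailVec σ)) vecInf (vecInt p q) := by
    intro g hg
    by_contra hcon
    rw [not_le, A.vecInt_eq, ← one_smul ℝ vecInf, crossSign_smul_right] at hcon
    have hneg : crossSign (headVec (toReal g * σ)) (tailVec (toReal g * σ))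
        (headVec (vertMat (p / q))) (tailVec (vertMat (p / q))) < 0 := by
      rw [headVec_toReal_mul, tailVec_toReal_mul, headVec_vertMat, tailVec_vertMat]
      by_contra h2
      rw [not_lt] at h2
      have := mul_nonneg (sq_nonneg (1 * (q : ℝ))) h2
      linarith
    obtain ⟨t, s, hts⟩ := meet_of_crossSign hneg
    refine Set.disjoint_left.mp h ⟨s, rfl⟩ ⟨t, ?_⟩
    simp only
    rw [projVertical_eq, ← hts, torusProj_toReal_mul hg]
  rcases A.F_index g hg with h | h
  · exact key g h
  · have h1 := key _ h
    have h2 : act F (vecInt p q) = -vecInf := by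
      rw [← A.F_inv.act_vecInf, act_sq_neg (mul_self_of_trace_zero A.F_inv.trace)]
    have h3 := crossSign_act F (act g (headVec σ)) (act g (tailVec σ)) vecInf (vecInt p q)
    rw [A.F_inv.act_vecInf, h2, crossSign_neg_second, crossSign_swap_right, ← act_mul,
      ← act_mul] at h3
    rwa [← h3]

/-- Otherwise invariance of the two brackets gives `bλ^j = 1 = bλ^{-j}`, hence `b² = 1`. -/
theorem br_eq_zero_of_eigen {j : ℤ} {r : ℝ × ℝ} {b : ℝ} (hb : b ^ 2 ≠ 1)
    (h : act (N ^ j) r = b • r) :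
    br r (vecOf (axisLeft p q)) = 0 ∨ br r (vecOf (axisRight p q)) = 0 := by
  by_contra hcon
  push Not at hcon
  have h1 := br_act (N ^ j) r (vecOf (axisLeft p q))
  have h2 := br_act (N ^ j) r (vecOf (axisRight p q))
  rw [h, A.zpow_left, br_smul_left, br_smul_right] at h1
  rw [h, A.zpow_right, br_smul_left, br_smul_right] at h2
  have h3 : b * axisEigen q ^ j = 1 := by
    apply mul_right_cancel₀ hcon.1; linarith
  have h4 : b * (axisEigen q)⁻¹ ^ j = 1 := by
    apply mul_right_cancel₀ hcon.2; linarith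
  apply hb
  have h5 : axisEigen q ^ j * (axisEigen q)⁻¹ ^ j = 1 := by
    rw [← mul_zpow, mul_inv_cancel₀ A.eigen_pos.ne', one_zpow]
  calc b ^ 2 = b ^ 2 * (axisEigen q ^ j * (axisEigen q)⁻¹ ^ j) := by rw [h5, mul_one]
    _ = (b * axisEigen q ^ j) * (b * (axisEigen q)⁻¹ ^ j) := by ring
    _ = 1 := by rw [h3, h4, one_mul]

/-- The only simple closed geodesic disjoint from the arc is the projection of the axis. -/
theorem eq_axis {σ₀ : SL(2, ℝ)} (hσ₀ : IsAxisMat p q σ₀) {η : Set ModularTorus}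
    (hη : IsSimpleClosedGeodesic η) (h : Disjoint (Set.range (projVertical (p / q))) η) :
    η = Set.range fun t => torusProj (geodesicLine σ₀ t) := by
  obtain ⟨σ, l, hl, hper, rfl⟩ := hη
  obtain ⟨w, hw, a, ha, ha1, h1, h2⟩ := exists_eigen_of_periodic hl
    fun t => (hper (t + l) t).mpr ⟨1, by push_cast; ring⟩
  have hlin := br_head_tail σ
  obtain ⟨g, hg, j, hj⟩ := A.hyper w (A.le hw) (headVec σ) (tailVec σ) a
    (by rw [hlin]; exact one_ne_zero) ha ha1 h1 h2
    fun g hg => A.crossSign_nonneg_of_disjoint h hg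
  -- A conjugator in `Γ` is corrected by `E`, which only replaces `N ^ j` by `N ^ (-j)`.
  obtain ⟨g, hg, j, hj⟩ : ∃ g ∈ torusGroupPM, ∃ j : ℤ, g * w * g⁻¹ = N ^ j ∨
      g * w * g⁻¹ = -N ^ j := by
    rcases A.E_index g hg with h3 | h3
    · exact ⟨g, h3, j, hj⟩
    · refine ⟨E * g, h3, -j, ?_⟩
      have h4 : E * g * w * (E * g)⁻¹ = E * (g * w * g⁻¹) * E⁻¹ := by group
      have h5 : E * N ^ j * E⁻¹ = N ^ (-j) := by
        rw [← conj_zpow, A.E_conj, inv_zpow, zpow_neg]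
      rw [h4]
      rcases hj with hj | hj
      · left; rw [hj, h5]
      · right; rw [hj, mul_neg, neg_mul, h5]
  obtain ⟨b, hb, e1, e2⟩ : ∃ b : ℝ, b ^ 2 < 1 ∧
      act (N ^ j) (act g (headVec σ)) = b • act g (headVec σ) ∧
      act (N ^ j) (act g (tailVec σ)) = b⁻¹ • act g (tailVec σ) := by
    have e1 := conj_eigen (g := g) h1
    have e2 := conj_eigen (g := g) h2
    rcases hj with hj | hj
    · rw [hj] at e1 e2
      exact ⟨a, ha1, e1, e2⟩
    · rw [hj, act_neg, neg_eq_iff_eq_neg, ← neg_smul] at e1 e2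
      exact ⟨-a, by rwa [neg_sq], e1, by rw [e2, inv_neg]⟩
  have f1 := A.br_eq_zero_of_eigen hb.ne e1
  have f2 := A.br_eq_zero_of_eigen (by rw [inv_pow]; intro h; exact hb.ne (inv_eq_one.mp h)) e2
  have hgl : br (act g (headVec σ)) (act g (tailVec σ)) = 1 := by rw [br_act, hlin]
  have hpar : ∀ y, br (act g (headVec σ)) (vecOf y) = 0 → br (act g (tailVec σ)) (vecOf y) = 0 →
      False := by
    intro y hy1 hy2
    rw [eq_smul_of_br_vecOf hy1, eq_smul_of_br_vecOf hy2, br_smul_left, br_smul_right, br_self]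
      at hgl
    simp at hgl
  have hrange : Set.range (geodesicLine (toReal g * σ)) = Set.range (geodesicLine σ₀) := by
    apply range_geodesicLine_eq
    obtain ⟨c, hc, c1, c2⟩ := hσ₀
    rw [headVec_toReal_mul, tailVec_toReal_mul, c1, c2]
    simp only [br_smul_left, br_smul_right, mul_eq_zero, hc, false_or]
    rw [br_swap (vecOf (axisRight p q)), br_swap (vecOf (axisRight p q)), neg_eq_zero, neg_eq_zero]
    rcases f1 with f1 | f1 <;> rcases f2 with f2 | f2
    · exact (hpar _ f1 f2).elim
    · exact Or.inl ⟨f1, f2⟩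
    · exact Or.inr ⟨f1, f2⟩
    · exact (hpar _ f1 f2).elim
  have him := congrArg (fun S => torusProj '' S) hrange
  simp only [← Set.range_comp] at him
  calc _ = Set.range (torusProj ∘ geodesicLine (toReal g * σ)) := by
        congr 1; ext t; exact (torusProj_toReal_mul hg σ t).symm
    _ = _ := him

end IsMarkovArc

/-! ### The ends of vertical geodesics -/

theorem im_smul_verticalPoint (w : SL(2, ℤ)) (y t : ℝ) :
    (w • verticalPoint y t).im =
      Real.exp t / (((w 1 0 : ℝ) * y + w 1 1) ^ 2 + ((w 1 0 : ℝ) * Real.exp t) ^ 2) := by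
  rw [ModularGroup.im_smul_eq_div_normSq, ModularGroup.denom_apply]
  congr 1
  simp [Complex.normSq_apply, verticalPoint, -Complex.ofReal_exp]
  ring

theorem tendsto_projVertical_atTop (y : ℝ) :
    Filter.Tendsto (projVertical y) Filter.atTop torusCusp := by
  have h : Filter.Tendsto (verticalPoint y) Filter.atTop UpperHalfPlane.atImInfty := by
    rw [UpperHalfPlane.atImInfty, Filter.tendsto_comap_iff]
    exact Real.tendsto_exp_atTop
  exact Filter.tendsto_map.comp h

/-- A vertical geodesic that ends in a point equivalent to `∞` ends in the cusp. -/
theorem bothEndsInCusp_of_mem {w : SL(2, ℤ)} (hw : w ∈ torusGroupPM) {y : ℝ}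
    (hy : (w 1 0 : ℝ) * y + w 1 1 = 0) : BothEndsInCusp (projVertical y) := by
  refine ⟨tendsto_projVertical_atTop y, ?_⟩
  have hc : (w 1 0 : ℝ) ≠ 0 := by
    intro h
    have hd := det_entries_real w
    rw [h, zero_mul, zero_add] at hy
    rw [h, hy] at hd
    simp at hd
  have h : Filter.Tendsto (fun t => w • verticalPoint y t) Filter.atBot
      UpperHalfPlane.atImInfty := by
    rw [UpperHalfPlane.atImInfty, Filter.tendsto_comap_iff]
    have : (UpperHalfPlane.im ∘ fun t => w • verticalPoint y t) =
        fun t => ((w 1 0 : ℝ) ^ 2)⁻¹ * Real.exp (-t) := by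
      ext t
      simp only [Function.comp, im_smul_verticalPoint, hy, Real.exp_neg]
      have := Real.exp_pos t
      field_simp
      ring
    rw [this]
    exact (Real.tendsto_exp_atTop.comp Filter.tendsto_neg_atBot_atTop).const_mul_atTop
      (by positivity)
  have h2 : projVertical y = torusProj ∘ fun t => w • verticalPoint y t := by
    ext t; exact (torusProj_smul hw _).symm
  rw [h2]
  exact Filter.tendsto_map.comp h

/-- The lower end then never enters the cusp neighbourhood given by `Im z > B`. -/
theorem not_bothEndsInCusp_of_im_le {y B : ℝ}
    (h : ∀ w ∈ torusGroup, ∀ t ≤ 0, (w • verticalPoint y t).im ≤ B) :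
    ¬ BothEndsInCusp (projVertical y) := by
  rintro ⟨-, hb⟩
  have hmem : torusProj '' {z | B < z.im} ∈ torusCusp := by
    apply Filter.image_mem_map
    rw [UpperHalfPlane.atImInfty]
    exact ⟨Set.Ioi B, Filter.Ioi_mem_atTop B, fun z hz => hz⟩
  obtain ⟨t, ht, ht0⟩ := ((hb.eventually hmem).and (Filter.eventually_le_atBot 0)).exists
  obtain ⟨z, hz, hzt⟩ := ht
  obtain ⟨w, hw, rfl⟩ := (torusProj_eq_iff _ _).mp hzt
  exact absurd (h w hw t ht0) (not_le.mpr hz)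

/-- Crossing geodesic lines have intersecting projections. -/
theorem exists_torusProj_eq_of_cross {σ τ : SL(2, ℝ)} {g : SL(2, ℤ)} (hg : g ∈ torusGroupPM)
    (h : crossSign (act g (headVec σ)) (act g (tailVec σ)) (headVec τ) (tailVec τ) < 0) :
    ∃ s t, torusProj (geodesicLine σ s) = torusProj (geodesicLine τ t) := by
  rw [← headVec_toReal_mul, ← tailVec_toReal_mul] at h
  obtain ⟨s, t, hst⟩ := meet_of_crossSign h
  exact ⟨s, t, by rw [← hst, torusProj_toReal_mul hg]⟩

theorem not_disjoint_axis {p q : ℤ} {σ : SL(2, ℝ)} (hσ : IsAxisMat p q σ) {y : ℝ} (h1 : axisLeft p q < y)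
    (h2 : y < axisRight p q) : ¬ Disjoint (Set.range (projVertical y))
      (Set.range fun t => torusProj (geodesicLine σ t)) := by
  have hneg : crossSign (act 1 (headVec σ)) (act 1 (tailVec σ)) (headVec (vertMat y))
      (tailVec (vertMat y)) < 0 := by
    obtain ⟨c, hc, h⟩ := crossSign_axisMat hσ 1 (headVec (vertMat y)) (tailVec (vertMat y))
    rw [h, act_one, act_one, headVec_vertMat, tailVec_vertMat]
    refine mul_neg_of_pos_of_neg (by positivity) ?_
    simp only [crossSign, br_vecInf_right, br_vecOf]
    simp only [vecOf]
    nlinarith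
  obtain ⟨s, t, hst⟩ := exists_torusProj_eq_of_cross (one_mem _) hneg
  rw [← projVertical_eq] at hst
  exact fun h => Set.disjoint_left.mp h ⟨t, rfl⟩ ⟨s, hst⟩

namespace IsMarkovArc

variable {p q : ℤ} {N E F : SL(2, ℤ)} {Γ : Subgroup SL(2, ℤ)} (A : IsMarkovArc p q N E F Γ)
include A

theorem bothEndsInCusp_chainPt {k : ℤ} (hk : k ≠ 0) :
    BothEndsInCusp (projVertical (chainPt N k)) := by
  apply bothEndsInCusp_of_mem (A.zpow_mem_PM (-k))
  have h := act_zpow_chain N (-k) k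
  rw [neg_add_cancel, chain_zero, A.chain_eq_smul hk, act_smul] at h
  have h2 := congrArg Prod.snd h
  simp only [act, vecOf, vecInf, Prod.smul_snd, smul_eq_mul, mul_one] at h2
  exact (mul_eq_zero.mp h2).resolve_left (A.chain_snd_ne_zero hk)

/-- A quadratic irrational is badly approximable: the integral quadratic form vanishing at the ends
of the axis takes a nonzero integer value on the lower row of `w`, and this bounds the height of the
orbit. -/
theorem not_bothEndsInCusp_axisLeft : ¬ BothEndsInCusp (projVertical (axisLeft p q)) := by
  apply not_bothEndsInCusp_of_im_le (B := 5 / 2 * q)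
  intro w hw t ht
  rw [im_smul_verticalPoint]
  have h1 := A.br_vecInf_left_ne w
  have h2 := A.br_vecInf_right_ne w
  rw [br_vecInf_left] at h1 h2
  simp only [act, vecOf, mul_one] at h1 h2
  have hq := A.one_le_q
  have hT := Real.exp_pos t
  have hT1 : Real.exp t ≤ 1 := Real.exp_le_one_iff.mpr ht
  set c : ℝ := (w 1 0 : ℝ) with hc
  set d : ℝ := (w 1 1 : ℝ) with hd
  set T := Real.exp t
  set δ := c * axisLeft p q + d with hδ
  have hr := A.radius_lt
  have hr0 := A.radius_pos
  have hδ' : c * axisRight p q + d = δ + 2 * axisRadius q * c := by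
    simp only [hδ, axisLeft, axisRight]; ring
  have hint : q * (δ * (δ + 2 * axisRadius q * c)) =
      ((q * w 1 1 ^ 2 + (2 * p + 3 * q) * w 1 1 * w 1 0 + N 0 1 * w 1 0 ^ 2 : ℤ) : ℝ) := by
    push_cast
    rw [← hc, ← hd]
    have h3 := A.N_det
    have h4 := A.radius_mul
    have hq0 := A.q_pos.ne'
    have hx : (q : ℝ) * (p / q) = p := by field_simp
    apply mul_left_cancel₀ hq0
    simp only [hδ, axisLeft]
    generalize (p : ℝ) / q = x at hx ⊢
    rw [← hx] at h3 ⊢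
    linear_combination (-c ^ 2) * h3 + c ^ 2 * h4
  rw [hδ'] at h2
  have hone : 1 ≤ |(q : ℝ) * (δ * (δ + 2 * axisRadius q * c))| := by
    have hne : (q : ℝ) * (δ * (δ + 2 * axisRadius q * c)) ≠ 0 :=
      mul_ne_zero A.q_pos.ne' (mul_ne_zero h1 h2)
    rw [hint] at hne ⊢
    have h5 : (q * w 1 1 ^ 2 + (2 * p + 3 * q) * w 1 1 * w 1 0 + N 0 1 * w 1 0 ^ 2 : ℤ) ≠ 0 := by
      exact_mod_cast hne
    have h6 := Int.one_le_abs h5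
    exact_mod_cast h6
  have hle : |(q : ℝ) * (δ * (δ + 2 * axisRadius q * c))| ≤ q * (δ ^ 2 + 3 * |δ * c|) := by
    rw [abs_mul, abs_of_pos A.q_pos]
    apply mul_le_mul_of_nonneg_left _ A.q_pos.le
    have : δ * (δ + 2 * axisRadius q * c) = δ ^ 2 + 2 * axisRadius q * (δ * c) := by ring
    rw [this]
    refine (abs_add_le _ _).trans ?_
    rw [abs_of_nonneg (sq_nonneg δ), abs_mul, abs_of_pos (by linarith)]
    have := abs_nonneg (δ * c)
    nlinarith
  -- This contributes `3/2` to the constant `5/2`; the term `δ²` contributes `1`, by `T ≤ 1`.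
  have hsq : 2 * |δ * c| * T ≤ δ ^ 2 + (c * T) ^ 2 := by
    rw [abs_mul, mul_pow]
    have := sq_nonneg (|δ| - |c| * T)
    have a1 := sq_abs δ
    have a2 := sq_abs c
    nlinarith
  rw [div_le_iff₀ (by positivity)]
  have s1 : 1 * T ≤ q * (δ ^ 2 + 3 * |δ * c|) * T :=
    mul_le_mul_of_nonneg_right (hone.trans hle) hT.le
  have s2 : δ ^ 2 * T ≤ δ ^ 2 * 1 := mul_le_mul_of_nonneg_left hT1 (sq_nonneg δ)
  calc T ≤ q * (δ ^ 2 * T + 3 / 2 * (2 * |δ * c| * T)) := by linarith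
    _ ≤ q * ((δ ^ 2 + (c * T) ^ 2) + 3 / 2 * (δ ^ 2 + (c * T) ^ 2)) := by
        apply mul_le_mul_of_nonneg_left _ A.q_pos.le
        have := sq_nonneg (c * T)
        linarith
    _ = _ := by ring

/-! ### The companions -/

theorem axisLeft_sub_chainPt {k : ℤ} (hk : k ≠ 0) :
    axisLeft p q - chainPt N k = (axisEigen q)⁻¹ ^ k / (q * seqU q N k) := by
  have h := A.br_left_chain k
  rw [A.chain_eq_smul hk, br_smul_right, br_vecOf, A.chain_snd] at h
  rw [eq_div_iff (mul_ne_zero A.q_pos.ne' (A.U_ne_zero hk))]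
  linarith

theorem chainPt_lt_axisLeft {k : ℤ} (hk : 1 ≤ k) : chainPt N k < axisLeft p q := by
  rw [← sub_pos, A.axisLeft_sub_chainPt (by omega)]
  have := A.q_pos
  have := A.U_pos (k := k) (by omega)
  have := A.eigen_pos
  positivity

theorem exists_lt_chainPt {y : ℝ} (hy : y < axisLeft p q) : ∃ n : ℕ, y < chainPt N (n + 1) := by
  have hl := A.one_lt_eigen
  have hl0 := A.eigen_pos
  obtain ⟨n, hn⟩ := exists_pow_lt_of_lt_one (sub_pos.mpr hy) (inv_lt_one_of_one_lt₀ hl)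
  refine ⟨n, ?_⟩
  have h1 := A.axisLeft_sub_chainPt (k := n + 1) (by omega)
  have hU : 1 ≤ seqU q N (n + 1) := by
    obtain ⟨h2, h3⟩ := A.U_nat_aux n
    linarith
  have hqU : 1 ≤ q * seqU q N (n + 1) := one_le_mul_of_one_le_of_one_le A.one_le_q hU
  have h4 : (axisEigen q)⁻¹ ^ ((n : ℤ) + 1) / (q * seqU q N (n + 1)) ≤ (axisEigen q)⁻¹ ^ n := by
    rw [div_le_iff₀ (by linarith), zpow_add_one₀ (inv_ne_zero hl0.ne'), zpow_natCast]
    have : (axisEigen q)⁻¹ ≤ 1 := (inv_lt_one_of_one_lt₀ hl).le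
    have h5 : 0 < (axisEigen q)⁻¹ ^ n := by positivity
    apply mul_le_mul_of_nonneg_left _ h5.le
    linarith
  linarith

/-- A vertical line over the gap between two consecutive cusps crosses the edge joining them, the
translate of the arc by `N ^ k`. -/
theorem not_disjoint_of_mem_Ioo {k : ℤ} (hk : 1 ≤ k) {y : ℝ} (h1 : chainPt N k < y)
    (h2 : y < chainPt N (k + 1)) :
    ¬ Disjoint (Set.range (projVertical y)) (Set.range (projVertical (p / q))) := by
  have hneg : crossSign (act (N ^ k) (headVec (vertMat (p / q))))
      (act (N ^ k) (tailVec (vertMat (p / q)))) (headVec (vertMat y)) (tailVec (vertMat y)) < 0 := by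
    have hk0 : k ≠ 0 := by omega
    have hk1 : k + 1 ≠ 0 := by omega
    rw [headVec_vertMat, tailVec_vertMat, headVec_vertMat, tailVec_vertMat, ← A.chainPt_one,
      A.vecOf_chainPt one_ne_zero, act_smul, ← chain, act_zpow_chain, A.chain_eq_smul hk0,
      A.chain_eq_smul hk1, smul_smul, crossSign_smul_left]
    have e := A.chain_snd_ne_zero hk0
    have e1 := A.chain_snd_ne_zero hk1
    have e2 := A.chain_snd_ne_zero one_ne_zero
    refine mul_neg_of_pos_of_neg (by positivity) ?_
    simp only [crossSign, br_vecInf_right, br_vecOf]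
    simp only [vecOf]
    nlinarith
  obtain ⟨s, t, hst⟩ := exists_torusProj_eq_of_cross (A.zpow_mem_PM k) hneg
  rw [← projVertical_eq, ← projVertical_eq] at hst
  exact fun h => Set.disjoint_left.mp h ⟨t, rfl⟩ ⟨s, hst⟩

/-- The characterization of the cusps of the chain. -/
theorem exists_chainPt_iff {σ : SL(2, ℝ)} (hσ : IsAxisMat p q σ) (y : ℝ) :
    (∃ k : ℕ, 2 ≤ k ∧ y = chainPt N k) ↔
      y ∈ Set.Icc (p / q : ℝ) (p / q + 3 / 2) ∧ BothEndsInCusp (projVertical y) ∧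
        Disjoint (Set.range (projVertical y)) (Set.range (projVertical (p / q))) ∧
        Disjoint (Set.range (projVertical y))
          (Set.range fun t => torusProj (geodesicLine σ t)) := by
  have hr := A.radius_pos
  constructor
  · rintro ⟨k, hk, rfl⟩
    have hk' : (2 : ℤ) ≤ k := by exact_mod_cast hk
    have h1 := A.chainPt_lt_axisLeft (k := k) (by omega)
    rw [axisLeft] at h1
    exact ⟨⟨A.le_chainPt (by omega), by linarith⟩, A.bothEndsInCusp_chainPt (by omega),
      A.disjoint_arc hk', A.disjoint_axis hσ (by omega)⟩
  · rintro ⟨⟨h1, h2⟩, h3, h4, h5⟩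
    rcases lt_trichotomy y (axisLeft p q) with hy | rfl | hy
    · classical
      have hex := A.exists_lt_chainPt hy
      have hspec := Nat.find_spec hex
      -- The least index is not `0`, because `chainPt N 1 = p / q ≤ y`.
      obtain ⟨k, hk⟩ : ∃ k, Nat.find hex = k + 1 := by
        refine Nat.exists_eq_succ_of_ne_zero fun h => ?_
        rw [h, Nat.cast_zero, zero_add, A.chainPt_one] at hspec
        linarith
      have hmin := Nat.find_min hex (m := k) (by omega)
      rw [hk] at hspec
      push_cast at hspec
      rw [not_lt] at hmin
      rcases hmin.lt_or_eq with h | h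
      · exact (A.not_disjoint_of_mem_Ioo (by omega) h hspec h4).elim
      · refine ⟨k + 1, ?_, by rw [← h]; push_cast; rfl⟩
        -- The remaining case is `y = p / q`, whose geodesic meets itself.
        by_contra hk2
        have : k = 0 := by omega
        subst this
        rw [Nat.cast_zero, zero_add, A.chainPt_one] at h
        rw [← h] at h4
        exact Set.disjoint_left.mp h4 ⟨0, rfl⟩ ⟨0, rfl⟩
    · exact (A.not_bothEndsInCusp_axisLeft h3).elim
    -- The bound `p / q + 3 / 2` is the midpoint of the ends of the axis.
    · refine (not_disjoint_axis hσ hy ?_ h5).elim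
      rw [axisRight]; linarith

/-- The determinant of `N` is a Bézout relation for `p` and `q`. -/
theorem den_eq {x : ℚ} (hx : x = p / q) : (x.den : ℤ) = q := by
  have hcop : IsCoprime p q := by
    have h := det_entries N
    rw [A.N00, A.N11, A.N10] at h
    exact ⟨-(p + 3 * q), N 0 1, by linear_combination h⟩
  rw [hx, Rat.den_div_eq_of_coprime A.pos (Int.isCoprime_iff_nat_coprime.mp hcop)]

theorem rightGamma_eq {x : ℚ} (hx : x = p / q) {k : ℕ} (hk : 1 ≤ k) :
    (rightGamma x k : ℝ) = chainPt N k := by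
  rw [A.chainPt_eq (by omega), rightGamma]
  have h1 : ((k : ℤ) - 1) = ((k - 1 : ℕ) : ℤ) := by omega
  have h2 : ((x.den : ℤ) : ℝ) = q := by rw [A.den_eq hx]
  rw [h1, A.U_nat, A.U_nat, A.den_eq hx]
  push_cast
  rw [hx]
  push_cast
  rw [← h2, hx]
  push_cast
  rfl

end IsMarkovArc

/-! ### The reflection of the modular torus -/

/-- The reflection of the hyperbolic plane in the imaginary axis. -/
def planeRefl (z : UpperHalfPlane) : UpperHalfPlane := ⟨⟨-z.re, z.im⟩, z.im_pos⟩

/-- The conjugation of a matrix by the reflection in the imaginary axis. -/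
def reflMat {R : Type*} [CommRing R] (g : SL(2, R)) : SL(2, R) :=
  ⟨!![g 0 0, -g 0 1; -g 1 0, g 1 1], by
    rw [Matrix.det_fin_two_of]; linear_combination det_entries g⟩

theorem planeRefl_planeRefl (z : UpperHalfPlane) : planeRefl (planeRefl z) = z := by
  ext1; apply Complex.ext <;> simp [planeRefl]

theorem coe_planeRefl (z : UpperHalfPlane) :
    ((planeRefl z : UpperHalfPlane) : ℂ) = -(starRingEnd ℂ) (z : ℂ) := by
  apply Complex.ext <;> simp [planeRefl]

theorem planeRefl_smul (σ : SL(2, ℝ)) (z : UpperHalfPlane) :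
    planeRefl (σ • z) = reflMat σ • planeRefl z := by
  ext1
  rw [coe_planeRefl, UpperHalfPlane.coe_specialLinearGroup_apply,
    UpperHalfPlane.coe_specialLinearGroup_apply, coe_planeRefl]
  simp only [reflMat, map_div₀, map_add, map_mul, Complex.conj_ofReal]
  simp
  rw [← neg_div]
  congr 1
  ring

theorem planeRefl_smul_int (g : SL(2, ℤ)) (z : UpperHalfPlane) :
    planeRefl (g • z) = reflMat g • planeRefl z := by
  rw [← toReal_smul, ← toReal_smul, planeRefl_smul]
  congr 1
  apply sl_ext <;> rw [toReal_apply] <;> simp [reflMat, toReal_apply]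

theorem reflMat_mul {R : Type*} [CommRing R] (g h : SL(2, R)) :
    reflMat (g * h) = reflMat g * reflMat h := by
  apply sl_ext
  · rw [mul00]; simp [reflMat, Matrix.mul_apply, Fin.sum_univ_two]
  · rw [mul01]; simp [reflMat, Matrix.mul_apply, Fin.sum_univ_two]; ring
  · rw [mul10]; simp [reflMat, Matrix.mul_apply, Fin.sum_univ_two]; ring
  · rw [mul11]; simp [reflMat, Matrix.mul_apply, Fin.sum_univ_two]

/-- The reflection exchanges the generators `A` and `B`, so it descends to `M`. -/
theorem reflMat_mem_torusGroup {g : SL(2, ℤ)} (hg : g ∈ torusGroup) : reflMat g ∈ torusGroup := by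
  have h1 : reflMat (1 : SL(2, ℤ)) = 1 := by apply sl_ext <;> simp [reflMat]
  induction hg using Subgroup.closure_induction with
  | mem x hx =>
    rcases hx with rfl | rfl
    · have : reflMat torusMatA = torusMatB := by apply sl_ext <;> simp [reflMat, torusMatA, torusMatB]
      rw [this]; exact torusMatB_mem
    · have : reflMat torusMatB = torusMatA := by apply sl_ext <;> simp [reflMat, torusMatA, torusMatB]
      rw [this]; exact torusMatA_mem
  | one => rw [h1]; exact one_mem _
  | mul x y _ _ hx hy => rw [reflMat_mul]; exact mul_mem hx hy
  | inv x _ hx =>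
    have : reflMat x⁻¹ = (reflMat x)⁻¹ := by
      rw [eq_inv_iff_mul_eq_one, ← reflMat_mul, inv_mul_cancel, h1]
    rw [this]; exact inv_mem hx

/-- The reflection of the modular torus. -/
noncomputable def torusRefl : ModularTorus → ModularTorus :=
  Quotient.map' planeRefl fun z z' h => by
    rw [MulAction.orbitRel_apply, MulAction.mem_orbit_iff] at h ⊢
    obtain ⟨⟨g, hg⟩, rfl⟩ := h
    exact ⟨⟨reflMat g, reflMat_mem_torusGroup hg⟩, (planeRefl_smul_int g z').symm⟩

theorem torusRefl_torusProj (z : UpperHalfPlane) :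
    torusRefl (torusProj z) = torusProj (planeRefl z) := rfl

theorem torusRefl_torusRefl (P : ModularTorus) : torusRefl (torusRefl P) = P := by
  induction P using Quotient.inductionOn' with
  | h z => exact congrArg torusProj (planeRefl_planeRefl z)

theorem torusRefl_injective : Function.Injective torusRefl :=
  Function.LeftInverse.injective torusRefl_torusRefl

theorem projVertical_neg (y : ℝ) : projVertical (-y) = torusRefl ∘ projVertical y := by
  ext t
  refine congrArg torusProj ?_
  ext1; apply Complex.ext <;> simp [planeRefl, verticalPoint, UpperHalfPlane.re, UpperHalfPlane.im]

theorem range_projVertical_neg (y : ℝ) :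
    Set.range (projVertical (-y)) = torusRefl '' Set.range (projVertical y) := by
  rw [projVertical_neg, Set.range_comp]

theorem torusRefl_geodesicLine (σ : SL(2, ℝ)) (t : ℝ) :
    torusRefl (torusProj (geodesicLine σ t)) = torusProj (geodesicLine (reflMat σ) t) := by
  rw [torusRefl_torusProj, geodesicLine, planeRefl_smul, geodesicLine]
  congr 2
  ext1; apply Complex.ext <;> simp [planeRefl, verticalPoint, UpperHalfPlane.re, UpperHalfPlane.im]

theorem IsSimpleClosedGeodesic.image_torusRefl {η : Set ModularTorus}
    (h : IsSimpleClosedGeodesic η) : IsSimpleClosedGeodesic (torusRefl '' η) := by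
  obtain ⟨σ, l, hl, h, rfl⟩ := h
  refine ⟨reflMat σ, l, hl, fun s t => ?_, ?_⟩
  · rw [← h, ← torusRefl_geodesicLine, ← torusRefl_geodesicLine, torusRefl_injective.eq_iff]
  · rw [← Set.range_comp]
    congr 1; ext t
    exact torusRefl_geodesicLine σ t

theorem disjoint_projVertical_neg_iff {y : ℝ} {S : Set ModularTorus} :
    Disjoint (Set.range (projVertical (-y))) (torusRefl '' S) ↔
      Disjoint (Set.range (projVertical y)) S := by
  rw [range_projVertical_neg, Set.disjoint_image_iff torusRefl_injective]

theorem BothEndsInCusp.neg {y : ℝ} (h : BothEndsInCusp (projVertical y)) :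
    BothEndsInCusp (projVertical (-y)) := by
  have h1 : Filter.Tendsto torusRefl torusCusp torusCusp := by
    rw [torusCusp, Filter.tendsto_map'_iff]
    have : Filter.Tendsto planeRefl UpperHalfPlane.atImInfty UpperHalfPlane.atImInfty := by
      rw [UpperHalfPlane.atImInfty, Filter.tendsto_comap_iff]
      exact Filter.tendsto_comap
    exact Filter.tendsto_map.comp this
  rw [projVertical_neg]
  exact ⟨h1.comp h.1, h1.comp h.2⟩

theorem bothEndsInCusp_neg_iff {y : ℝ} :
    BothEndsInCusp (projVertical (-y)) ↔ BothEndsInCusp (projVertical y) :=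
  ⟨fun h => by simpa using h.neg, fun h => h.neg⟩

theorem HasSelfIntersections.comp {c : ℝ → ModularTorus} {n : ℕ} (h : HasSelfIntersections c n)
    {f : ModularTorus → ModularTorus} (hf : Function.Injective f) :
    HasSelfIntersections (f ∘ c) n := by
  have h1 : selfIntersections (f ∘ c) = f '' selfIntersections c := by
    ext P
    constructor
    · rintro ⟨s, t, hst, rfl, h2⟩
      exact ⟨c s, ⟨s, t, hst, rfl, hf h2⟩, rfl⟩
    · rintro ⟨P, ⟨s, t, hst, rfl, h2⟩, rfl⟩
      exact ⟨s, t, hst, rfl, congrArg f h2⟩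
  rw [HasSelfIntersections, h1, hf.encard_image]
  refine ⟨h.1, ?_⟩
  rintro _ ⟨P, hP, rfl⟩
  rw [Set.preimage_comp, ← Set.image_singleton, hf.preimage_image]
  exact h.2 P hP

/-- Negating a triple and reversing its order preserves both determinant conditions. -/
theorem IsMarkovFraction.neg {x : ℚ} (hx : IsMarkovFraction x) : IsMarkovFraction (-x) := by
  obtain ⟨x₁, x₂, x₃, ⟨p₁, p₂, p₃, q₁, q₂, q₃, ⟨h1, h2, h3, hm⟩, rfl, rfl, rfl, d1, d2⟩, hx⟩ := hx
  refine ⟨-(p₃ / q₃), -(p₂ / q₂), -(p₁ / q₁), ⟨-p₃, -p₂, -p₁, q₃, q₂, q₁,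
    ⟨h3, h2, h1, by linear_combination hm⟩, ?_, ?_, ?_, by linear_combination d2,
    by linear_combination d1⟩, ?_⟩
  · push_cast; ring
  · push_cast; ring
  · push_cast; ring
  · rcases hx with rfl | rfl | rfl <;> simp

theorem leftGamma_eq (x : ℚ) (k : ℕ) : leftGamma x k = -rightGamma (-x) k := by
  rw [leftGamma, rightGamma, Rat.den_neg_eq_den]; ring

/-! ### The main theorem -/

/-- The properties of the right companions of a Markov fraction. -/
theorem rightGamma_spec {x : ℚ} (hx : IsMarkovFraction x) :
    (Function.Injective (projVertical x) ∧ BothEndsInCusp (projVertical x)) ∧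
    (∃! η : Set ModularTorus,
      IsSimpleClosedGeodesic η ∧ Disjoint (Set.range (projVertical x)) η) ∧
    (∀ η : Set ModularTorus, IsSimpleClosedGeodesic η →
      Disjoint (Set.range (projVertical x)) η → ∀ y : ℝ,
        ((∃ k : ℕ, 2 ≤ k ∧ y = rightGamma x k) ↔
          y ∈ Set.Icc (x : ℝ) (x + 3 / 2) ∧ BothEndsInCusp (projVertical y) ∧
            Disjoint (Set.range (projVertical y)) (Set.range (projVertical x)) ∧
            Disjoint (Set.range (projVertical y)) η)) ∧
    (∀ k : ℕ, 2 ≤ k → HasSelfIntersections (projVertical (rightGamma x k)) (k - 1)) := by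
  obtain ⟨p, q, N, E, F, Γ, A, hpq⟩ := exists_isMarkovArc hx
  obtain ⟨σ, hσ⟩ := A.exists_axisMat
  have hx' : (x : ℝ) = p / q := by rw [hpq]; push_cast; rfl
  have hγ : ∀ k : ℕ, 2 ≤ k → (rightGamma x k : ℝ) = chainPt N k :=
    fun k hk => A.rightGamma_eq hpq (by omega)
  rw [hx']
  refine ⟨⟨A.injective_arc, ?_⟩, ⟨Set.range fun t => torusProj (geodesicLine σ t),
    ⟨A.isSimpleClosedGeodesic_axis hσ, ?_⟩, fun η hη => A.eq_axis hσ hη.1 hη.2⟩, ?_, ?_⟩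
  · rw [← A.chainPt_one]
    exact A.bothEndsInCusp_chainPt one_ne_zero
  · rw [← A.chainPt_one]
    exact A.disjoint_axis hσ one_ne_zero
  · intro η h1 h2 y
    rw [A.eq_axis hσ h1 h2, ← A.exists_chainPt_iff hσ y]
    refine exists_congr fun k => and_congr_right fun hk => ?_
    rw [hγ k hk]
  · intro k hk
    rw [hγ k hk]
    exact A.hasSelfIntersections_chainPt (by omega)

theorem lemma4p3 (x : ℚ) (hx : IsMarkovFraction x) :
    -- `π(g_x)` is a simple geodesic with both ends in the cusp
    (Function.Injective (projVertical x) ∧ BothEndsInCusp (projVertical x)) ∧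
    -- there is a unique simple closed geodesic that does not intersect it
    (∃! η : Set ModularTorus,
      IsSimpleClosedGeodesic η ∧ Disjoint (Set.range (projVertical x)) η) ∧
    -- the characterization of right and left companions
    (∀ η : Set ModularTorus, IsSimpleClosedGeodesic η →
      Disjoint (Set.range (projVertical x)) η → ∀ y : ℝ,
        ((∃ k : ℕ, 2 ≤ k ∧ y = rightGamma x k) ↔
          y ∈ Set.Icc (x : ℝ) (x + 3 / 2) ∧ BothEndsInCusp (projVertical y) ∧
            Disjoint (Set.range (projVertical y)) (Set.range (projVertical x)) ∧
            Disjoint (Set.range (projVertical y)) η) ∧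
        ((∃ k : ℕ, 2 ≤ k ∧ y = leftGamma x k) ↔
          y ∈ Set.Icc ((x : ℝ) - 3 / 2) x ∧ BothEndsInCusp (projVertical y) ∧
            Disjoint (Set.range (projVertical y)) (Set.range (projVertical x)) ∧
            Disjoint (Set.range (projVertical y)) η)) ∧
    -- the number of self-intersections
    (∀ k : ℕ, 2 ≤ k →
      HasSelfIntersections (projVertical (rightGamma x k)) (k - 1) ∧
      HasSelfIntersections (projVertical (leftGamma x k)) (k - 1)) := by
  obtain ⟨h1, h2, h3, h4⟩ := rightGamma_spec hx
  obtain ⟨-, -, h3', h4'⟩ := rightGamma_spec hx.neg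
  refine ⟨h1, h2, fun η hη hd y => ⟨h3 η hη hd y, ?_⟩, fun k hk => ⟨h4 k hk, ?_⟩⟩
  -- The left companions of `x` are the negatives of the right companions of `-x`; reflect `y` and
  -- `η` accordingly.
  · have h := h3' (torusRefl '' η) hη.image_torusRefl
      (by rw [Rat.cast_neg, disjoint_projVertical_neg_iff]; exact hd) (-y)
    rw [Rat.cast_neg, range_projVertical_neg x, disjoint_projVertical_neg_iff,
      disjoint_projVertical_neg_iff, bothEndsInCusp_neg_iff] at h
    have hI : -y ∈ Set.Icc (-x : ℝ) (-x + 3 / 2) ↔ y ∈ Set.Icc ((x : ℝ) - 3 / 2) x := by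
      simp only [Set.mem_Icc]
      constructor <;> rintro ⟨a, b⟩ <;> constructor <;> linarith
    rw [hI] at h
    rw [← h]
    refine exists_congr fun k => and_congr_right fun _ => ?_
    rw [leftGamma_eq, Rat.cast_neg, neg_eq_iff_eq_neg]
  · rw [leftGamma_eq, Rat.cast_neg, projVertical_neg]
    exact (h4' k hk).comp torusRefl_injective
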